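/- Let $n\ge 1$ and let $\Lambda\subset\mathbb{R}^{n+1}$ be an infinite pipe, $L$-periodic ($L>0$) in the axial variable $z=x_{n+1}$: an open set with $\Lambda+L\mathbf{e}_z=\Lambda$, with boundary of class $C^2$, with non-empty connected cross sections $\Sigma_z$, and with a bounded cell $\Lambda_{0,L}=\{(x,z)\in\Lambda: 0<z<L\}$, normalized by $|\Lambda_{0,L}|=1$. Let $L^2_*(\Lambda)$ be the space of the vector fields that are $L$-periodic in $z$ and square integrable on $\Lambda_{0,L}$, with $(\phi,\psi)=\int_{\Lambda_{0,L}}\phi\cdot\psi$ and $\|\phi\|^2=(\phi,\phi)$. Let $\mathcal{V}$ be the space of the smooth divergence-free fields, $L$-periodic in $z$, with support in $\Lambda$; let $\mathbb{H}$ be its closure in $L^2_*(\Lambda)$, $\mathbb{V}$ its closure in the $H^1(\Lambda_{0,L})$ norm, $\mathbb{P}:L^2_*(\Lambda)\to\mathbb{H}$ the orthogonal projection, and $((u,v))=\int_{\Lambda_{0,L}}\nabla u\cdot\nabla v$ for $u,v\in\mathbb{V}$. The Stokes operator $A_H$ has the domain $D(A_H)$ of all $u\in\mathbb{V}$ for which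 there is $f\in\mathbb{H}$ with $((u,v))=(f,v)$ for all $v\in\mathbb{V}$, and $A_Hu=f$. Let $\mathbf{e}_z$ be the constant unit vector field in the $z$-direction, and put $\mathbf{e}=\mathbb{P}\mathbf{e}_z/\|\mathbb{P}\mathbf{e}_z\|$. There is exactly one $\mathbf{w}\in D(A_H)$ with $A_H\mathbf{w}=\mathbf{e}$; put $C_0=\|\mathbf{w}\|$ and $C_1=(A_H\mathbf{w},\mathbf{w})^{1/2}$. Theorem. Let $T>0$, $\nu>0$, let $k\ge1$ be an integer and let $p,q$ be reals. Then the system $$\frac{2\pi k}{T}v+\nu A_Hu-\nu(A_Hu,\mathbf{e})\mathbf{e}=\frac{2\pi k}{T}\frac{L}{\|\mathbb{P}\mathbf{e}_z\|}\,q\,\mathbf{e},$$ $$-\frac{2\pi k}{T}u+\nu A_Hv-\nu(A_Hv,\mathbf{e})\mathbf{e}=-\frac{2\pi k}{T}\frac{L}{\|\mathbb{P}\mathbf{e}_z\|}\,p\,\mathbf{e}$$ has one and only one solution $(u,v)\in D(A_H)\times D(A_H)$. Moreover, $$\|A_Hu\|^2+\|A_Hv\|^2\le\tilde C\left(1+\left(\frac{2\pi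 L}{T\nu\|\mathbb{P}\mathbf{e}_z\|}\right)^2k^2\right)(p^2+q^2),$$ where, in each fixed dimension $n+1$, the constant $\tilde C$ depends only on $C_0$ and $C_1$. -/

import Mathlib

open MeasureTheory Set Filter Topology
open scoped ContDiff

noncomputable section

namespace StokesPipe

/-- The ambient space `ℝⁿ⁺¹` of the points `(x, z)`, `x ∈ ℝⁿ`; the axial variable `z` is the last
coordinate. -/
abbrev Space (n : ℕ) : Type := EuclideanSpace ℝ (Fin (n + 1))

/-- Real `(n+1) × (n+1)` matrices with the Frobenius (Hilbert-Schmidt) inner product. -/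
abbrev Mat (n : ℕ) : Type := EuclideanSpace ℝ (Fin (n + 1) × Fin (n + 1))

/-- The `i`-th vector of the standard basis. -/
def basisVec (n : ℕ) (i : Fin (n + 1)) : Space n := EuclideanSpace.single i 1

/-- The unit vector `e_z` in the axial direction. -/
def axis (n : ℕ) : Space n := basisVec n (Fin.last n)

/-- The cell `Λ_{0,L}`, the part of `Λ` with `0 < z < L`. -/
def cellOf {n : ℕ} (Λ : Set (Space n)) (L : ℝ) : Set (Space n) :=
  {y ∈ Λ | y (Fin.last n) ∈ Ioo 0 L}

/-- `Λ` has a boundary of class `C²`: near each boundary point it is the set where some `C²`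
function with non-vanishing differential is negative. -/
def HasC2Boundary {n : ℕ} (Λ : Set (Space n)) : Prop :=
  ∀ y ∈ frontier Λ, ∃ U ∈ 𝓝 y, ∃ ρ : Space n → ℝ,
    ContDiff ℝ 2 ρ ∧ fderiv ℝ ρ y ≠ 0 ∧ ∀ x ∈ U, x ∈ Λ ↔ ρ x < 0

/-- An infinite pipe in `ℝⁿ⁺¹`, `L`-periodic in the axial direction: an open set with `C²` boundary,
non-empty connected cross sections `Σ_z`, and a bounded cell `Λ_{0,L}` of measure one. -/
structure Pipe (n : ℕ) where
  /-- the set `Λ` -/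
  carrier : Set (Space n)
  /-- the axial period `L` -/
  L : ℝ
  L_pos : 0 < L
  isOpen : IsOpen carrier
  periodic : ∀ y : Space n, y + L • axis n ∈ carrier ↔ y ∈ carrier
  section_connected : ∀ z : ℝ, IsConnected {y ∈ carrier | y (Fin.last n) = z}
  boundary : HasC2Boundary carrier
  bounded : Bornology.IsBounded (cellOf carrier L)
  volume_cell : volume (cellOf carrier L) = 1

/-- The Jacobian matrix `(∂_j φ_i)_{i,j}` of a vector field. -/
def jacobian {n : ℕ} (φ : Space n → Space n) (x : Space n) : Mat n :=
  WithLp.toLp 2 fun ij => fderiv ℝ φ x (basisVec n ij.2) ij.1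

/-- The divergence of a vector field. -/
def divergence {n : ℕ} (φ : Space n → Space n) (x : Space n) : ℝ :=
  ∑ i, fderiv ℝ φ x (basisVec n i) i

namespace Pipe

variable {n : ℕ} (P : Pipe n)

/-- The cell `Λ_{0,L}`. -/
def cell : Set (Space n) := cellOf P.carrier P.L

theorem isOpen_cell : IsOpen P.cell :=
  P.isOpen.inter (isOpen_Ioo.preimage (EuclideanSpace.proj (𝕜 := ℝ) (Fin.last n)).continuous)

/-- Lebesgue measure on the cell. -/
def measure : Measure (Space n) := volume.restrict P.cell

instance : IsProbabilityMeasure P.measure :=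
  ⟨by rw [measure, Measure.restrict_apply_univ]; exact P.volume_cell⟩

/-- `L²_*(Λ)` for vector fields, with `(φ, ψ) = ∫_{Λ_{0,L}} φ · ψ`. A periodic field is identified
with its restriction to the cell; this is an isometric isomorphism, since the translates of the cell
cover `Λ` up to a null set. -/
abbrev L2 : Type := Lp (Space n) 2 P.measure

/-- `L²_*(Λ)` for matrix fields. -/
abbrev L2Mat : Type := Lp (Mat n) 2 P.measure

/-- The space `𝒱(Λ)` of the smooth divergence-free fields, `L`-periodic in `z`, with support in `Λ`
(extended by zero to all of `ℝⁿ⁺¹`). -/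
def testFields : Set (Space n → Space n) :=
  {φ | ContDiff ℝ ∞ φ ∧ Function.Periodic φ (P.L • axis n) ∧ tsupport φ ⊆ P.carrier ∧
    ∀ x, divergence φ x = 0}

/-- `ℍ(Λ)`, the closure of `𝒱(Λ)` in `L²_*(Λ)`. -/
def H : Submodule ℝ P.L2 :=
  (Submodule.span ℝ {f : P.L2 | ∃ φ ∈ P.testFields, f =ᵐ[P.measure] φ}).topologicalClosure

/-- `𝕍(Λ)`, the closure of `𝒱(Λ)` in the `H¹` norm, as the space of the pairs `(u, ∇u)`. -/
def V : Submodule ℝ (P.L2 × P.L2Mat) :=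
  (Submodule.span ℝ {f : P.L2 × P.L2Mat | ∃ φ ∈ P.testFields,
    f.1 =ᵐ[P.measure] φ ∧ f.2 =ᵐ[P.measure] jacobian φ}).topologicalClosure

instance : CompleteSpace P.H := by unfold H; infer_instance

instance : P.H.HasOrthogonalProjection := inferInstance

/-- The graph of the Stokes operator in `ℍ`: the pairs `(u, f) ∈ ℍ × ℍ` with `u ∈ 𝕍` and
`((u, v)) = (f, v)` for all `v ∈ 𝕍`, where `((u, v)) = ∫_{Λ_{0,L}} ∇u · ∇v`. -/
def stokesGraph : Submodule ℝ (P.H × P.H) where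
  carrier := {x | ∃ G : P.L2Mat, ((x.1 : P.L2), G) ∈ P.V ∧
    ∀ y ∈ P.V, inner ℝ G y.2 = inner ℝ (x.2 : P.L2) y.1}
  zero_mem' := ⟨0, P.V.zero_mem, fun y _ => by simp⟩
  add_mem' := by
    rintro a b ⟨G, hG, h⟩ ⟨G', hG', h'⟩
    refine ⟨G + G', P.V.add_mem hG hG', fun y hy => ?_⟩
    rw [inner_add_left, h y hy, h' y hy, Prod.snd_add, Submodule.coe_add, inner_add_left]
  smul_mem' := by
    rintro c a ⟨G, hG, h⟩
    refine ⟨c • G, P.V.smul_mem c hG, fun y hy => ?_⟩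
    rw [real_inner_smul_left, h y hy, Prod.smul_snd, Submodule.coe_smul, real_inner_smul_left]

/-- Continuous fields are square integrable over the cell. -/
theorem memLp_of_continuous {F : Type*} [NormedAddCommGroup F] {f : Space n → F}
    [SecondCountableTopologyEither (Space n) F] (hf : Continuous f) : MemLp f 2 P.measure := by
  have hK : IsCompact (closure P.cell) :=
    Metric.isCompact_of_isClosed_isBounded isClosed_closure P.bounded.closure
  obtain ⟨C, hC⟩ := hK.exists_bound_of_continuousOn hf.continuousOn
  have hm : MeasurableSet P.cell := P.isOpen_cell.measurableSet
  refine MemLp.of_bound hf.aestronglyMeasurable C ?_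
  exact (ae_restrict_iff' hm).2 (Eventually.of_forall fun x hx => hC x (subset_closure hx))

theorem continuous_jacobian {φ : Space n → Space n} (hφ : ContDiff ℝ ∞ φ) :
    Continuous (jacobian φ) := by
  have h : Continuous (fderiv ℝ φ) := hφ.continuous_fderiv (by simp)
  refine (PiLp.continuous_toLp 2 _).comp (continuous_pi fun ij => ?_)
  exact (EuclideanSpace.proj (𝕜 := ℝ) ij.1).continuous.comp (h.clm_apply continuous_const)

theorem test_integration_by_parts {ψ : Space n → ℝ} (hψ : ContDiff ℝ ∞ ψ)
    (hc : HasCompactSupport ψ) (hs : tsupport ψ ⊆ P.cell) {φ : Space n → Space n}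
    (hφ : ContDiff ℝ ∞ φ) (i j : Fin (n + 1)) :
    ∫ x, ψ x * jacobian φ x (i, j) ∂P.measure
      = -∫ x, fderiv ℝ ψ x (basisVec n j) * φ x i ∂P.measure := by
  have hm : MeasurableSet P.cell := P.isOpen_cell.measurableSet
  have hg : ContDiff ℝ ∞ fun x => φ x i :=
    (EuclideanSpace.proj (𝕜 := ℝ) i).contDiff.comp hφ
  have hgd : ∀ x v, fderiv ℝ (fun x => φ x i) x v = fderiv ℝ φ x v i := by
    intro x v
    have h1 : HasFDerivAt φ (fderiv ℝ φ x) x :=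
      (hφ.differentiable (by simp) x).hasFDerivAt
    have h2 := (EuclideanSpace.proj (𝕜 := ℝ) i).hasFDerivAt.comp x h1
    have h3 : fderiv ℝ (fun x => φ x i) x = _ := h2.fderiv
    rw [h3]; rfl
  have hψ' : Continuous (fderiv ℝ ψ) := hψ.continuous_fderiv (by simp)
  have hg' : Continuous (fderiv ℝ fun x => φ x i) := hg.continuous_fderiv (by simp)
  have hcd : HasCompactSupport fun x => fderiv ℝ ψ x (basisVec n j) := hc.fderiv_apply ℝ _
  have key := integral_mul_fderiv_eq_neg_fderiv_mul_of_integrable (𝕜 := ℝ) (μ := volume)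
    (f := ψ) (g := fun x => φ x i) (v := basisVec n j)
    (((hψ'.clm_apply continuous_const).mul hg.continuous).integrable_of_hasCompactSupport
      hcd.mul_right)
    ((hψ.continuous.mul (hg'.clm_apply continuous_const)).integrable_of_hasCompactSupport
      hc.mul_right)
    ((hψ.continuous.mul hg.continuous).integrable_of_hasCompactSupport hc.mul_right)
    (fun x _ => hψ.differentiable (by simp) x)
    (fun x _ => hg.differentiable (by simp) x)
  have e1 : ∫ x, ψ x * jacobian φ x (i, j) ∂P.measure
      = ∫ x, ψ x * fderiv ℝ (fun x => φ x i) x (basisVec n j) := by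
    rw [measure, setIntegral_eq_integral_of_forall_compl_eq_zero]
    · exact integral_congr_ae (Eventually.of_forall fun x => by
        simp only [hgd]; rfl)
    · intro x hx
      rw [image_eq_zero_of_notMem_tsupport fun h => hx (hs h), zero_mul]
  have e2 : ∫ x, fderiv ℝ ψ x (basisVec n j) * φ x i ∂P.measure
      = ∫ x, fderiv ℝ ψ x (basisVec n j) * φ x i := by
    rw [measure, setIntegral_eq_integral_of_forall_compl_eq_zero]
    intro x hx
    have : fderiv ℝ ψ x = 0 :=
      image_eq_zero_of_notMem_tsupport fun h => hx (hs (tsupport_fderiv_subset ℝ h))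
    rw [this]; simp
  rw [e1, e2, key]

/-- A field in `𝕍` has one gradient. -/
theorem gradient_unique {G : P.L2Mat} (hG : ((0 : P.L2), G) ∈ P.V) : G = 0 := by
  have hm : MeasurableSet P.cell := P.isOpen_cell.measurableSet
  have main : ∀ i j, ∀ᵐ x ∂volume, x ∈ P.cell → G x (i, j) = 0 := by
    intro i j
    have hGi : MemLp (fun x => G x (i, j)) 2 P.measure :=
      (EuclideanSpace.proj (𝕜 := ℝ) (i, j)).comp_memLp' (Lp.memLp G)
    refine P.isOpen_cell.ae_eq_zero_of_integral_contDiff_smul_eq_zero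
      (IntegrableOn.locallyIntegrableOn (hGi.integrable (by norm_num))) ?_
    intro ψ hψ hc hs
    have hψ' : Continuous (fderiv ℝ ψ) := hψ.continuous_fderiv (by simp)
    have hA : MemLp (fun x => ψ x • (EuclideanSpace.single (i, j) 1 : Mat n)) 2 P.measure :=
      P.memLp_of_continuous (hψ.continuous.smul continuous_const)
    have hB : MemLp (fun x => fderiv ℝ ψ x (basisVec n j) • basisVec n i) 2 P.measure :=
      P.memLp_of_continuous ((hψ'.clm_apply continuous_const).smul continuous_const)
    have ev : ∀ (f : P.L2) (M : P.L2Mat), inner ℝ hA.toLp M + inner ℝ hB.toLp f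
        = ∫ x, ψ x * M x (i, j) ∂P.measure
          + ∫ x, fderiv ℝ ψ x (basisVec n j) * f x i ∂P.measure := by
      intro f M
      rw [L2.inner_def, L2.inner_def]
      congr 1
      · refine integral_congr_ae ?_
        filter_upwards [hA.coeFn_toLp] with x hx
        rw [hx, real_inner_smul_left, EuclideanSpace.inner_single_left]; simp
      · refine integral_congr_ae ?_
        filter_upwards [hB.coeFn_toLp] with x hx
        have hb : inner ℝ (basisVec n i) (f x) = f x i := by
          rw [basisVec, EuclideanSpace.inner_single_left]; simp
        rw [hx, real_inner_smul_left, hb]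
    let K : Submodule ℝ (P.L2 × P.L2Mat) :=
      LinearMap.ker (((innerSL ℝ hA.toLp).comp (ContinuousLinearMap.snd ℝ P.L2 P.L2Mat)
        + (innerSL ℝ hB.toLp).comp (ContinuousLinearMap.fst ℝ P.L2 P.L2Mat) :
          (P.L2 × P.L2Mat) →L[ℝ] ℝ) : (P.L2 × P.L2Mat) →ₗ[ℝ] ℝ)
    have hKc : IsClosed (K : Set (P.L2 × P.L2Mat)) :=
      ContinuousLinearMap.isClosed_ker ((innerSL ℝ hA.toLp).comp
        (ContinuousLinearMap.snd ℝ P.L2 P.L2Mat)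
        + (innerSL ℝ hB.toLp).comp (ContinuousLinearMap.fst ℝ P.L2 P.L2Mat))
    have hVK : P.V ≤ K := by
      refine Submodule.topologicalClosure_minimal _ (Submodule.span_le.2 ?_) hKc
      rintro ⟨f, M⟩ ⟨φ, hφ, hf, hM⟩
      change inner ℝ hA.toLp M + inner ℝ hB.toLp f = 0
      have hM' : ∫ x, ψ x * M x (i, j) ∂P.measure
          = ∫ x, ψ x * jacobian φ x (i, j) ∂P.measure := by
        refine integral_congr_ae ?_
        filter_upwards [hM] with x hx
        exact congrArg _ (by rw [show _ = _ from hx])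
      have hf' : ∫ x, fderiv ℝ ψ x (basisVec n j) * f x i ∂P.measure
          = ∫ x, fderiv ℝ ψ x (basisVec n j) * φ x i ∂P.measure := by
        refine integral_congr_ae ?_
        filter_upwards [hf] with x hx
        exact congrArg _ (by rw [show _ = _ from hx])
      rw [ev, hM', hf', P.test_integration_by_parts hψ hc hs hφ.1, neg_add_cancel]
    have h0 : inner ℝ hA.toLp G + inner ℝ hB.toLp (0 : P.L2) = 0 := hVK hG
    have hz : ∫ x, ψ x * G x (i, j) ∂P.measure = 0 := by
      have h1 : inner ℝ hA.toLp G = ∫ x, ψ x * G x (i, j) ∂P.measure := by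
        rw [L2.inner_def]
        refine integral_congr_ae ?_
        filter_upwards [hA.coeFn_toLp] with x hx
        rw [hx, real_inner_smul_left, EuclideanSpace.inner_single_left]; simp
      rw [← h1]; simpa using h0
    change ∫ x in P.cell, ψ x * G x (i, j) = 0 at hz
    rw [setIntegral_eq_integral_of_forall_compl_eq_zero] at hz
    · exact hz
    · intro x hx
      rw [image_eq_zero_of_notMem_tsupport fun h => hx (hs h), zero_mul]
  refine Lp.ext ?_
  have h2 : ∀ᵐ x ∂P.measure, ∀ ij : Fin (n + 1) × Fin (n + 1), G x ij = 0 :=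
    ae_all_iff.2 fun ij => (ae_restrict_iff' hm).2 (main ij.1 ij.2)
  filter_upwards [h2, Lp.coeFn_zero (Mat n) 2 P.measure] with x hx h0
  rw [h0]
  ext ij
  exact hx ij

/-- The relation defining the Stokes operator is single-valued. -/
theorem stokesGraph_single_valued (x : P.H × P.H) (hx : x ∈ P.stokesGraph) (h0 : x.1 = 0) :
    x.2 = 0 := by
  obtain ⟨G, hG, h⟩ := hx
  rw [h0] at hG
  rw [P.gradient_unique hG] at h
  let K : Submodule ℝ P.L2 := LinearMap.ker ((innerSL ℝ (x.2 : P.L2) : P.L2 →L[ℝ] ℝ) : P.L2 →ₗ[ℝ] ℝ)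
  have hK : P.H ≤ K := by
    refine Submodule.topologicalClosure_minimal _ (Submodule.span_le.2 ?_)
      (ContinuousLinearMap.isClosed_ker (innerSL ℝ (x.2 : P.L2)))
    rintro f ⟨φ, hφ, hf⟩
    have hJ := P.memLp_of_continuous (continuous_jacobian hφ.1)
    have hmem : (f, hJ.toLp) ∈ P.V :=
      Submodule.le_topologicalClosure _ (Submodule.subset_span ⟨φ, hφ, hf, hJ.coeFn_toLp⟩)
    have := h _ hmem
    rw [inner_zero_left] at this
    exact this.symm
  have h1 : inner ℝ (x.2 : P.L2) (x.2 : P.L2) = 0 := hK x.2.2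
  exact Subtype.ext (inner_self_eq_zero.1 h1)

/-- The Stokes operator `A_H` with domain `D(A_H) = {u ∈ 𝕍 | A u ∈ ℍ}`. -/
def stokes : P.H →ₗ.[ℝ] P.H := P.stokesGraph.toLinearPMap

/-- The projection `ℙ e_z` of the constant field `e_z` on `ℍ`. -/
def projAxis : P.H :=
  P.H.orthogonalProjectionOnto ((memLp_const (axis n)).toLp (fun _ => axis n))

/-- The field `e = ℙ e_z / ‖ℙ e_z‖`. -/
def e : P.H := ‖P.projAxis‖⁻¹ • P.projAxis

/-- The pair `(u, v) ∈ D(A_H)²` solves the system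
`(2πk/T) v + ν A_H u - ν (A_H u, e) e = (2πk/T) (L/‖ℙ e_z‖) q e`,
`-(2πk/T) u + ν A_H v - ν (A_H v, e) e = -(2πk/T) (L/‖ℙ e_z‖) p e`. -/
def SolvesSystem (T ν : ℝ) (k : ℕ) (p q : ℝ) (uv : P.stokes.domain × P.stokes.domain) : Prop :=
  (2 * Real.pi * k / T) • (uv.2 : P.H) + ν • P.stokes uv.1
      - (ν * inner ℝ (P.stokes uv.1) P.e) • P.e
    = (2 * Real.pi * k / T * (P.L / ‖P.projAxis‖) * q) • P.e ∧
  -((2 * Real.pi * k / T) • (uv.1 : P.H)) + ν • P.stokes uv.2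
      - (ν * inner ℝ (P.stokes uv.2) P.e) • P.e
    = -((2 * Real.pi * k / T * (P.L / ‖P.projAxis‖) * p) • P.e)

end Pipe

end StokesPipe

end

/-! Put a = 2πk/(Tν) and m = L/‖ℙe_z‖. If ℙe_z ≠ 0, the system says Au + av = s e, Av − au = t e
with unknown multipliers s, t and prescribed fluxes (u, e) = mp, (v, e) = mq (`exists_multiplier`).
With z = u + iv this is (A − ia)z = (s + it)e, so one resolvent solution, multiplied by a suitable
complex number, meets any two fluxes. Pairing with w gives C₁²s = mp + a(v, w) and C₁²t = mq − a(u,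
w); the energy identity a(‖u‖² + ‖v‖²) = s·mq − t·mp then closes a quadratic inequality for |(s, t)|
(`multiplier_bound`). By symmetry of A, ‖Au‖² + ‖Av‖² ≤ s² + t² (`resolvent_graph_norm`). The
outcome is a multiple of (m + (C₀²/C₁²)am)²(p² + q²). The term am is in the claim; the lone m is
not.

Hence the main work is to bound m by C₀, C₁ and n, uniformly over all pipes (`exists_flux_bound`).
The periodic extension g of e has norm one, and its product with a test field is m/L times the flux
of that field. A test field φ close to w has ‖φ‖ and ‖∇φ‖ under control, and (g, φ) ≥ C₁²/2.

If L is small, φ is small in mean square off the vertical lines that stay in its support, because it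
has a zero on every other line. The set of the remaining lines carries an axial test field, and
testing g with it shows that this set has measure at most (L/m)². So m cannot be large
(`IsDrive.flux_le_of_short`).

If L is not small, g is mollified to E. Along compactly supported fields that move a mollified mass
from x to y, the product with g is determined by x and y up to multiples of m, since a closed
transport periodizes to a test field. So E/m is the gradient of a phase θ defined modulo the
integers. For a 1-periodic bump χ of width 1/N, the field χ(θ)φ retains exactly the fraction κ/N of
the product with E, because χ − κ/N is a derivative and div φ = 0. Among N disjoint bumps one sees
at most 1/N of the energy. If m > cN the gradient of that piece is under control, and a Poincaré
inequality for small supports makes its product with E much smaller than κ/N: a contradiction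
(`IsPhase.modulation_estimate`). -/

noncomputable section

namespace StokesPipe

/-! ### The projected resolvent system of a symmetric operator -/

section Abstract

variable {E : Type*} [NormedAddCommGroup E] [InnerProductSpace ℝ E]

/-- A bounded symmetric operator `S` admits solutions of `x + a² S² x = f`. -/
theorem exists_add_sq_apply_eq [CompleteSpace E] (S : E →L[ℝ] E)
    (hS : ∀ x y, inner ℝ (S x) y = inner ℝ x (S y)) (a : ℝ) (f : E) :
    ∃ x, x + a ^ 2 • S (S x) = f := by
  let B : E →L[ℝ] E →L[ℝ] ℝ := innerSL ℝ + a ^ 2 • ((innerSL ℝ).comp (S.comp S))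
  have hB : ∀ x y, B x y = inner ℝ (x + a ^ 2 • S (S x)) y := by
    intro x y
    simp only [B, add_apply, smul_apply, ContinuousLinearMap.comp_apply, innerSL_apply_apply,
      inner_add_left, real_inner_smul_left, smul_eq_mul]
    rfl
  have hc : IsCoercive B := by
    refine ⟨1, one_pos, fun x => ?_⟩
    rw [hB, inner_add_left, real_inner_smul_left, hS, real_inner_self_eq_norm_mul_norm,
      real_inner_self_eq_norm_mul_norm]
    nlinarith [mul_nonneg (sq_nonneg a) (mul_self_nonneg ‖S x‖)]
  refine ⟨hc.continuousLinearEquivOfBilin.symm f, ?_⟩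
  refine ext_inner_right ℝ fun y => ?_
  rw [← hB, ← hc.continuousLinearEquivOfBilin_apply, ContinuousLinearEquiv.apply_symm_apply]

variable {A : E →ₗ.[ℝ] E}

/-- Solvability of the rotated resolvent system of a symmetric operator with bounded inverse. -/
theorem exists_resolvent_pair [CompleteSpace E] (S : E →L[ℝ] E)
    (hS : ∀ x y, inner ℝ (S x) y = inner ℝ x (S y))
    (hA : ∀ f, ∃ u : A.domain, (u : E) = S f ∧ A u = f) (a : ℝ) (f g : E) :
    ∃ u v : A.domain, A u + a • (v : E) = f ∧ A v - a • (u : E) = g := by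
  obtain ⟨y, hy⟩ := exists_add_sq_apply_eq S hS a (S g + a • S (S f))
  obtain ⟨u, hu, hAu⟩ := hA (f - a • y)
  obtain ⟨v, hv, hAv⟩ := hA (g + a • (u : E))
  have hvy : (v : E) = y := by
    rw [hv, hu]
    simp only [map_add, map_sub, map_smul, smul_sub, smul_smul, ← sq]
    rw [← add_sub_assoc, ← hy]; abel
  exact ⟨u, v, by rw [hAu, hvy]; abel, by rw [hAv]; abel⟩

/-- Pairing the first equation with v and the second with u, the terms with `A` cancel in the
difference by symmetry. -/
theorem resolvent_energy
    (hsym : ∀ u v : A.domain, inner ℝ (A u) (v : E) = inner ℝ (u : E) (A v))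
    {a : ℝ} {u v : A.domain} {f g : E} (h1 : A u + a • (v : E) = f)
    (h2 : A v - a • (u : E) = g) :
    a * (‖(u : E)‖ ^ 2 + ‖(v : E)‖ ^ 2) = inner ℝ f (v : E) - inner ℝ g (u : E) := by
  rw [← h1, ← h2, inner_add_left, inner_sub_left, real_inner_smul_left, real_inner_smul_left,
    real_inner_self_eq_norm_sq, real_inner_self_eq_norm_sq, hsym u v, real_inner_comm]
  ring

/-- In ‖Au + av‖² + ‖Av − au‖² the cross terms 2a(Au, v) and −2a(Av, u) cancel by symmetry. -/
theorem resolvent_graph_norm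
    (hsym : ∀ u v : A.domain, inner ℝ (A u) (v : E) = inner ℝ (u : E) (A v))
    {a : ℝ} {u v : A.domain} {f g : E} (h1 : A u + a • (v : E) = f)
    (h2 : A v - a • (u : E) = g) :
    ‖A u‖ ^ 2 + ‖A v‖ ^ 2 ≤ ‖f‖ ^ 2 + ‖g‖ ^ 2 := by
  rw [← h1, ← h2, norm_add_sq_real, norm_sub_sq_real, real_inner_smul_right,
    real_inner_smul_right, hsym u v, real_inner_comm (u : E) (A v)]
  nlinarith [sq_nonneg ‖a • (v : E)‖, sq_nonneg ‖a • (u : E)‖]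

/-- The projected system, written with an unknown multiple of `e`, forces the two fluxes. -/
theorem exists_multiplier {e : E} (he : ‖e‖ = 1) {a : ℝ} (ha : a ≠ 0) {b b' : ℝ}
    {u v : A.domain} :
    (a • (v : E) + A u - (inner ℝ (A u) e : ℝ) • e = (a * b') • e ∧
      -(a • (u : E)) + A v - (inner ℝ (A v) e : ℝ) • e = -((a * b) • e)) ↔
    ((inner ℝ (u : E) e = b ∧ inner ℝ (v : E) e = b') ∧
      ∃ s t : ℝ, A u + a • (v : E) = s • e ∧ A v - a • (u : E) = t • e) := by
  have hee : inner ℝ e e = (1 : ℝ) := by rw [real_inner_self_eq_norm_sq, he]; norm_num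
  constructor
  · rintro ⟨h1, h2⟩
    -- Paired with the unit vector e, the projected `A`-terms drop out and only the fluxes remain.
    have i1 := congrArg (fun x => inner ℝ x e) h1
    have i2 := congrArg (fun x => inner ℝ x e) h2
    simp only [inner_add_left, inner_sub_left, inner_neg_left, real_inner_smul_left, hee] at i1 i2
    refine ⟨⟨mul_left_cancel₀ ha (by linarith), mul_left_cancel₀ ha (by linarith)⟩,
      inner ℝ (A u) e + a * b', inner ℝ (A v) e - a * b, ?_, ?_⟩
    · rw [add_smul, ← h1]; abel
    · rw [sub_smul, sub_eq_add_neg (_ • e), ← h2]; abel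
  · rintro ⟨⟨hu, hv⟩, s, t, h1, h2⟩
    have i1 := congrArg (fun x => inner ℝ x e) h1
    have i2 := congrArg (fun x => inner ℝ x e) h2
    simp only [inner_add_left, inner_sub_left, real_inner_smul_left, hee, hu, hv] at i1 i2
    constructor
    · rw [add_comm, h1, ← sub_smul]; congr 1; linarith
    · rw [neg_add_eq_sub, h2, ← sub_smul, ← neg_smul]; congr 1; linarith

/-- With z = u + iv the equations read (A − ia)z = (s + it)e. One solution z₀ for the right-hand
side e suffices: (s + it)z₀ solves the equation for (s + it)e, and its flux is (s + it)(x + iy),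
where x + iy is the flux of z₀. This can be set to b + ib' as soon as x + iy ≠ 0. -/
theorem exists_projected_solution [CompleteSpace E]
    (hsym : ∀ u v : A.domain, inner ℝ (A u) (v : E) = inner ℝ (u : E) (A v))
    (S : E →L[ℝ] E)
    (hS : ∀ x y, inner ℝ (S x) y = inner ℝ x (S y))
    (hA : ∀ f, ∃ u : A.domain, (u : E) = S f ∧ A u = f) {e : E} (he : ‖e‖ = 1) {a : ℝ}
    (ha : a ≠ 0) (b b' : ℝ) :
    ∃ u v : A.domain, (inner ℝ (u : E) e = b ∧ inner ℝ (v : E) e = b') ∧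
      ∃ s t : ℝ, A u + a • (v : E) = s • e ∧ A v - a • (u : E) = t • e := by
  obtain ⟨u, v, h1, h2⟩ := exists_resolvent_pair S hS hA a e 0
  set x : ℝ := inner ℝ (u : E) e
  set y : ℝ := inner ℝ (v : E) e with hy
  -- The energy identity with right-hand sides e and 0 reads a(‖u‖² + ‖v‖²) = y, so a zero flux
  -- would force u = v = 0 and hence e = 0.
  have hd : x ^ 2 + y ^ 2 ≠ 0 := by
    intro h0
    have hy0 : y = 0 := by nlinarith [sq_nonneg x, sq_nonneg y]
    have h := resolvent_energy hsym h1 h2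
    rw [inner_zero_left, real_inner_comm, ← hy, hy0, sub_zero] at h
    have h' := (mul_eq_zero.1 h).resolve_left ha
    have hu : (u : E) = 0 := by
      rw [← norm_eq_zero]; nlinarith [sq_nonneg ‖(u : E)‖, sq_nonneg ‖(v : E)‖]
    have hv : (v : E) = 0 := by
      rw [← norm_eq_zero]; nlinarith [sq_nonneg ‖(u : E)‖, sq_nonneg ‖(v : E)‖]
    have hu' : u = 0 := Subtype.ext hu
    rw [hu', hv, LinearPMap.map_zero, smul_zero, add_zero] at h1
    rw [← h1, norm_zero] at he
    exact zero_ne_one he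
  -- Real and imaginary part of (b + ib')/(x + iy).
  set s := (b * x + b' * y) / (x ^ 2 + y ^ 2) with hs
  set t := (b' * x - b * y) / (x ^ 2 + y ^ 2) with ht
  refine ⟨s • u - t • v, s • v + t • u, ⟨?_, ?_⟩, s, t, ?_, ?_⟩
  · push_cast
    rw [inner_sub_left, real_inner_smul_left, real_inner_smul_left]
    change s * x - t * y = b
    rw [hs, ht]; field_simp; ring
  · push_cast
    rw [inner_add_left, real_inner_smul_left, real_inner_smul_left]
    change s * y + t * x = b'
    rw [hs, ht]; field_simp; ring
  · rw [LinearPMap.map_sub, LinearPMap.map_smul, LinearPMap.map_smul, ← h1,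
      sub_eq_zero.1 h2]
    push_cast
    module
  · rw [LinearPMap.map_add, LinearPMap.map_smul, LinearPMap.map_smul, ← h1,
      sub_eq_zero.1 h2]
    push_cast
    module

/-- The multiplier estimate: `w` solves `A w = e`, and `b, b'` are the fluxes. -/
theorem multiplier_bound
    (hsym : ∀ u v : A.domain, inner ℝ (A u) (v : E) = inner ℝ (u : E) (A v))
    {e : E} {w : A.domain} (hw : A w = e) {c₀ c : ℝ}
    (h0 : ‖(w : E)‖ ≤ c₀) (hc : inner ℝ e (w : E) = c) (hcpos : 0 < c) {a : ℝ} (ha : 0 ≤ a)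
    {b b' : ℝ} {u v : A.domain} (hu : inner ℝ (u : E) e = b) (hv : inner ℝ (v : E) e = b')
    {s t : ℝ} (h1 : A u + a • (v : E) = s • e) (h2 : A v - a • (u : E) = t • e) :
    c ^ 2 * (s ^ 2 + t ^ 2) ≤ 4 * (b ^ 2 + b' ^ 2) * (1 + (c₀ ^ 2 / c) * a) ^ 2 := by
  have hen := resolvent_energy hsym h1 h2
  rw [real_inner_smul_left, real_inner_smul_left, real_inner_comm, hv, real_inner_comm, hu] at hen
  -- Pairing with w turns (Au, w) into (u, e), which is the given flux.
  have hsw : s * c = b + a * inner ℝ (v : E) (w : E) := by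
    have := congrArg (fun x => inner ℝ x (w : E)) h1
    simp only [inner_add_left, real_inner_smul_left, hc, hsym u w, hw, hu] at this
    linarith
  have htw : t * c = b' - a * inner ℝ (u : E) (w : E) := by
    have := congrArg (fun x => inner ℝ x (w : E)) h2
    simp only [inner_sub_left, real_inner_smul_left, hc, hsym v w, hw, hv] at this
    linarith
  have c0 : 0 ≤ c₀ := (norm_nonneg _).trans h0
  have cs : ∀ z : E, (inner ℝ z (w : E)) ^ 2 ≤ ‖z‖ ^ 2 * c₀ ^ 2 := by
    intro z
    rw [← mul_pow, ← sq_abs]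
    exact pow_le_pow_left₀ (abs_nonneg _)
      ((abs_real_inner_le_norm _ _).trans (mul_le_mul_of_nonneg_left h0 (norm_nonneg _))) 2
  set X : ℝ := inner ℝ (v : E) (w : E)
  set Y : ℝ := inner ℝ (u : E) (w : E)
  have hXY : X ^ 2 + Y ^ 2 ≤ (‖(u : E)‖ ^ 2 + ‖(v : E)‖ ^ 2) * c₀ ^ 2 := by
    have := cs v; have := cs u; linarith
  set y := s ^ 2 + t ^ 2 with hy
  set p := b ^ 2 + b' ^ 2 with hp
  have hy0 : 0 ≤ y := by positivity
  have hp0 : 0 ≤ p := by positivity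
  -- Lagrange's identity: (sb' − tb)² + (sb + tb')² = (s² + t²)(b² + b'²).
  have hcross : (s * b' - t * b) ≤ √y * √p := by
    rw [← Real.sqrt_mul hy0]
    refine Real.le_sqrt_of_sq_le ?_
    rw [hy, hp]; nlinarith [sq_nonneg (s * b + t * b')]
  have hZ : a * (X ^ 2 + Y ^ 2) ≤ √y * √p * c₀ ^ 2 := by
    calc a * (X ^ 2 + Y ^ 2) ≤ a * ((‖(u : E)‖ ^ 2 + ‖(v : E)‖ ^ 2) * c₀ ^ 2) := by gcongr
      _ = (s * b' - t * b) * c₀ ^ 2 := by rw [← mul_assoc, hen]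
      _ ≤ _ := by gcongr
  have hmain : c ^ 2 * y ≤ 2 * p + 2 * a * (√y * √p * c₀ ^ 2) := by
    have e1 : c ^ 2 * y = (b + a * X) ^ 2 + (b' - a * Y) ^ 2 := by rw [← hsw, ← htw, hy]; ring
    rw [e1, hp]
    nlinarith [sq_nonneg (b - a * X), sq_nonneg (b' + a * Y), mul_le_mul_of_nonneg_left hZ ha]
  set r := √y with hr
  set σ := √p with hσ
  have hr0 : 0 ≤ r := Real.sqrt_nonneg _
  have hσ0 : 0 ≤ σ := Real.sqrt_nonneg _
  have hry : y = r ^ 2 := (Real.sq_sqrt hy0).symm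
  have hσp : p = σ ^ 2 := (Real.sq_sqrt hp0).symm
  rw [hry, hσp] at hmain ⊢
  have hK : 0 ≤ c₀ ^ 2 / c * a := by positivity
  set K := c₀ ^ 2 / c * a with hKdef
  have hKc : a * c₀ ^ 2 = K * c := by rw [hKdef]; field_simp
  have hq : (c * r) ^ 2 ≤ 2 * σ ^ 2 + 2 * (c * r) * σ * K := by
    have : 2 * a * (r * σ * c₀ ^ 2) = 2 * (c * r) * σ * K := by
      linear_combination 2 * r * σ * hKc
    nlinarith
  -- For x = cr the inequality x² ≤ 2σ² + 2σKx fails once x > 2σ(1 + K), since then x² > 2σx + 2σKx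
  -- and 2σx ≥ 2σ².
  have hlin : c * r ≤ 2 * σ * (1 + K) := by
    by_contra hlt
    push Not at hlt
    nlinarith [mul_nonneg hσ0 hK, mul_nonneg hcpos.le hr0]
  calc c ^ 2 * r ^ 2 = (c * r) ^ 2 := by ring
    _ ≤ (2 * σ * (1 + K)) ^ 2 := pow_le_pow_left₀ (by positivity) hlin 2
    _ = _ := by ring

end Abstract

/-! ### Periodic functions on a slab of one period -/

section Strip

variable {n : ℕ}

/-- The half-open slab `a < z ≤ a + L`. -/
def slab (n : ℕ) (a L : ℝ) : Set (Space n) := {x | x (Fin.last n) ∈ Ioc a (a + L)}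

theorem measurable_coord (i : Fin (n + 1)) : Measurable fun x : Space n => x i :=
  (EuclideanSpace.proj (𝕜 := ℝ) i).continuous.measurable

theorem measurableSet_slab (a L : ℝ) : MeasurableSet (slab n a L) :=
  measurable_coord _ measurableSet_Ioc

theorem axis_last : (axis n) (Fin.last n) = 1 := by simp [axis, basisVec]

theorem axis_ne_last {i : Fin (n + 1)} (hi : i ≠ Fin.last n) : (axis n) i = 0 := by
  simp [axis, basisVec, hi]

theorem basisVec_apply (i j : Fin (n + 1)) : basisVec n i j = if j = i then 1 else 0 := by
  simp [basisVec]

theorem volume_coord_eq (i : Fin (n + 1)) (c : ℝ) : volume {x : Space n | x i = c} = 0 := by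
  have h := (PiLp.volume_preserving_ofLp (Fin (n + 1))).measure_preimage
    (s := {f : Fin (n + 1) → ℝ | f i = c})
    (measurableSet_eq_fun (measurable_pi_apply i) measurable_const).nullMeasurableSet
  have h2 := Measure.pi_hyperplane (fun _ : Fin (n + 1) => (volume : Measure ℝ)) i c
  rw [volume_pi] at h
  exact h.trans h2

/-- The cell is cut by an open interval, the fundamental domain by a half-open one; they differ by a
hyperplane, which is null. -/
theorem restrict_slab_zero (L : ℝ) : (volume : Measure (Space n)).restrict
    {x | x (Fin.last n) ∈ Ioo 0 L} = volume.restrict (slab n 0 L) := by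
  refine Measure.restrict_congr_set ?_
  have h0 : ∀ᵐ x : Space n, x (Fin.last n) ≠ L := by
    rw [ae_iff]; simpa using volume_coord_eq (Fin.last n) L
  filter_upwards [h0] with x hx
  refine propext ⟨fun h => ⟨h.1, by simpa using h.2.le⟩, fun h => ⟨h.1, ?_⟩⟩
  exact lt_of_le_of_ne (by simpa using h.2) hx

theorem isAddFundamentalDomain_slab {L : ℝ} (hL : 0 < L) (a : ℝ) :
    IsAddFundamentalDomain (AddSubgroup.zmultiples (L • axis n)) (slab n a L) volume := by
  refine IsAddFundamentalDomain.mk' (measurableSet_slab a L).nullMeasurableSet fun x => ?_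
  have hinj : Function.Injective fun k : ℤ => k • (L • axis n) := by
    intro k k' h
    have := congrArg (fun y : Space n => y (Fin.last n)) h
    simp [axis_last] at this
    exact this.resolve_right hL.ne'
  have : Function.Bijective (codRestrict (fun k : ℤ => k • (L • axis n))
      (AddSubgroup.zmultiples (L • axis n)) fun k => ⟨k, rfl⟩) :=
    (Equiv.ofInjective _ hinj).bijective
  refine this.existsUnique_iff.2 ?_
  have h := existsUnique_add_zsmul_mem_Ioc hL (x (Fin.last n)) a
  refine (existsUnique_congr fun k => ?_).1 h
  change _ ↔ (k • (L • axis n) + x) (Fin.last n) ∈ Ioc a (a + L)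
  have : (k • (L • axis n) + x) (Fin.last n) = x (Fin.last n) + k • L := by
    simp [axis_last, add_comm]
  rw [this]

theorem periodic_vadd {L : ℝ} {β : Type*} {F : Space n → β} (hF : Function.Periodic F (L • axis n))
    (g : AddSubgroup.zmultiples (L • axis n)) (x : Space n) : F (g +ᵥ x) = F x := by
  obtain ⟨_, k, rfl⟩ := g
  change F (k • (L • axis n) + x) = F x
  rw [add_comm]
  exact hF.zsmul k x

/-- Integration over one period. -/
abbrev period (n : ℕ) (L : ℝ) : Measure (Space n) := volume.restrict (slab n 0 L)

theorem lintegral_slab {L : ℝ} (hL : 0 < L) (a : ℝ) {F : Space n → ENNReal}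
    (hF : Function.Periodic F (L • axis n)) :
    ∫⁻ x in slab n a L, F x = ∫⁻ x, F x ∂period n L :=
  (isAddFundamentalDomain_slab hL a).setLIntegral_eq (isAddFundamentalDomain_slab hL 0) F
    (periodic_vadd hF)

theorem slab_preimage_add (a L : ℝ) (h : Space n) :
    (fun x => x + h) ⁻¹' slab n (a + h (Fin.last n)) L = slab n a L := by
  ext x
  simp only [slab, mem_preimage, mem_ofPred_eq, mem_Ioc, PiLp.add_apply]
  constructor <;> rintro ⟨h1, h2⟩ <;> constructor <;> linarith

/-- A translation carries the slab to another slab of height L, which is again a fundamental domain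
of the axial translations. -/
theorem lintegral_period_add {L : ℝ} (hL : 0 < L) {F : Space n → ENNReal}
    (hF : Function.Periodic F (L • axis n)) (h : Space n) :
    ∫⁻ x, F (x + h) ∂period n L = ∫⁻ x, F x ∂period n L := by
  rw [← lintegral_slab hL (0 + h (Fin.last n)) hF, period, ← slab_preimage_add 0 L h]
  exact (measurePreserving_add_right volume h).setLIntegral_comp_preimage_emb
    (measurableEmbedding_addRight h) F _

theorem integral_period_add {L : ℝ} (hL : 0 < L) {G : Type*} [NormedAddCommGroup G]
    [NormedSpace ℝ G] {F : Space n → G}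
    (hF : Function.Periodic F (L • axis n)) (h : Space n) :
    ∫ x, F (x + h) ∂period n L = ∫ x, F x ∂period n L := by
  have := (isAddFundamentalDomain_slab hL (0 + h (Fin.last n))).setIntegral_eq
    (isAddFundamentalDomain_slab (n := n) hL 0) (periodic_vadd hF)
  rw [period, ← this]
  conv_lhs => rw [← slab_preimage_add 0 L h]
  exact (measurePreserving_add_right volume h).setIntegral_preimage_emb
    (measurableEmbedding_addRight h) F _

theorem sq_lintegral_mul_le {α : Type*} [MeasurableSpace α] (μ : Measure α) {f g : α → ENNReal}
    (hf : AEMeasurable f μ) (hg : AEMeasurable g μ) :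
    (∫⁻ x, f x * g x ∂μ) ^ 2 ≤ (∫⁻ x, f x ^ 2 ∂μ) * ∫⁻ x, g x ^ 2 ∂μ := by
  have h := ENNReal.lintegral_mul_le_Lp_mul_Lq μ Real.HolderConjugate.two_two hf hg
  simp only [Pi.mul_apply, ENNReal.rpow_two] at h
  calc _ ≤ _ := pow_le_pow_left' h 2
    _ = _ := by
      rw [mul_pow, ← ENNReal.rpow_natCast, ← ENNReal.rpow_mul, ← ENNReal.rpow_natCast,
        ← ENNReal.rpow_mul]
      norm_num

variable {G : Type*} [NormedAddCommGroup G] [NormedSpace ℝ G]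

theorem enorm_add_smul_sub_le {f : Space n → G} (hf : ContDiff ℝ 1 f) (x h : Space n) {T : ℝ}
    (hT : 0 ≤ T) :
    ‖f (x + T • h) - f x‖ₑ ≤ ∫⁻ t in Icc (0 : ℝ) T, ‖fderiv ℝ f (x + t • h)‖ₑ * ‖h‖ₑ := by
  have hl : ContDiff ℝ 1 fun t : ℝ => f (x + t • h) := by fun_prop
  have hd : ∀ t : ℝ, deriv (fun t : ℝ => f (x + t • h)) t = fderiv ℝ f (x + t • h) h := by
    intro t
    have h1 : HasDerivAt (fun t : ℝ => x + t • h) h t := by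
      simpa using ((hasDerivAt_id t).smul_const h).const_add x
    exact (((hf.differentiable (by simp)) (x + t • h)).hasFDerivAt.comp_hasDerivAt t h1).deriv
  have := enorm_sub_le_lintegral_deriv_of_contDiffOn_Icc (a := 0) (b := T) hl.contDiffOn hT
  simp only [zero_smul, add_zero, hd] at this
  refine this.trans (lintegral_mono fun t => ?_)
  exact ContinuousLinearMap.le_opENorm _ _

theorem enorm_add_sub_le {f : Space n → G} (hf : ContDiff ℝ 1 f) (x h : Space n) :
    ‖f (x + h) - f x‖ₑ ≤ ∫⁻ t in Icc (0 : ℝ) 1, ‖fderiv ℝ f (x + t • h)‖ₑ * ‖h‖ₑ := by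
  simpa using enorm_add_smul_sub_le hf x h zero_le_one

theorem measurable_enorm_fderiv_add {f : Space n → G} (hf : ContDiff ℝ 1 f) (h : Space n) :
    Measurable fun p : Space n × ℝ => ‖fderiv ℝ f (p.1 + p.2 • h)‖ₑ := by
  have : Continuous (fderiv ℝ f) := hf.continuous_fderiv (by simp)
  have h2 : Continuous fun p : Space n × ℝ => fderiv ℝ f (p.1 + p.2 • h) := by fun_prop
  exact h2.enorm.measurable

theorem periodic_fderiv {L : ℝ} {f : Space n → G} (hp : Function.Periodic f (L • axis n)) :
    Function.Periodic (fderiv ℝ f) (L • axis n) := by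
  intro x
  rw [← fderiv_comp_add_right]
  congr 1
  exact funext hp

/-- The difference is at most the integral of |∇f||h| along the segment. By Fubini each point of the
segment contributes a translate of |∇f|, whose integral over a period does not depend on the
translation. -/
theorem lintegral_translate_sub_le {L : ℝ} (hL : 0 < L) {f : Space n → G} (hf : ContDiff ℝ 1 f)
    (hp : Function.Periodic f (L • axis n)) (h : Space n) :
    ∫⁻ x, ‖f (x + h) - f x‖ₑ ∂period n L ≤ ‖h‖ₑ * ∫⁻ x, ‖fderiv ℝ f x‖ₑ ∂period n L := by
  calc _ ≤ ∫⁻ x, (∫⁻ t in Icc (0 : ℝ) 1, ‖fderiv ℝ f (x + t • h)‖ₑ * ‖h‖ₑ) ∂period n L :=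
        lintegral_mono fun x => enorm_add_sub_le hf x h
    _ = ∫⁻ t in Icc (0 : ℝ) 1, ∫⁻ x, ‖fderiv ℝ f (x + t • h)‖ₑ * ‖h‖ₑ ∂period n L := by
        refine lintegral_lintegral_swap (Measurable.aemeasurable ?_)
        exact (measurable_enorm_fderiv_add hf h).mul_const _
    _ = ∫⁻ t in Icc (0 : ℝ) 1, ∫⁻ x, ‖fderiv ℝ f x‖ₑ * ‖h‖ₑ ∂period n L := by
        congr 1; funext t
        exact lintegral_period_add hL (F := fun x => ‖fderiv ℝ f x‖ₑ * ‖h‖ₑ)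
          (fun x => by simp only [periodic_fderiv hp x]) (t • h)
    _ = _ := by
        rw [lintegral_mul_const' _ _ enorm_ne_top]
        simp [mul_comm]

/-- As for the first power, with Cauchy-Schwarz on the segment of parameter length one. -/
theorem lintegral_sq_translate_sub_le {L : ℝ} (hL : 0 < L) {f : Space n → G} (hf : ContDiff ℝ 1 f)
    (hp : Function.Periodic f (L • axis n)) (h : Space n) :
    ∫⁻ x, ‖f (x + h) - f x‖ₑ ^ 2 ∂period n L
      ≤ ‖h‖ₑ ^ 2 * ∫⁻ x, ‖fderiv ℝ f x‖ₑ ^ 2 ∂period n L := by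
  have hm := measurable_enorm_fderiv_add hf h
  calc _ ≤ ∫⁻ x, (∫⁻ t in Icc (0 : ℝ) 1, (‖fderiv ℝ f (x + t • h)‖ₑ * ‖h‖ₑ) ^ 2) ∂period n L := by
        refine lintegral_mono fun x => ?_
        calc _ ≤ _ := pow_le_pow_left' (enorm_add_sub_le hf x h) 2
          _ ≤ _ := by
            have := sq_lintegral_mul_le (volume.restrict (Icc (0 : ℝ) 1))
              (f := fun t => ‖fderiv ℝ f (x + t • h)‖ₑ * ‖h‖ₑ) (g := fun _ => 1)
              ((hm.comp measurable_prodMk_left).mul_const _).aemeasurable aemeasurable_const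
            simpa using this
    _ = ∫⁻ t in Icc (0 : ℝ) 1, ∫⁻ x, (‖fderiv ℝ f (x + t • h)‖ₑ * ‖h‖ₑ) ^ 2 ∂period n L := by
        refine lintegral_lintegral_swap (Measurable.aemeasurable ?_)
        exact (hm.mul_const _).pow_const 2
    _ = ∫⁻ t in Icc (0 : ℝ) 1, ∫⁻ x, (‖fderiv ℝ f x‖ₑ * ‖h‖ₑ) ^ 2 ∂period n L := by
        congr 1; funext t
        exact lintegral_period_add hL (F := fun x => (‖fderiv ℝ f x‖ₑ * ‖h‖ₑ) ^ 2)
          (fun x => by simp only [periodic_fderiv hp x]) (t • h)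
    _ = _ := by
        simp only [mul_pow]
        rw [lintegral_mul_const' _ _ (by simp)]
        simp [mul_comm]

/-- A derivative of a periodic function has mean zero. -/
theorem integral_fderiv_period {L : ℝ} (hL : 0 < L) {f : Space n → ℝ} (hf : ContDiff ℝ 1 f)
    (hp : Function.Periodic f (L • axis n)) (v : Space n) (hi : Integrable f (period n L))
    (hi' : Integrable (fun x => fderiv ℝ f x v) (period n L)) :
    ∫ x, fderiv ℝ f x v ∂period n L = 0 := by
  have hp' : Function.Periodic (fun x => fderiv ℝ f x v) (L • axis n) := fun x => by
    simp only [periodic_fderiv hp x]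
  have hc : Continuous fun x => fderiv ℝ f x v :=
    (hf.continuous_fderiv (by simp)).clm_apply continuous_const
  -- The left side has mean zero by translation invariance, and the mean of the right side is that
  -- of the derivative itself.
  have hftc : ∀ x, f (x + v) - f x = ∫ t in Icc (0 : ℝ) 1, fderiv ℝ f (x + t • v) v := by
    intro x
    have hd : ∀ t : ℝ, HasDerivAt (fun t : ℝ => f (x + t • v)) (fderiv ℝ f (x + t • v) v) t := by
      intro t
      have h1 : HasDerivAt (fun t : ℝ => x + t • v) v t := by
        simpa using ((hasDerivAt_id t).smul_const v).const_add x
      exact ((hf.differentiable (by simp)) (x + t • v)).hasFDerivAt.comp_hasDerivAt t h1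
    have := intervalIntegral.integral_eq_sub_of_hasDerivAt (a := 0) (b := 1) (fun t _ => hd t)
      (Continuous.intervalIntegrable (by fun_prop) _ _)
    rw [integral_Icc_eq_integral_Ioc, ← intervalIntegral.integral_of_le zero_le_one, this]
    simp
  have hadd : Integrable (fun x => f (x + v)) (period n L) := by
    refine ⟨by fun_prop, ?_⟩
    have := lintegral_period_add hL (F := fun x => ‖f x‖ₑ) (fun x => by simp only [hp x]) v
    rw [HasFiniteIntegral, this]; exact hi.2
  have h0 : ∫ x, (f (x + v) - f x) ∂period n L = 0 := by
    rw [integral_sub hadd hi, integral_period_add hL hp, sub_self]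
  have hprod : Integrable (Function.uncurry fun (x : Space n) (t : ℝ) => fderiv ℝ f (x + t • v) v)
      ((period n L).prod (volume.restrict (Icc (0 : ℝ) 1))) := by
    have hcc : Continuous (Function.uncurry fun (x : Space n) (t : ℝ) =>
        fderiv ℝ f (x + t • v) v) := by
      exact hc.comp (g := fun x => fderiv ℝ f x v)
        (f := fun p : Space n × ℝ => p.1 + p.2 • v) (by fun_prop)
    refine ⟨hcc.aestronglyMeasurable, ?_⟩
    rw [HasFiniteIntegral, lintegral_prod_symm' _ hcc.enorm.measurable]
    have : ∀ t : ℝ, ∫⁻ x, ‖fderiv ℝ f (x + t • v) v‖ₑ ∂period n L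
        = ∫⁻ x, ‖fderiv ℝ f x v‖ₑ ∂period n L := fun t =>
      lintegral_period_add hL (F := fun x => ‖fderiv ℝ f x v‖ₑ) (fun x => by
        simp only [periodic_fderiv hp x]) (t • v)
    simp only [Function.uncurry_apply_pair, this]
    simpa [HasFiniteIntegral] using hi'.2
  simp only [hftc] at h0
  rw [integral_integral_swap hprod] at h0
  have : ∀ t : ℝ, ∫ x, fderiv ℝ f (x + t • v) v ∂period n L
      = ∫ x, fderiv ℝ f x v ∂period n L := fun t => integral_period_add hL hp' (t • v)
  simpa [this] using h0

end Strip

/-! ### Hilbert-space tools: Jacobian norms and the inverse of a quadratic form -/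

variable {n : ℕ}

theorem enorm_sq_Lp {α F : Type*} [MeasurableSpace α] {μ : Measure α} [NormedAddCommGroup F]
    {f : Lp F 2 μ} {φ : α → F} (h : f =ᵐ[μ] φ) : ‖f‖ₑ ^ 2 = ∫⁻ x, ‖φ x‖ₑ ^ 2 ∂μ := by
  rw [Lp.enorm_def, eLpNorm_congr_ae h]
  have := eLpNorm_nnreal_pow_eq_lintegral (μ := μ) (f := φ) (p := 2) two_ne_zero
  simpa using this

/-- The operator norm is at most the Hilbert-Schmidt norm, by Cauchy-Schwarz in each row. -/
theorem norm_fderiv_le_jacobian (φ : Space n → Space n) (x : Space n) :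
    ‖fderiv ℝ φ x‖ ≤ ‖jacobian φ x‖ := by
  refine ContinuousLinearMap.opNorm_le_bound _ (norm_nonneg _) fun v => ?_
  have hv : v = ∑ j, v j • basisVec n j := by
    ext i
    simp [basisVec_apply]
  have hi : ∀ i, fderiv ℝ φ x v i = ∑ j, jacobian φ x (i, j) * v j := by
    intro i
    conv_lhs => rw [hv]
    simp [map_sum, jacobian, mul_comm]
  rw [← abs_of_nonneg (norm_nonneg (fderiv ℝ φ x v)),
    ← abs_of_nonneg (mul_nonneg (norm_nonneg (jacobian φ x)) (norm_nonneg v)), ← sq_le_sq, mul_pow,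
    EuclideanSpace.real_norm_sq_eq, EuclideanSpace.real_norm_sq_eq, EuclideanSpace.real_norm_sq_eq,
    Fintype.sum_prod_type, Finset.sum_mul]
  refine Finset.sum_le_sum fun i _ => ?_
  rw [hi]
  exact Finset.sum_mul_sq_le_sq_mul_sq _ _ _

theorem inner_comp_adjoint {E F : Type*} [NormedAddCommGroup E] [InnerProductSpace ℝ E]
    [CompleteSpace E] [NormedAddCommGroup F] [InnerProductSpace ℝ F] [CompleteSpace F]
    (J : E →L[ℝ] F) (x y : F) :
    inner ℝ ((J.comp (ContinuousLinearMap.adjoint J)) x) y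
      = inner ℝ x ((J.comp (ContinuousLinearMap.adjoint J)) y) := by
  rw [ContinuousLinearMap.comp_apply, ContinuousLinearMap.comp_apply,
    ← ContinuousLinearMap.adjoint_inner_right]
  exact ContinuousLinearMap.adjoint_inner_left J _ _

/-- Solution operator of the form `(G, G')`, for a closed space `V` of pairs `(u, G)` in which `u`
is bounded by `G`. -/
theorem exists_form_inverse {E F : Type*} [NormedAddCommGroup E] [InnerProductSpace ℝ E]
    [CompleteSpace E] [NormedAddCommGroup F] [InnerProductSpace ℝ F] [CompleteSpace F]
    (V : Submodule ℝ (E × F)) (hV : IsClosed (V : Set (E × F))) (H : Submodule ℝ E)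
    [CompleteSpace H] (hVH : ∀ f ∈ V, f.1 ∈ H) {K : ℝ} (hK : ∀ f ∈ V, ‖f.1‖ ≤ K * ‖f.2‖) :
    ∃ S : H →L[ℝ] H, (∀ x y, inner ℝ (S x) y = inner ℝ x (S y)) ∧
      ∀ f : H, ∃ G : F, ((S f : E), G) ∈ V ∧ ∀ y ∈ V, inner ℝ G y.2 = inner ℝ (f : E) y.1 := by
  let T : V →L[ℝ] F := (ContinuousLinearMap.snd ℝ E F).comp V.subtypeL
  have : CompleteSpace V := hV.completeSpace_coe
  have hT : AntilipschitzWith (NNReal.mk (max K 1) (by positivity)) T := by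
    refine ContinuousLinearMap.antilipschitz_of_bound T fun x => ?_
    rw [NNReal.coe_mk]
    change ‖(x : E × F)‖ ≤ max K 1 * ‖(x : E × F).2‖
    rw [Prod.norm_def]
    refine max_le ((hK _ x.2).trans ?_) ?_
    · exact mul_le_mul_of_nonneg_right (le_max_left _ _) (norm_nonneg _)
    · exact le_mul_of_one_le_left (norm_nonneg _) (le_max_right _ _)
  -- The inequality ‖u‖ ≤ K‖G‖ makes (u, G) ↦ G bounded below, so the gradients form a closed, hence
  -- complete, space on which u is a bounded function of G.
  have hcl : IsClosed (Set.range T) := hT.isClosed_range T.uniformContinuous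
  let Θ := ContinuousLinearMap.equivRange (f := T) hT.injective hcl
  have : CompleteSpace (LinearMap.range (T : V →ₗ[ℝ] F)) := hcl.completeSpace_coe
  let J : LinearMap.range (T : V →ₗ[ℝ] F) →L[ℝ] H :=
    ((ContinuousLinearMap.fst ℝ E F).comp
      (V.subtypeL.comp (Θ.symm : LinearMap.range (T : V →ₗ[ℝ] F) →L[ℝ] V))).codRestrict
      H fun x => hVH _ (Θ.symm x).2
  have hΘ : ∀ G, (((J G : H) : E), (G : F)) ∈ V := by
    intro G
    have h1 : T (Θ.symm G) = G := congrArg Subtype.val (Θ.apply_symm_apply G)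
    have h2 : (((J G : H) : E), (G : F)) = ((Θ.symm G : V) : E × F) := Prod.ext rfl h1.symm
    rw [h2]; exact (Θ.symm G).2
  -- With J : G ↦ u, the weak equation (G, G') = (f, J G') for all G' is the definition of G = J*f.
  -- So the solution operator is JJ*, which is symmetric at once.
  refine ⟨J.comp (ContinuousLinearMap.adjoint J), fun x y => inner_comp_adjoint J x y, fun f =>
    ⟨_, hΘ (ContinuousLinearMap.adjoint J f), fun y hy => ?_⟩⟩
  have hJ : Θ.symm (Θ ⟨y, hy⟩) = ⟨y, hy⟩ := Θ.symm_apply_apply _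
  have h1 : ((J (Θ ⟨y, hy⟩) : H) : E) = y.1 :=
    congrArg (fun z : V => (z : E × F).1) hJ
  have h2 := ContinuousLinearMap.adjoint_inner_left J (Θ ⟨y, hy⟩) f
  rw [Submodule.coe_inner, Submodule.coe_inner, h1] at h2
  exact h2

/-! ### Test fields, the Poincaré inequality and the inverse of the Stokes operator -/

namespace Pipe

variable (P : Pipe n)

theorem testFields_zero : (0 : Space n → Space n) ∈ P.testFields := by
  refine ⟨contDiff_const, fun x => rfl, ?_, fun x => ?_⟩
  · simp [tsupport]
  · simp [divergence]

variable {P}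

theorem testFields_add {φ ψ : Space n → Space n} (hφ : φ ∈ P.testFields) (hψ : ψ ∈ P.testFields) :
    φ + ψ ∈ P.testFields := by
  obtain ⟨h1, h2, h3, h4⟩ := hφ
  obtain ⟨k1, k2, k3, k4⟩ := hψ
  refine ⟨h1.add k1, h2.add k2, ?_, fun x => ?_⟩
  · exact (tsupport_add φ ψ).trans (union_subset h3 k3)
  · have e := h4 x
    have e' := k4 x
    simp only [divergence] at e e' ⊢
    rw [fderiv_add (h1.differentiable (by simp) x) (k1.differentiable (by simp) x)]
    simp [Finset.sum_add_distrib, e, e']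

theorem testFields_smul (c : ℝ) {φ : Space n → Space n} (hφ : φ ∈ P.testFields) :
    c • φ ∈ P.testFields := by
  obtain ⟨h1, h2, h3, h4⟩ := hφ
  refine ⟨contDiff_const.smul h1, fun x => by simp [h2 x], ?_, fun x => ?_⟩
  · exact (closure_mono (Function.support_const_smul_subset c φ)).trans h3
  · have e := h4 x
    simp only [divergence] at e ⊢
    rw [fderiv_const_smul (h1.differentiable (by simp) x)]
    simp [← Finset.mul_sum, e]

/-- The pairs given by test fields already form a linear space, so the span adds nothing, and an
element of 𝕍 is a limit of single test fields. -/
theorem mem_span_test {f : P.L2 × P.L2Mat} (hf : f ∈ Submodule.span ℝ {f : P.L2 × P.L2Mat |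
    ∃ φ ∈ P.testFields, f.1 =ᵐ[P.measure] φ ∧ f.2 =ᵐ[P.measure] jacobian φ}) :
    ∃ φ ∈ P.testFields, f.1 =ᵐ[P.measure] φ ∧ f.2 =ᵐ[P.measure] jacobian φ := by
  refine Submodule.span_induction (p := fun f _ => ∃ φ ∈ P.testFields,
    f.1 =ᵐ[P.measure] φ ∧ f.2 =ᵐ[P.measure] jacobian φ) (fun _ h => h) ?_ ?_ ?_ hf
  · refine ⟨0, P.testFields_zero, Lp.coeFn_zero _ _ _, ?_⟩
    filter_upwards [Lp.coeFn_zero (Mat n) 2 P.measure] with x hx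
    rw [Prod.snd_zero, hx]
    ext ij; simp [jacobian]
  · rintro f g _ _ ⟨φ, hφ, h1, h2⟩ ⟨ψ, hψ, k1, k2⟩
    refine ⟨φ + ψ, testFields_add hφ hψ, ?_, ?_⟩
    · filter_upwards [Lp.coeFn_add f.1 g.1, h1, k1] with x hx h1 k1
      rw [Prod.fst_add, hx, Pi.add_apply, h1, k1, Pi.add_apply]
    · filter_upwards [Lp.coeFn_add f.2 g.2, h2, k2] with x hx h2 k2
      rw [Prod.snd_add, hx, Pi.add_apply, h2, k2]
      ext ij
      simp [jacobian, fderiv_add (hφ.1.differentiable (by simp) x)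
        (hψ.1.differentiable (by simp) x)]
  · rintro c f _ ⟨φ, hφ, h1, h2⟩
    refine ⟨c • φ, testFields_smul c hφ, ?_, ?_⟩
    · filter_upwards [Lp.coeFn_smul c f.1, h1] with x hx h1
      rw [Prod.smul_fst, hx, Pi.smul_apply, h1, Pi.smul_apply]
    · filter_upwards [Lp.coeFn_smul c f.2, h2] with x hx h2
      rw [Prod.smul_snd, hx, Pi.smul_apply, h2]
      ext ij
      simp [jacobian, fderiv_const_smul (hφ.1.differentiable (by simp) x)]

variable (P) in
/-- Elements of `𝕍` are limits of test fields. -/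
theorem exists_test_near {f : P.L2 × P.L2Mat} (hf : f ∈ P.V) {ε : ℝ} (hε : 0 < ε) :
    ∃ φ ∈ P.testFields, ∃ g : P.L2 × P.L2Mat, g.1 =ᵐ[P.measure] φ ∧
      g.2 =ᵐ[P.measure] jacobian φ ∧ ‖f - g‖ < ε := by
  obtain ⟨g, hg, hfg⟩ := Metric.mem_closure_iff.1 hf ε hε
  obtain ⟨φ, hφ, h1, h2⟩ := mem_span_test hg
  exact ⟨φ, hφ, g, h1, h2, by rwa [← dist_eq_norm]⟩

variable (P)

/-- Integrals over the cell become integrals over a full period of functions that vanish off the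
pipe, to which translation invariance applies. -/
theorem measure_eq : P.measure = (period n P.L).restrict P.carrier := by
  rw [measure, cell, cellOf, period, ← restrict_slab_zero,
    Measure.restrict_restrict P.isOpen.measurableSet]
  rfl

theorem ae_measure_iff {p : Space n → Prop} :
    (∀ᵐ x ∂P.measure, p x) ↔ ∀ᵐ x ∂period n P.L, x ∈ P.carrier → p x := by
  rw [measure_eq, ae_restrict_iff' P.isOpen.measurableSet]

theorem lintegral_measure {F : Space n → ENNReal} (hF : ∀ x ∉ P.carrier, F x = 0) :
    ∫⁻ x, F x ∂P.measure = ∫⁻ x, F x ∂period n P.L := by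
  rw [measure_eq, ← lintegral_indicator P.isOpen.measurableSet]
  congr 1; funext x
  by_cases hx : x ∈ P.carrier
  · simp [hx]
  · simp [hx, hF x hx]

theorem integral_measure {F : Space n → ℝ} (hF : ∀ x ∉ P.carrier, F x = 0) :
    ∫ x, F x ∂P.measure = ∫ x, F x ∂period n P.L := by
  rw [measure_eq, ← integral_indicator P.isOpen.measurableSet]
  congr 1; funext x
  by_cases hx : x ∈ P.carrier
  · simp [hx]
  · simp [hx, hF x hx]

theorem integrable_period {G : Type*} [NormedAddCommGroup G] {F : Space n → G}
    (hF : ∀ x ∉ P.carrier, F x = 0) (hi : Integrable F P.measure) :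
    Integrable F (period n P.L) := by
  rw [measure_eq] at hi
  have h := (integrable_indicator_iff P.isOpen.measurableSet).2 hi
  rwa [indicator_eq_self.2 fun x hx => by_contra fun h => hx (hF x h)] at h

theorem integrable_of_continuous {F : Type*} [NormedAddCommGroup F] {f : Space n → F}
    [SecondCountableTopologyEither (Space n) F] (hf : Continuous f) : Integrable f P.measure :=
  (P.memLp_of_continuous hf).integrable (by norm_num)

variable {P}

theorem periodic_carrier : Function.Periodic (· ∈ P.carrier) (P.L • axis n) := fun y =>
  propext (P.periodic y)

theorem test_eq_zero {φ : Space n → Space n} (hφ : tsupport φ ⊆ P.carrier) {x : Space n}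
    (hx : x ∉ P.carrier) : φ x = 0 := image_eq_zero_of_notMem_tsupport fun h => hx (hφ h)

theorem fderiv_eq_zero_of_notMem {G : Type*} [NormedAddCommGroup G] [NormedSpace ℝ G]
    {φ : Space n → G} (hφ : tsupport φ ⊆ P.carrier) {x : Space n}
    (hx : x ∉ P.carrier) : fderiv ℝ φ x = 0 :=
  image_eq_zero_of_notMem_tsupport fun h => hx (hφ (tsupport_fderiv_subset ℝ h))

theorem lintegral_fderiv_le {φ : Space n → Space n} (hφ : φ ∈ P.testFields) :
    ∫⁻ x, ‖fderiv ℝ φ x‖ₑ ^ 2 ∂period n P.L ≤ ∫⁻ x, ‖jacobian φ x‖ₑ ^ 2 ∂P.measure := by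
  rw [← P.lintegral_measure fun x hx => by
    rw [fderiv_eq_zero_of_notMem hφ.2.2.1 hx, ← ofReal_norm, norm_zero]; simp]
  refine lintegral_mono fun x => pow_le_pow_left' ?_ 2
  exact enorm_le_iff_norm_le.2 (norm_fderiv_le_jacobian φ x)

-- The bounded cell omits the faces z = 0 and z = L. Since the pipe is open, a point on a face is
-- the limit of its axial shifts into the cell, so the closure of the cell contains the closed slab
-- of the pipe.
variable (P) in
theorem exists_bound_slab : ∃ R : ℝ, 0 < R ∧ ∀ x ∈ P.carrier, x (Fin.last n) ∈ Icc 0 P.L → ‖x‖ ≤ R := by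
  obtain ⟨R, hR⟩ := P.bounded.closure.subset_closedBall 0
  refine ⟨max R 1, lt_max_of_lt_right one_pos, fun x hx hz => ?_⟩
  suffices x ∈ closure (cellOf P.carrier P.L) by
    exact (mem_closedBall_zero_iff.1 (hR this)).trans (le_max_left _ _)
  obtain ⟨ε, hε, hball⟩ := Metric.isOpen_iff.1 P.isOpen x hx
  rw [Metric.mem_closure_iff]
  intro η hη
  obtain ⟨t, ht, ht'⟩ : ∃ t : ℝ, |t| < min ε η ∧ x (Fin.last n) + t ∈ Ioo 0 P.L := by
    have hL := P.L_pos
    set δ := min (min ε η) P.L / 2 with hδ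
    have hδ0 : 0 < δ := by positivity
    have h1 : δ < min ε η := by
      have : min (min ε η) P.L ≤ min ε η := min_le_left _ _
      have : 0 < min ε η := by positivity
      linarith
    have h2 : 2 * δ ≤ P.L := by
      have : min (min ε η) P.L ≤ P.L := min_le_right _ _
      linarith
    by_cases hc : x (Fin.last n) ≤ P.L / 2
    · exact ⟨δ / 2, by rw [abs_of_pos (by linarith)]; linarith,
        by have := hz.1; linarith, by linarith⟩
    · push Not at hc
      exact ⟨-(δ / 2), by rw [abs_neg, abs_of_pos (by linarith)]; linarith,
        by linarith, by have := hz.2; linarith⟩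
  have hn : ‖axis n‖ = 1 := by simp [axis, basisVec]
  have hd : dist (x + t • axis n) x = |t| := by
    rw [dist_eq_norm, add_sub_cancel_left, norm_smul, hn, mul_one, Real.norm_eq_abs]
  refine ⟨x + t • axis n, ⟨hball ?_, ?_⟩, ?_⟩
  · rw [Metric.mem_ball, hd]; exact ht.trans_le (min_le_left _ _)
  · simpa [axis_last] using ht'
  · rw [dist_comm, hd]; exact ht.trans_le (min_le_right _ _)

variable (P) in
/-- The Poincaré inequality on test fields. -/
theorem exists_poincare (hn : 1 ≤ n) : ∃ K : NNReal, ∀ φ ∈ P.testFields,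
    ∫⁻ x, ‖φ x‖ₑ ^ 2 ∂period n P.L ≤ (K : ENNReal) ^ 2 * ∫⁻ x, ‖fderiv ℝ φ x‖ₑ ^ 2 ∂period n P.L := by
  obtain ⟨R, hR0, hR⟩ := P.exists_bound_slab
  have h0 : (0 : Fin (n + 1)) ≠ Fin.last n := by
    intro h
    have := congrArg Fin.val h
    simp at this; omega
  -- For n ≥ 1 the coordinate 0 is transversal to the axis. A shift by 2R + 1 moves every point of
  -- the pipe in this period out of the pipe, so |φ(x)| is the size of a translation difference.
  refine ⟨‖(2 * R + 1) • basisVec n 0‖₊, fun φ hφ => ?_⟩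
  refine le_trans ?_ (lintegral_sq_translate_sub_le P.L_pos (hφ.1.of_le (by simp)) hφ.2.1
    ((2 * R + 1) • basisVec n 0))
  refine setLIntegral_mono' (measurableSet_slab _ _) fun x hx => ?_
  by_cases hφx : φ x = 0
  · simp [hφx]
  have hz : x (Fin.last n) ∈ Icc 0 P.L := ⟨hx.1.le, by simpa using hx.2⟩
  have hxc : x ∈ P.carrier := by
    by_contra h; exact hφx (test_eq_zero hφ.2.2.1 h)
  have hx0 : -R ≤ x 0 := by
    have := (abs_le.1 ((PiLp.norm_apply_le x 0).trans (hR x hxc hz))).1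
    exact this
  have : φ (x + (2 * R + 1) • basisVec n 0) = 0 := by
    refine test_eq_zero hφ.2.2.1 fun h => ?_
    have h1 := hR _ h (by simpa [basisVec_apply, h0.symm] using hz)
    have h2 := (abs_le.1 ((PiLp.norm_apply_le _ 0).trans h1)).2
    simp [basisVec_apply] at h2
    linarith
  rw [this, zero_sub, enorm_neg]

theorem exists_poincare_V (hn : 1 ≤ n) : ∃ K : ℝ, 0 ≤ K ∧ ∀ f ∈ P.V, ‖f.1‖ ≤ K * ‖f.2‖ := by
  obtain ⟨K, hK⟩ := P.exists_poincare hn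
  refine ⟨K, K.2, fun f hf => ?_⟩
  have hcl : IsClosed {f : P.L2 × P.L2Mat | ‖f.1‖ ≤ K * ‖f.2‖} :=
    isClosed_le continuous_fst.norm (continuous_const.mul continuous_snd.norm)
  refine closure_minimal ?_ hcl hf
  intro g hg
  obtain ⟨φ, hφ, h1, h2⟩ := mem_span_test hg
  have e1 := enorm_sq_Lp h1
  have e2 := enorm_sq_Lp h2
  have := (hK φ hφ).trans (mul_le_mul_right (lintegral_fderiv_le hφ) _)
  rw [← P.lintegral_measure fun x hx => by rw [test_eq_zero hφ.2.2.1 hx]; simp, ← e1, ← e2,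
    ← mul_pow] at this
  have h3 : ‖g.1‖ₑ ≤ K * ‖g.2‖ₑ := (ENNReal.pow_le_pow_left_iff two_ne_zero).1 this
  have h4 : ‖g.1‖₊ ≤ K * ‖g.2‖₊ := by
    have : (‖g.1‖₊ : ENNReal) ≤ ((K * ‖g.2‖₊ : NNReal) : ENNReal) := by
      rw [ENNReal.coe_mul]; exact h3
    exact_mod_cast this
  exact_mod_cast h4

theorem fst_mem_H {f : P.L2 × P.L2Mat} (hf : f ∈ P.V) : f.1 ∈ P.H := by
  have : P.V ≤ P.H.comap (LinearMap.fst ℝ P.L2 P.L2Mat) := by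
    refine Submodule.topologicalClosure_minimal _ (Submodule.span_le.2 ?_) ?_
    · rintro g ⟨φ, hφ, h1, _⟩
      exact Submodule.le_topologicalClosure _ (Submodule.subset_span ⟨φ, hφ, h1⟩)
    · exact (Submodule.isClosed_topologicalClosure _).preimage continuous_fst
  exact this hf

theorem stokes_mem_graph (u : P.stokes.domain) : ((u : P.H), P.stokes u) ∈ P.stokesGraph :=
  Submodule.mem_graph_toLinearPMap (fun x hx h0 => P.stokesGraph_single_valued x hx h0) u

theorem exists_stokes_eq {u f : P.H} (h : (u, f) ∈ P.stokesGraph) :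
    ∃ w : P.stokes.domain, (w : P.H) = u ∧ P.stokes w = f := by
  rw [← Submodule.toLinearPMap_graph_eq P.stokesGraph P.stokesGraph_single_valued] at h
  exact (LinearPMap.mem_graph_iff _).1 h

theorem stokes_symm (u v : P.stokes.domain) :
    inner ℝ (P.stokes u) (v : P.H) = inner ℝ (u : P.H) (P.stokes v) := by
  obtain ⟨G, hG, h⟩ := stokes_mem_graph u
  obtain ⟨G', hG', h'⟩ := stokes_mem_graph v
  have h1 := h _ hG'
  have h2 := h' _ hG
  rw [real_inner_comm] at h2
  change inner ℝ ((P.stokes u : P.H) : P.L2) ((v : P.H) : P.L2) = _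
  rw [← h1, h2, real_inner_comm]
  rfl

/-- (Au, u) = ‖∇u‖², and the Poincaré inequality applies. -/
theorem stokes_injective (hn : 1 ≤ n) {u : P.stokes.domain}
    (h : inner ℝ (P.stokes u) (u : P.H) = 0) : u = 0 := by
  obtain ⟨K, -, hK⟩ := exists_poincare_V (P := P) hn
  obtain ⟨G, hG, hu⟩ := stokes_mem_graph u
  have h1 : inner ℝ G G = 0 := (hu _ hG).trans h
  have h2 := hK _ hG
  rw [inner_self_eq_zero.1 h1, norm_zero, mul_zero] at h2
  have h3 : ((u : P.H) : P.L2) = 0 := norm_le_zero_iff.1 h2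
  exact Subtype.ext (Subtype.ext h3)

theorem stokes_inner_nonneg (u : P.stokes.domain) : 0 ≤ inner ℝ (P.stokes u) (u : P.H) := by
  obtain ⟨G, hG, hu⟩ := stokes_mem_graph u
  exact (real_inner_self_nonneg (x := G)).trans_eq (hu _ hG)

variable (P) in
/-- The Stokes operator has a bounded symmetric inverse. -/
theorem exists_stokes_inverse (hn : 1 ≤ n) : ∃ S : P.H →L[ℝ] P.H,
    (∀ x y, inner ℝ (S x) y = inner ℝ x (S y)) ∧
    ∀ f, ∃ u : P.stokes.domain, (u : P.H) = S f ∧ P.stokes u = f := by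
  obtain ⟨K, hK0, hK⟩ := exists_poincare_V (P := P) hn
  obtain ⟨S, hS, h⟩ := exists_form_inverse P.V (Submodule.isClosed_topologicalClosure _) P.H
    (fun f hf => fst_mem_H hf) hK
  exact ⟨S, hS, fun f => exists_stokes_eq (h f)⟩

end Pipe

/-! ### Averages over the translates of a box -/

theorem ENNReal_add_sq_le (a b : ENNReal) : (a + b) ^ 2 ≤ 2 * (a ^ 2 + b ^ 2) := by
  rcases eq_or_ne a ⊤ with rfl | ha
  · simp
  rcases eq_or_ne b ⊤ with rfl | hb
  · simp
  lift a to NNReal using ha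
  lift b to NNReal using hb
  have h : (a + b) ^ 2 ≤ 2 * (a ^ 2 + b ^ 2) := add_sq_le
  exact_mod_cast h

theorem norm_axis : ‖axis n‖ = 1 := by simp [axis, basisVec]

/-- The box `0 < h_i < r`, `0 < h_z < s`. -/
def box (n : ℕ) (r s : ℝ) : Set (Space n) :=
  {h | ∀ i, h i ∈ Ioo 0 (if i = Fin.last n then s else r)}

theorem volume_box {r s : ℝ} (hr : 0 ≤ r) :
    volume (box n r s) = ENNReal.ofReal (r ^ n * s) := by
  have h := (PiLp.volume_preserving_ofLp (Fin (n + 1))).measure_preimage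
    (s := pi univ fun i => Ioo (0 : ℝ) (if i = Fin.last n then s else r))
    (MeasurableSet.univ_pi fun i => measurableSet_Ioo).nullMeasurableSet
  rw [Real.volume_pi_Ioo, Fin.prod_univ_castSucc] at h
  have e : box n r s = WithLp.ofLp ⁻¹'
      (pi univ fun i => Ioo (0 : ℝ) (if i = Fin.last n then s else r)) := by
    ext x; simp [box]
  rw [e, h]
  have : ∀ i : Fin n, Fin.castSucc i ≠ Fin.last n := fun i => (Fin.castSucc_lt_last i).ne
  simp only [this, if_false, if_true, sub_zero, Finset.prod_const, Finset.card_univ,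
    Fintype.card_fin]
  rw [ENNReal.ofReal_mul (by positivity), ENNReal.ofReal_pow hr]

theorem measurableSet_box (r s : ℝ) : MeasurableSet (box n r s) := by
  have : box n r s = ⋂ i, (fun x : Space n => x i) ⁻¹' Ioo 0 (if i = Fin.last n then s else r) := by
    ext x; simp [box]
  rw [this]
  exact MeasurableSet.iInter fun i => measurable_coord i measurableSet_Ioo

theorem norm_le_of_mem_box {r s t : ℝ} (ht : 0 ≤ t) (hr : r ≤ t) (hs : s ≤ t) {h : Space n}
    (hh : h ∈ box n r s) : ‖h‖ ≤ (n + 1) * t := by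
  rw [← abs_of_nonneg (norm_nonneg h), ← abs_of_nonneg (show 0 ≤ (n + 1 : ℝ) * t by positivity),
    ← sq_le_sq, EuclideanSpace.real_norm_sq_eq]
  calc ∑ i, h i ^ 2 ≤ ∑ _i : Fin (n + 1), t ^ 2 := by
        refine Finset.sum_le_sum fun i _ => pow_le_pow_left₀ (hh i).1.le ((hh i).2.le.trans ?_) 2
        split_ifs <;> assumption
    _ = (n + 1) * t ^ 2 := by simp
    _ ≤ _ := by
      rw [mul_pow]
      refine mul_le_mul_of_nonneg_right ?_ (sq_nonneg t)
      have : (0 : ℝ) ≤ n := n.cast_nonneg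
      nlinarith

theorem box_subset_slab {r s L : ℝ} (hs : s ≤ L) : box n r s ⊆ slab n 0 L := by
  intro h hh
  have := hh (Fin.last n)
  simp only [if_true] at this
  exact ⟨this.1, by rw [zero_add]; exact this.2.le.trans hs⟩

/-- A box of axial height at most L fits into one slab, whatever its width, so its translates see at
most one period. -/
theorem lintegral_box_le {r s L : ℝ} (hL : 0 < L) (hs : s ≤ L) {F : Space n → ENNReal}
    (hF : Function.Periodic F (L • axis n)) (x : Space n) :
    ∫⁻ h in box n r s, F (x + h) ≤ ∫⁻ x, F x ∂period n L := by
  refine (lintegral_mono_set (box_subset_slab hs)).trans_eq ?_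
  simp only [add_comm x]
  exact lintegral_period_add hL hF x

theorem hasDerivAt_line {ψ : Space n → ℝ} {x v : Space n} (hd : DifferentiableAt ℝ ψ x) :
    HasDerivAt (fun t : ℝ => ψ (x + t • v)) (fderiv ℝ ψ x v) 0 := by
  have h1 : HasDerivAt (fun t : ℝ => x + t • v) v 0 := by
    simpa using ((hasDerivAt_id (0 : ℝ)).smul_const v).const_add x
  have h3 : HasFDerivAt ψ (fderiv ℝ ψ x) (x + (0 : ℝ) • v) := by
    rw [zero_smul, add_zero]; exact hd.hasFDerivAt
  exact h3.comp_hasDerivAt (0 : ℝ) h1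

theorem fderiv_eq_zero_of_invariant {ψ : Space n → ℝ} {x v : Space n} (hd : DifferentiableAt ℝ ψ x)
    (h : ∀ t : ℝ, ψ (x + t • v) = ψ x) : fderiv ℝ ψ x v = 0 := by
  have h2 := hasDerivAt_line (v := v) hd
  simp only [h] at h2
  exact h2.unique (hasDerivAt_const _ _)

theorem lintegral_box_translate_le {r s L : ℝ} (hL : 0 < L) (hs : s ≤ L) {φ : Space n → Space n}
    (hp : Function.Periodic φ (L • axis n)) (A : Set (Space n)) :
    ∫⁻ x in A, (∫⁻ h in box n r s, ‖φ (x + h)‖ₑ ^ 2) ∂period n L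
      ≤ period n L A * ∫⁻ x, ‖φ x‖ₑ ^ 2 ∂period n L := by
  refine (lintegral_mono fun x => lintegral_box_le hL hs
    (F := fun x => ‖φ x‖ₑ ^ 2) (fun x => by simp only [hp x]) x).trans_eq ?_
  rw [lintegral_const, Measure.restrict_apply_univ, mul_comm]

theorem measurable_sq_translate_sub {φ : Space n → Space n} (hc : Continuous φ) :
    Measurable fun p : Space n × Space n => ‖φ (p.1 + p.2) - φ p.1‖ₑ ^ 2 :=
  (((hc.comp (continuous_fst.add continuous_snd)).sub
    (hc.comp continuous_fst)).enorm.measurable).pow_const 2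

theorem lintegral_box_translate_sub_le {r s t L : ℝ} (hL : 0 < L) (ht : 0 ≤ t) (hrt : r ≤ t)
    (hst : s ≤ t) {φ : Space n → Space n} (hφ : ContDiff ℝ 1 φ)
    (hp : Function.Periodic φ (L • axis n)) :
    ∫⁻ x, (∫⁻ h in box n r s, ‖φ (x + h) - φ x‖ₑ ^ 2) ∂period n L
      ≤ volume (box n r s) *
        (ENNReal.ofReal ((n + 1) * t) ^ 2 * ∫⁻ x, ‖fderiv ℝ φ x‖ₑ ^ 2 ∂period n L) := by
  rw [lintegral_lintegral_swap (measurable_sq_translate_sub hφ.continuous).aemeasurable]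
  calc _ ≤ ∫⁻ _h in box n r s, (ENNReal.ofReal ((n + 1) * t) ^ 2
        * ∫⁻ x, ‖fderiv ℝ φ x‖ₑ ^ 2 ∂period n L) := by
        refine setLIntegral_mono' (measurableSet_box r s) fun h hh => ?_
        refine (lintegral_sq_translate_sub_le hL hφ hp h).trans ?_
        refine mul_le_mul_left (pow_le_pow_left' ?_ 2) _
        rw [← ofReal_norm]
        exact ENNReal.ofReal_le_ofReal (norm_le_of_mem_box ht hrt hst hh)
    _ = _ := by rw [setLIntegral_const, mul_comm]

/-- Integrate |φ(x)|² ≤ 2|φ(x + h)|² + 2|φ(x + h) − φ(x)|² over h in the box: value at a point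
against local average and oscillation. -/
theorem volume_box_mul_sq_le {r s : ℝ} {φ : Space n → Space n} (hc : Continuous φ) (x : Space n) :
    ‖φ x‖ₑ ^ 2 * volume (box n r s) ≤ 2 * ((∫⁻ h in box n r s, ‖φ (x + h)‖ₑ ^ 2)
      + ∫⁻ h in box n r s, ‖φ (x + h) - φ x‖ₑ ^ 2) := by
  have hmx : Measurable fun h => ‖φ (x + h)‖ₑ ^ 2 :=
    (hc.comp (continuous_const.add continuous_id)).enorm.measurable.pow_const 2
  rw [← setLIntegral_const, ← lintegral_add_left hmx, ← lintegral_const_mul' _ _ (by simp)]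
  refine lintegral_mono fun h => ?_
  refine le_trans (pow_le_pow_left' ?_ 2) (ENNReal_add_sq_le _ _)
  calc ‖φ x‖ₑ = ‖φ (x + h) - (φ (x + h) - φ x)‖ₑ := by rw [sub_sub_cancel]
    _ ≤ _ := enorm_sub_le

/-- Local mass of a periodic field, estimated by averages over the translates of a box. -/
theorem lintegral_mul_volume_box_le {r s t L : ℝ} (hL : 0 < L) (hs : s ≤ L) (ht : 0 ≤ t)
    (hrt : r ≤ t) (hst : s ≤ t) {φ : Space n → Space n} (hφ : ContDiff ℝ 1 φ)
    (hp : Function.Periodic φ (L • axis n)) (A : Set (Space n)) :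
    (∫⁻ x in A, ‖φ x‖ₑ ^ 2 ∂period n L) * volume (box n r s)
      ≤ 2 * (period n L A * ∫⁻ x, ‖φ x‖ₑ ^ 2 ∂period n L + volume (box n r s) *
        (ENNReal.ofReal ((n + 1) * t) ^ 2 * ∫⁻ x, ‖fderiv ℝ φ x‖ₑ ^ 2 ∂period n L)) := by
  have hc := hφ.continuous
  have hm1 : Measurable fun p : Space n × Space n => ‖φ (p.1 + p.2)‖ₑ ^ 2 :=
    ((hc.comp (continuous_fst.add continuous_snd)).enorm.measurable).pow_const 2
  have hm1' : Measurable fun x => ∫⁻ h in box n r s, ‖φ (x + h)‖ₑ ^ 2 :=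
    Measurable.lintegral_prod_right' hm1
  rw [← lintegral_mul_const _ (hc.enorm.measurable.pow_const 2)]
  refine (lintegral_mono fun x => volume_box_mul_sq_le hc x).trans ?_
  rw [lintegral_const_mul' _ _ (by simp), lintegral_add_left hm1']
  exact mul_le_mul_right (add_le_add (lintegral_box_translate_le hL hs hp A)
    ((setLIntegral_le_lintegral A _).trans
      (lintegral_box_translate_sub_le hL ht hrt hst hφ hp))) 2

/-! ### Drives, and the vertical lines inside the support of a test field -/

namespace Pipe

variable {P : Pipe n}

/-- A square integrable periodic field `g` of norm at most one, whose product
with any test field is `m` times the flux of the test field. -/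
structure IsDrive (P : Pipe n) (g : Space n → Space n) (m : ℝ) : Prop where
  measurable : Measurable g
  periodic : Function.Periodic g (P.L • axis n)
  norm_le : ∫⁻ x, ‖g x‖ₑ ^ 2 ∂period n P.L ≤ 1
  flux : ∀ ψ ∈ P.testFields, ∫ x, inner ℝ (g x) (ψ x) ∂period n P.L
    = m / P.L * ∫ x, ψ x (Fin.last n) ∂period n P.L

theorem IsDrive.enorm_inner_sq_le {g : Space n → Space n} {m : ℝ} (hg : P.IsDrive g m)
    {ψ : Space n → Space n} (hψ : Measurable ψ) :
    ‖∫ x, inner ℝ (g x) (ψ x) ∂period n P.L‖ₑ ^ 2 ≤ ∫⁻ x, ‖ψ x‖ₑ ^ 2 ∂period n P.L := by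
  calc _ ≤ (∫⁻ x, ‖g x‖ₑ * ‖ψ x‖ₑ ∂period n P.L) ^ 2 := by
        refine pow_le_pow_left' ((enorm_integral_le_lintegral_enorm _).trans ?_) 2
        refine lintegral_mono fun x => ?_
        rw [← ofReal_norm, ← ofReal_norm (g x), ← ofReal_norm (ψ x),
          ← ENNReal.ofReal_mul (norm_nonneg _)]
        exact ENNReal.ofReal_le_ofReal (norm_inner_le_norm _ _)
    _ ≤ _ := sq_lintegral_mul_le _ hg.measurable.enorm.aemeasurable hψ.enorm.aemeasurable
    _ ≤ 1 * _ := by gcongr; exact hg.norm_le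
    _ = _ := one_mul _

theorem periodic_tsupport {G : Type*} [NormedAddCommGroup G] {φ : Space n → G} {v : Space n}
    (hp : Function.Periodic φ v) : Function.Periodic (· ∈ tsupport φ) v := by
  intro x
  have h1 : (Homeomorph.addRight v) ⁻¹' tsupport φ = tsupport φ := by
    rw [tsupport, Homeomorph.preimage_closure]
    congr 1
    ext y
    simp [hp y]
  exact propext (Set.ext_iff.1 h1 x)

theorem exists_zsmul_add_mem_slab {L : ℝ} (hL : 0 < L) (x : Space n) :
    ∃ k : ℤ, x + k • (L • axis n) ∈ slab n 0 L := by
  obtain ⟨k, hk, -⟩ := existsUnique_add_zsmul_mem_Ioc hL (x (Fin.last n)) 0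
  refine ⟨k, ?_⟩
  change (x + k • (L • axis n)) (Fin.last n) ∈ Ioc 0 (0 + L)
  simpa [axis_last] using hk

theorem slab_coord {L : ℝ} {x : Space n} (hx : x ∈ slab n 0 L) : x (Fin.last n) ∈ Icc 0 L :=
  ⟨hx.1.le, by simpa using hx.2⟩

/-- One period of the support is compact, and periodicity carries the margin to the rest. The radius
2δ leaves room for a mollifier of radius δ moved by a vector of length δ. -/
theorem exists_margin {φ : Space n → Space n} (hφ : φ ∈ P.testFields) :
    ∃ δ : ℝ, 0 < δ ∧ ∀ x ∈ tsupport φ, Metric.closedBall x (2 * δ) ⊆ P.carrier := by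
  obtain ⟨R, -, hR⟩ := P.exists_bound_slab
  have hcpt : IsCompact (tsupport φ ∩ {x | x (Fin.last n) ∈ Icc 0 P.L}) := by
    refine Metric.isCompact_of_isClosed_isBounded ((isClosed_tsupport φ).inter
      (isClosed_Icc.preimage (EuclideanSpace.proj (𝕜 := ℝ) (Fin.last n)).continuous)) ?_
    refine (Metric.isBounded_closedBall (x := (0 : Space n)) (r := R)).subset fun x hx => ?_
    rw [mem_closedBall_zero_iff]
    exact hR x (hφ.2.2.1 hx.1) hx.2
  obtain ⟨δ, hδ, h⟩ := hcpt.exists_cthickening_subset_open P.isOpen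
    (inter_subset_left.trans hφ.2.2.1)
  refine ⟨δ / 2, by positivity, fun x hx y hy => ?_⟩
  rw [mul_div_cancel₀ _ two_ne_zero] at hy
  obtain ⟨k, hk⟩ := exists_zsmul_add_mem_slab P.L_pos x
  have hx' : x + k • (P.L • axis n) ∈ tsupport φ :=
    ((periodic_tsupport hφ.2.1).zsmul k x).symm ▸ hx
  have hy' : y + k • (P.L • axis n) ∈ P.carrier := by
    refine h (Metric.mem_cthickening_of_dist_le _ (x + k • (P.L • axis n)) _ _
      ⟨hx', slab_coord hk⟩ ?_)
    rwa [dist_add_right]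
  exact (P.periodic_carrier.zsmul k y) ▸ hy'

/-- The points whose whole vertical line lies in the support. -/
def columnSet (φ : Space n → Space n) : Set (Space n) := {x | ∀ t : ℝ, x + t • axis n ∈ tsupport φ}

theorem isClosed_columnSet (φ : Space n → Space n) : IsClosed (columnSet φ) := by
  have : columnSet φ = ⋂ t : ℝ, (fun x => x + t • axis n) ⁻¹' tsupport φ := by
    ext x; simp [columnSet]
  rw [this]
  exact isClosed_iInter fun t => (isClosed_tsupport φ).preimage (by fun_prop)

theorem columnSet_add {φ : Space n → Space n} {x : Space n} (t : ℝ) (hx : x ∈ columnSet φ) :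
    x + t • axis n ∈ columnSet φ := fun s => by
  rw [add_assoc, ← add_smul]; exact hx _

/-- A field with a zero on each vertical line is bounded by its gradient. -/
theorem lintegral_compl_columnSet_le {L : ℝ} (hL : 0 < L) {φ : Space n → Space n}
    (hφ : ContDiff ℝ 1 φ) (hp : Function.Periodic φ (L • axis n)) :
    ∫⁻ x in (columnSet φ)ᶜ, ‖φ x‖ₑ ^ 2 ∂period n L
      ≤ ENNReal.ofReal L ^ 2 * ∫⁻ x, ‖fderiv ℝ φ x‖ₑ ^ 2 ∂period n L := by
  have hm : Measurable fun p : Space n × ℝ => ‖fderiv ℝ φ (p.1 + p.2 • axis n)‖ₑ :=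
    measurable_enorm_fderiv_add hφ (axis n)
  have hax : ‖axis n‖ₑ = 1 := by rw [← ofReal_norm, norm_axis, ENNReal.ofReal_one]
  have hpt : ∀ x ∈ (columnSet φ)ᶜ, ‖φ x‖ₑ ^ 2 ≤
      ENNReal.ofReal L * ∫⁻ t in Icc 0 L, ‖fderiv ℝ φ (x + t • axis n)‖ₑ ^ 2 := by
    intro x hx
    have hx : ∃ t : ℝ, x + t • axis n ∉ tsupport φ := by simpa [columnSet] using hx
    obtain ⟨t, ht⟩ := hx
    -- By periodicity the zero of φ on this line is taken at axial distance less than L from x.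
    obtain ⟨k, hk, -⟩ := existsUnique_add_zsmul_mem_Ico hL t 0
    have h0 : φ (x + (t + k • L) • axis n) = 0 := by
      have := hp.zsmul k (x + t • axis n)
      rw [add_smul, ← add_assoc, smul_assoc, this]
      exact image_eq_zero_of_notMem_tsupport ht
    have h1 := enorm_add_smul_sub_le hφ x (axis n) hk.1
    rw [h0, zero_sub, enorm_neg] at h1
    simp only [hax, mul_one] at h1
    have h2 : ‖φ x‖ₑ ≤ ∫⁻ t in Icc 0 L, ‖fderiv ℝ φ (x + t • axis n)‖ₑ := by
      refine h1.trans (lintegral_mono_set (Icc_subset_Icc_right ?_))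
      simpa using hk.2.le
    calc _ ≤ _ := pow_le_pow_left' h2 2
      _ ≤ _ := by
        have := sq_lintegral_mul_le (volume.restrict (Icc (0 : ℝ) L)) (f := fun _ => 1)
          (g := fun t => ‖fderiv ℝ φ (x + t • axis n)‖ₑ) aemeasurable_const
          (hm.comp measurable_prodMk_left).aemeasurable
        simpa using this
  calc _ ≤ ∫⁻ x in (columnSet φ)ᶜ, (ENNReal.ofReal L *
          ∫⁻ t in Icc 0 L, ‖fderiv ℝ φ (x + t • axis n)‖ₑ ^ 2) ∂period n L :=
        setLIntegral_mono' (isClosed_columnSet φ).measurableSet.compl hpt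
    _ ≤ ∫⁻ x, (ENNReal.ofReal L *
          ∫⁻ t in Icc 0 L, ‖fderiv ℝ φ (x + t • axis n)‖ₑ ^ 2) ∂period n L :=
        setLIntegral_le_lintegral _ _
    _ = ENNReal.ofReal L * ∫⁻ t in Icc 0 L, ∫⁻ x, ‖fderiv ℝ φ (x + t • axis n)‖ₑ ^ 2
          ∂period n L := by
        rw [lintegral_const_mul' _ _ (by simp), lintegral_lintegral_swap]
        exact (hm.pow_const 2).aemeasurable
    _ = ENNReal.ofReal L * ∫⁻ t in Icc 0 L, ∫⁻ x, ‖fderiv ℝ φ x‖ₑ ^ 2 ∂period n L := by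
        congr 2; funext t
        exact lintegral_period_add hL (F := fun x => ‖fderiv ℝ φ x‖ₑ ^ 2)
          (fun x => by simp only [periodic_fderiv hp x]) (t • axis n)
    _ = _ := by
        simp [sq]; ring

/-- A profile constant along the axis, times e_z, is divergence-free. A cutoff of the column set
supported within the margin of the support of φ provides it. -/
theorem exists_column_test {φ : Space n → Space n} (hφ : φ ∈ P.testFields) :
    ∃ ψ : Space n → ℝ, Continuous ψ ∧ (fun x => ψ x • axis n) ∈ P.testFields ∧
      (∀ x, ψ x ∈ Icc (0 : ℝ) 1) ∧ ∀ x ∈ columnSet φ, ψ x = 1 := by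
  obtain ⟨δ, hδ, hm⟩ := exists_margin hφ
  have hd : Disjoint (Metric.thickening δ (columnSet φ))ᶜ (columnSet φ) :=
    disjoint_compl_left_iff_subset.2 (Metric.self_subset_thickening hδ _)
  obtain ⟨η, h0, h1, hη⟩ := exists_contMDiffMap_zero_one_of_isClosed
    (modelWithCornersSelf ℝ (Space n)) (n := (⊤ : ℕ∞))
    Metric.isOpen_thickening.isClosed_compl (isClosed_columnSet φ) hd
  have hηs : ContDiff ℝ ∞ η := η.contMDiff.contDiff
  -- Evaluating the cutoff at the projection of x to z = 0 makes it axially invariant; the column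
  -- set itself is invariant, so nothing is lost.
  set ψ : Space n → ℝ := fun x => η (x - x (Fin.last n) • axis n) with hψ
  have hψs : ContDiff ℝ ∞ ψ := by
    have : ContDiff ℝ ∞ fun x : Space n => x (Fin.last n) :=
      (EuclideanSpace.proj (𝕜 := ℝ) (Fin.last n)).contDiff
    exact hηs.comp (contDiff_id.sub (this.smul contDiff_const))
  have hinv : ∀ x (t : ℝ), ψ (x + t • axis n) = ψ x := by
    intro x t
    simp only [hψ]
    congr 1
    simp [axis_last, add_smul]
  have hsupp : tsupport (fun x => ψ x • axis n) ⊆ P.carrier := by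
    have hsub : Function.support (fun x => ψ x • axis n) ⊆ Metric.thickening δ (columnSet φ) := by
      intro x hx
      have hx1 : η (x - x (Fin.last n) • axis n) ≠ 0 := by
        intro h; apply hx; simp [hψ, h]
      have hx2 : x - x (Fin.last n) • axis n ∈ Metric.thickening δ (columnSet φ) := by
        by_contra h; exact hx1 (h0 h)
      obtain ⟨y, hy, hxy⟩ := Metric.mem_thickening_iff.1 hx2
      refine Metric.mem_thickening_iff.2 ⟨_, columnSet_add (x (Fin.last n)) hy, ?_⟩
      rwa [← dist_add_right _ _ (x (Fin.last n) • axis n), sub_add_cancel] at hxy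
    refine (closure_mono hsub).trans fun x hx => ?_
    have hx := Metric.closure_thickening_subset_cthickening _ _ hx
    have hx := Metric.cthickening_subset_thickening' (δ₂ := 2 * δ) (by positivity) (by linarith) _ hx
    obtain ⟨y, hy, hxy⟩ := Metric.mem_thickening_iff.1 hx
    have : y ∈ tsupport φ := by simpa using hy 0
    exact hm y this (Metric.mem_closedBall.2 hxy.le)
  refine ⟨ψ, hψs.continuous, ⟨hψs.smul contDiff_const, fun x => ?_, hsupp, fun x => ?_⟩,
    fun x => hη _, fun x hx => ?_⟩
  · simp only [hinv]
  · have hψd := (hψs.differentiable (by simp) x).hasFDerivAt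
    have hfd : HasFDerivAt (fun x => ψ x • axis n) _ x := hψd.smul_const (axis n)
    have hax : fderiv ℝ ψ x (axis n) = 0 :=
      fderiv_eq_zero_of_invariant (hψs.differentiable (by simp) x) fun t => hinv x t
    rw [divergence, hfd.fderiv, Finset.sum_eq_single (Fin.last n)]
    · simp only [ContinuousLinearMap.smulRight_apply, PiLp.smul_apply, axis_last, smul_eq_mul,
        mul_one]
      exact hax
    · intro i _ hi
      simp [axis_ne_last hi]
    · simp
  · refine h1 ?_
    have := columnSet_add (-x (Fin.last n)) hx
    rwa [neg_smul, ← sub_eq_add_neg] at this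

/-- Test the drive with ψe_z. For I = ∫ψ the product is (m/L)I, and it is at most √I because the
drive has norm at most one and ψ² ≤ ψ. Hence I ≤ (L/m)², and ψ = 1 on the columns. -/
theorem IsDrive.volume_columnSet_le {g : Space n → Space n} {m : ℝ} (hg : P.IsDrive g m)
    (hm : 0 < m) {φ : Space n → Space n} (hφ : φ ∈ P.testFields) :
    period n P.L (columnSet φ) ≤ ENNReal.ofReal ((P.L / m) ^ 2) := by
  obtain ⟨ψ, hψc, hψ, hψ1, hψK⟩ := exists_column_test hφ
  have hL := P.L_pos
  have hψ0 : ∀ x ∉ P.carrier, ψ x = 0 := by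
    intro x hx
    have := congrArg (fun y : Space n => y (Fin.last n)) (test_eq_zero hψ.2.2.1 hx)
    simpa [axis_last] using this
  have hi : Integrable ψ (period n P.L) :=
    P.integrable_period hψ0 (P.integrable_of_continuous hψc)
  set I := ∫ x, ψ x ∂period n P.L with hI
  have hI0 : 0 ≤ I := integral_nonneg fun x => (hψ1 x).1
  have hlint : ENNReal.ofReal I = ∫⁻ x, ENNReal.ofReal (ψ x) ∂period n P.L :=
    ofReal_integral_eq_lintegral_ofReal hi (Eventually.of_forall fun x => (hψ1 x).1)
  have hvol : period n P.L (columnSet φ) ≤ ENNReal.ofReal I := by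
    rw [hlint, ← setLIntegral_one]
    refine le_trans ?_ (setLIntegral_le_lintegral (columnSet φ) _)
    refine setLIntegral_mono' (isClosed_columnSet φ).measurableSet fun x hx => ?_
    simp [hψK x hx]
  refine hvol.trans (ENNReal.ofReal_le_ofReal ?_)
  have h1 := hg.enorm_inner_sq_le hψ.1.continuous.measurable
  rw [hg.flux _ hψ] at h1
  have h2 : ∫ x, (ψ x • axis n) (Fin.last n) ∂period n P.L = I := by simp [axis_last, hI]
  have h3 : ∫⁻ x, ‖ψ x • axis n‖ₑ ^ 2 ∂period n P.L ≤ ENNReal.ofReal I := by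
    rw [hlint]
    refine lintegral_mono fun x => ?_
    rw [← ofReal_norm, norm_smul, norm_axis, mul_one, Real.norm_of_nonneg (hψ1 x).1,
      ← ENNReal.ofReal_pow (hψ1 x).1]
    exact ENNReal.ofReal_le_ofReal (by nlinarith [(hψ1 x).1, (hψ1 x).2])
  have h4 := h1.trans h3
  rw [h2, ← ofReal_norm, Real.norm_of_nonneg (by positivity), ← ENNReal.ofReal_pow (by positivity),
    ENNReal.ofReal_le_ofReal_iff hI0] at h4
  rw [div_pow, le_div_iff₀ (by positivity)]
  rw [mul_pow, div_pow, div_mul_eq_mul_div, div_le_iff₀ (by positivity)] at h4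
  rcases hI0.eq_or_lt with h | h
  · rw [← h]; nlinarith [sq_nonneg P.L]
  · nlinarith

end Pipe

/-! ### Periodization of compactly supported fields -/

/-- The sum of the translates of a field by the multiples of the period. -/
def periodize (L : ℝ) (ψ : Space n → Space n) (x : Space n) : Space n :=
  ∑' k : ℤ, ψ (x + k • (L • axis n))

theorem periodic_periodize (L : ℝ) (ψ : Space n → Space n) :
    Function.Periodic (periodize L ψ) (L • axis n) := by
  intro x
  rw [periodize, periodize, ← (Equiv.addRight (1 : ℤ)).tsum_eq fun k => ψ (x + k • (L • axis n))]
  refine tsum_congr fun k => ?_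
  rw [Equiv.coe_addRight, add_smul, one_smul]
  congr 1
  abel

theorem exists_finset_translate {L : ℝ} (hL : 0 < L) {K : Set (Space n)}
    (hK : Bornology.IsBounded K) (M : ℝ) :
    ∃ s : Finset ℤ, ∀ x : Space n, |x (Fin.last n)| ≤ M → ∀ k ∉ s, x + k • (L • axis n) ∉ K := by
  obtain ⟨R, hR⟩ := hK.subset_closedBall 0
  refine ⟨Finset.Icc (-⌈(R + M) / L⌉) ⌈(R + M) / L⌉, fun x hx k hk hxk => hk ?_⟩
  have h1 := (PiLp.norm_apply_le _ (Fin.last n)).trans (mem_closedBall_zero_iff.1 (hR hxk))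
  have h2 : (x + k • (L • axis n)) (Fin.last n) = x (Fin.last n) + k * L := by simp [axis_last]
  rw [h2, Real.norm_eq_abs] at h1
  have h3 : |(k : ℝ)| * L ≤ R + M := by
    calc |(k : ℝ)| * L = |(k : ℝ) * L| := by rw [abs_mul, abs_of_pos hL]
      _ = |(x (Fin.last n) + k * L) - x (Fin.last n)| := by congr 1; ring
      _ ≤ |x (Fin.last n) + k * L| + |x (Fin.last n)| := abs_sub _ _
      _ ≤ _ := add_le_add h1 hx
  rw [← le_div_iff₀ hL] at h3
  rw [Finset.mem_Icc, ← abs_le]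
  have : ((|k| : ℤ) : ℝ) ≤ ⌈(R + M) / L⌉ := by
    rw [Int.cast_abs]; exact h3.trans (Int.le_ceil _)
  exact_mod_cast this

section Periodize

variable {L : ℝ} {ψ : Space n → Space n}

theorem exists_periodize_eq_sum (hL : 0 < L) (hc : HasCompactSupport ψ) (M : ℝ) :
    ∃ s : Finset ℤ, (∀ x : Space n, |x (Fin.last n)| ≤ M → ∀ k ∉ s,
      x + k • (L • axis n) ∉ tsupport ψ) ∧ ∀ x : Space n, |x (Fin.last n)| ≤ M →
        periodize L ψ x = ∑ k ∈ s, ψ (x + k • (L • axis n)) := by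
  obtain ⟨s, hs⟩ := exists_finset_translate hL hc.isCompact.isBounded M
  exact ⟨s, hs, fun x hx => tsum_eq_sum fun k hk =>
    image_eq_zero_of_notMem_tsupport (hs x hx k hk)⟩

theorem eventually_coord_le (x : Space n) :
    ∀ᶠ y in 𝓝 x, |y (Fin.last n)| ≤ |x (Fin.last n)| + 1 := by
  have hc : Continuous fun y : Space n => |y (Fin.last n)| :=
    (EuclideanSpace.proj (𝕜 := ℝ) (Fin.last n)).continuous.abs
  exact (hc.tendsto x).eventually_le_const (lt_add_one _)

theorem contDiff_periodize (hL : 0 < L) (hc : HasCompactSupport ψ) (hψ : ContDiff ℝ ∞ ψ) :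
    ContDiff ℝ ∞ (periodize L ψ) := by
  rw [contDiff_iff_contDiffAt]
  intro x
  obtain ⟨s, -, hs⟩ := exists_periodize_eq_sum hL hc (|x (Fin.last n)| + 1)
  have : periodize L ψ =ᶠ[𝓝 x] fun y => ∑ k ∈ s, ψ (y + k • (L • axis n)) :=
    (eventually_coord_le x).mono hs
  refine ContDiffAt.congr_of_eventuallyEq ?_ this
  refine ContDiffAt.sum fun k _ => ?_
  exact (hψ.comp (contDiff_id.add contDiff_const)).contDiffAt

theorem tsupport_periodize_subset (hL : 0 < L) (hc : HasCompactSupport ψ) {U : Set (Space n)}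
    (hU : Function.Periodic (· ∈ U) (L • axis n)) (hψ : tsupport ψ ⊆ U) :
    tsupport (periodize L ψ) ⊆ U := by
  intro x hx
  by_contra hxU
  obtain ⟨s, hs0, hs⟩ := exists_periodize_eq_sum hL hc (|x (Fin.last n)| + 1)
  refine (notMem_tsupport_iff_eventuallyEq.2 ?_) hx
  have hk : ∀ k ∈ s, ∀ᶠ y in 𝓝 x, ψ (y + k • (L • axis n)) = 0 := by
    intro k _
    have h1 : x + k • (L • axis n) ∉ tsupport ψ := fun h => hxU ((hU.zsmul k x) ▸ hψ h)
    have h2 : Tendsto (fun y => y + k • (L • axis n)) (𝓝 x) (𝓝 (x + k • (L • axis n))) :=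
      (continuous_id.add continuous_const).tendsto x
    exact h2.eventually (notMem_tsupport_iff_eventuallyEq.1 h1)
  filter_upwards [eventually_coord_le x, (Finset.eventually_all s).2 hk] with y hy hy'
  rw [hs y hy]
  exact Finset.sum_eq_zero hy'

theorem divergence_eq_zero_of_notMem {x : Space n} (hx : x ∉ tsupport ψ) : divergence ψ x = 0 := by
  have : fderiv ℝ ψ x = 0 :=
    image_eq_zero_of_notMem_tsupport fun h => hx (tsupport_fderiv_subset ℝ h)
  simp [divergence, this]

theorem divergence_periodize (hL : 0 < L) (hc : HasCompactSupport ψ) (hψ : ContDiff ℝ ∞ ψ)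
    (x : Space n) :
    divergence (periodize L ψ) x = ∑' k : ℤ, divergence ψ (x + k • (L • axis n)) := by
  obtain ⟨s, hs0, hs⟩ := exists_periodize_eq_sum hL hc (|x (Fin.last n)| + 1)
  have h1 : periodize L ψ =ᶠ[𝓝 x] fun y => ∑ k ∈ s, ψ (y + k • (L • axis n)) :=
    (eventually_coord_le x).mono hs
  rw [tsum_eq_sum fun k hk => divergence_eq_zero_of_notMem (hs0 x (by linarith) k hk), divergence,
    h1.fderiv_eq, fderiv_fun_sum fun k _ => ?_]
  · simp only [divergence, fderiv_comp_add_right, sum_apply]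
    rw [Finset.sum_comm]
    simp
  · exact ((hψ.comp (contDiff_id.add contDiff_const)).differentiable (by simp) x)

/-- Unfolding: the slab tiles the space under the axial translations and g is periodic, so the sum
over the translates of ψ on one slab is the integral of ψ over the whole space. -/
theorem integral_inner_periodize (hL : 0 < L) (hc : HasCompactSupport ψ)
    {g : Space n → Space n} (hg : Function.Periodic g (L • axis n))
    (hi : Integrable fun x => inner ℝ (g x) (ψ x)) :
    ∫ x, inner ℝ (g x) (periodize L ψ x) ∂period n L = ∫ x, inner ℝ (g x) (ψ x) := by
  obtain ⟨s, hs0, hs⟩ := exists_periodize_eq_sum hL hc L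
  have hinj : Function.Injective fun k : ℤ => k • (L • axis n) := by
    intro k k' h
    have := congrArg (fun y : Space n => y (Fin.last n)) h
    simp [axis_last] at this
    exact this.resolve_right hL.ne'
  let Θ : ℤ ≃ AddSubgroup.zmultiples (L • axis n) :=
    (Equiv.ofInjective _ hinj)
  rw [(isAddFundamentalDomain_slab hL 0).integral_eq_tsum'' _ hi, ← Θ.tsum_eq]
  have hΘ : ∀ (k : ℤ) (x : Space n), Θ k +ᵥ x = x + k • (L • axis n) := fun k x => by
    exact add_comm (k • (L • axis n)) x
  have hgk : ∀ (k : ℤ) (x : Space n), g (x + k • (L • axis n)) = g x := fun k x => hg.zsmul k x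
  simp only [hΘ, hgk]
  have hik : ∀ k : ℤ, IntegrableOn (fun x => inner ℝ (g x) (ψ (x + k • (L • axis n))))
      (slab n 0 L) := by
    intro k
    have := (hi.comp_add_right (k • (L • axis n))).integrableOn (s := slab n 0 L)
    simpa only [hgk] using this
  have hz : ∀ x ∈ slab n 0 L, |x (Fin.last n)| ≤ L := by
    intro x hx
    rw [abs_of_pos hx.1]; simpa using hx.2
  rw [tsum_eq_sum (s := s)]
  · rw [← integral_finsetSum s fun k _ => hik k]
    refine setIntegral_congr_fun (measurableSet_slab 0 L) fun x hx => ?_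
    simp only [hs x (hz x hx), inner_sum]
  · intro k hk
    refine setIntegral_eq_zero_of_forall_eq_zero fun x hx => ?_
    rw [image_eq_zero_of_notMem_tsupport (hs0 x (hz x hx) k hk), inner_zero_right]

end Periodize

/-- The total flux of a field is minus the first moment of its divergence. -/
theorem integral_coord_mul_divergence {ψ : Space n → Space n} (hc : HasCompactSupport ψ)
    (hψ : ContDiff ℝ ∞ ψ) (j : Fin (n + 1)) :
    ∫ x, x j * divergence ψ x = -∫ x, ψ x j := by
  have hcoord : ∀ x : Space n, HasFDerivAt (fun y : Space n => y j)
      (EuclideanSpace.proj (𝕜 := ℝ) j : Space n →L[ℝ] ℝ) x := fun x =>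
    (EuclideanSpace.proj (𝕜 := ℝ) j).hasFDerivAt
  have hcj : Continuous fun y : Space n => y j := (EuclideanSpace.proj (𝕜 := ℝ) j).continuous
  have hci : ∀ i, HasCompactSupport fun x => ψ x i := fun i =>
    hc.comp_left (g := fun y : Space n => y i) rfl
  have hψi : ∀ i, ContDiff ℝ ∞ fun x => ψ x i := fun i =>
    (EuclideanSpace.proj (𝕜 := ℝ) i).contDiff.comp hψ
  have hd : ∀ i x, fderiv ℝ (fun x => ψ x i) x (basisVec n i) = fderiv ℝ ψ x (basisVec n i) i := by
    intro i x
    have h2 := (EuclideanSpace.proj (𝕜 := ℝ) i).hasFDerivAt.comp x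
      (hψ.differentiable (by simp) x).hasFDerivAt
    have h3 : fderiv ℝ (fun x => ψ x i) x = _ := h2.fderiv
    rw [h3]; rfl
  have hcont : ∀ i, Continuous fun x => fderiv ℝ (fun x => ψ x i) x (basisVec n i) := fun i =>
    ((hψi i).continuous_fderiv (by simp)).clm_apply continuous_const
  have hcs : ∀ i, HasCompactSupport fun x => fderiv ℝ (fun x => ψ x i) x (basisVec n i) := fun i =>
    (hci i).fderiv_apply ℝ _
  have key : ∀ i, ∫ x, x j * fderiv ℝ (fun x => ψ x i) x (basisVec n i)
      = -∫ x, basisVec n i j * ψ x i := by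
    intro i
    have := integral_mul_fderiv_eq_neg_fderiv_mul_of_integrable (𝕜 := ℝ) (μ := volume)
      (f := fun x : Space n => x j) (g := fun x => ψ x i) (v := basisVec n i)
      ?_ ?_ ?_ (fun x _ => (hcoord x).differentiableAt)
      (fun x _ => (hψi i).differentiable (by simp) x)
    · rw [this]
      congr 2; funext x
      rw [(hcoord x).fderiv]; rfl
    · simp only [fun x => (hcoord x).fderiv]
      exact (continuous_const.mul (hψi i).continuous).integrable_of_hasCompactSupport
        (hci i).mul_left
    · exact (hcj.mul (hcont i)).integrable_of_hasCompactSupport (hcs i).mul_left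
    · exact (hcj.mul (hψi i).continuous).integrable_of_hasCompactSupport (hci i).mul_left
  simp only [divergence, Finset.mul_sum, ← hd]
  have hint : ∀ i, Integrable fun x => x j * fderiv ℝ (fun x => ψ x i) x (basisVec n i) :=
    fun i => (hcj.mul (hcont i)).integrable_of_hasCompactSupport (hcs i).mul_left
  rw [integral_finsetSum _ fun i _ => hint i]
  simp only [key]
  rw [Finset.sum_eq_single j]
  · simp [basisVec_apply]
  · intro i _ hi
    simp [basisVec_apply, hi.symm]
  · simp

/-! ### Mollifiers and transports of mollified mass -/

/-- A smooth probability density supported in the ball of radius `δ`. -/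
structure IsMollifier (ρ : Space n → ℝ) (δ : ℝ) : Prop where
  contDiff : ContDiff ℝ ∞ ρ
  tsupport_subset : tsupport ρ ⊆ Metric.closedBall 0 δ
  nonneg : ∀ x, 0 ≤ ρ x
  integral_eq_one : ∫ x, ρ x = 1

theorem exists_isMollifier {δ : ℝ} (hδ : 0 < δ) : ∃ ρ : Space n → ℝ, IsMollifier ρ δ := by
  let f : ContDiffBump (0 : Space n) := ⟨δ / 2, δ, by positivity, by linarith⟩
  exact ⟨f.normed volume, f.contDiff_normed (n := (⊤ : ℕ∞)), f.tsupport_normed_eq.subset,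
    f.nonneg_normed, f.integral_normed⟩

theorem IsMollifier.hasCompactSupport {ρ : Space n → ℝ} {δ : ℝ} (hρ : IsMollifier ρ δ) :
    HasCompactSupport ρ :=
  (isCompact_closedBall 0 δ).of_isClosed_subset (isClosed_tsupport ρ) hρ.tsupport_subset

theorem IsMollifier.eq_zero {ρ : Space n → ℝ} {δ : ℝ} (hρ : IsMollifier ρ δ) {x : Space n}
    (hx : δ < ‖x‖) : ρ x = 0 :=
  image_eq_zero_of_notMem_tsupport fun h =>
    hx.not_ge (mem_closedBall_zero_iff.1 (hρ.tsupport_subset h))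

theorem integrable_inner_of_hasCompactSupport {g ψ : Space n → Space n} (hg : LocallyIntegrable g)
    (hψ : Continuous ψ) (hc : HasCompactSupport ψ) : Integrable fun x => inner ℝ (g x) (ψ x) := by
  obtain ⟨C, hC⟩ := hψ.bounded_above_of_compact_support hc
  have h1 : IntegrableOn g (tsupport ψ) := hg.integrableOn_isCompact hc.isCompact
  have h2 : Integrable ((tsupport ψ).indicator fun x => C * ‖g x‖) :=
    (integrable_indicator_iff (isClosed_tsupport ψ).measurableSet).2 (h1.norm.const_mul C)
  refine h2.mono' (hg.aestronglyMeasurable.inner hψ.aestronglyMeasurable) ?_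
  refine Eventually.of_forall fun x => ?_
  by_cases hx : x ∈ tsupport ψ
  · rw [indicator_of_mem hx]
    calc _ ≤ ‖g x‖ * ‖ψ x‖ := norm_inner_le_norm _ _
      _ ≤ _ := by rw [mul_comm]; exact mul_le_mul_of_nonneg_right (hC x) (norm_nonneg _)
  · rw [indicator_of_notMem hx, image_eq_zero_of_notMem_tsupport hx]; simp

/-- A compactly supported smooth field in `U` transports the mollified mass at `x` to `y`, and its
product with `g` is `c`. -/
def IsTransport (U : Set (Space n)) (g : Space n → Space n) (ρ : Space n → ℝ) (x y : Space n)
    (c : ℝ) : Prop :=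
  ∃ ψ : Space n → Space n, ContDiff ℝ ∞ ψ ∧ HasCompactSupport ψ ∧ tsupport ψ ⊆ U ∧
    (∀ z, divergence ψ z = ρ (z - x) - ρ (z - y)) ∧ ∫ z, inner ℝ (g z) (ψ z) = c

theorem divergence_add {φ ψ : Space n → Space n} (hφ : ContDiff ℝ ∞ φ) (hψ : ContDiff ℝ ∞ ψ)
    (x : Space n) : divergence (fun z => φ z + ψ z) x = divergence φ x + divergence ψ x := by
  simp only [divergence]
  rw [fderiv_fun_add (hφ.differentiable (by simp) x) (hψ.differentiable (by simp) x)]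
  simp [Finset.sum_add_distrib]

theorem divergence_comp_add_right (ψ : Space n → Space n) (a x : Space n) :
    divergence (fun z => ψ (z + a)) x = divergence ψ (x + a) := by
  simp only [divergence, fderiv_comp_add_right]

section Transport

variable {U : Set (Space n)} {g : Space n → Space n} {ρ : Space n → ℝ}

theorem IsTransport.refl (x : Space n) : IsTransport U g ρ x x 0 :=
  ⟨0, contDiff_const, HasCompactSupport.zero, by simp [tsupport], fun z => by simp [divergence],
    by simp⟩

theorem IsTransport.add (hg : LocallyIntegrable g) {x y z : Space n} {c d : ℝ}
    (h : IsTransport U g ρ x y c) (h' : IsTransport U g ρ y z d) :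
    IsTransport U g ρ x z (c + d) := by
  obtain ⟨ψ, h1, h2, h3, h4, h5⟩ := h
  obtain ⟨χ, k1, k2, k3, k4, k5⟩ := h'
  refine ⟨fun z => ψ z + χ z, h1.add k1, h2.add k2, (tsupport_add ψ χ).trans (union_subset h3 k3),
    fun w => ?_, ?_⟩
  · rw [divergence_add h1 k1, h4, k4]; ring
  · simp only [inner_add_right]
    rw [integral_add (integrable_inner_of_hasCompactSupport hg h1.continuous h2)
      (integrable_inner_of_hasCompactSupport hg k1.continuous k2), h5, k5]

theorem IsTransport.symm {x y : Space n} {c : ℝ} (h : IsTransport U g ρ x y c) :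
    IsTransport U g ρ y x (-c) := by
  obtain ⟨ψ, h1, h2, h3, h4, h5⟩ := h
  refine ⟨fun z => -ψ z, h1.neg, h2.neg, ?_, fun w => ?_, ?_⟩
  · have : tsupport (fun z => -ψ z) = tsupport ψ := by
      rw [tsupport, tsupport, Function.support_fun_neg]
    rw [this]; exact h3
  · have := h4 w
    simp only [divergence, fderiv_fun_neg] at this ⊢
    simp [this]
  · simp only [inner_neg_right, integral_neg, h5]

theorem IsTransport.translate {v : Space n} (hg : Function.Periodic g v)
    (hU : Function.Periodic (· ∈ U) v) {x y : Space n} {c : ℝ} (h : IsTransport U g ρ x y c)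
    (k : ℤ) : IsTransport U g ρ (x + k • v) (y + k • v) c := by
  obtain ⟨ψ, h1, h2, h3, h4, h5⟩ := h
  have hsub : ∀ z, z - k • v = z + (-k) • v := fun z => by rw [neg_smul, sub_eq_add_neg]
  refine ⟨fun z => ψ (z + (-k) • v), h1.comp (contDiff_id.add contDiff_const),
    h2.comp_homeomorph (Homeomorph.addRight ((-k) • v)), ?_, fun w => ?_, ?_⟩
  · have : tsupport (fun z => ψ (z + (-k) • v)) = (Homeomorph.addRight ((-k) • v)) ⁻¹' tsupport ψ :=
      (tsupport_comp_eq_preimage ψ (Homeomorph.addRight ((-k) • v)))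
    rw [this]
    intro z hz
    exact (hU.zsmul (-k) z) ▸ h3 hz
  · rw [divergence_comp_add_right, h4]
    congr 2 <;> rw [neg_smul] <;> abel
  · rw [← h5, ← integral_add_right_eq_self (fun z => inner ℝ (g z) (ψ z)) ((-k) • v)]
    congr 1; funext z
    rw [hg.zsmul (-k) z]

end Transport

/-- The mean of `g` over the translates of the mollifier. -/
def mollify (ρ : Space n → ℝ) (g : Space n → Space n) (x : Space n) : Space n :=
  ∫ h, ρ h • g (x + h)

theorem mollify_eq (ρ : Space n → ℝ) (g : Space n → Space n) (x : Space n) :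
    mollify ρ g x = ∫ z, ρ (z - x) • g z := by
  rw [mollify, ← integral_add_left_eq_self (fun z => ρ (z - x) • g z) x]
  simp

section Segment

variable {ρ : Space n → ℝ} {δ : ℝ}

/-- The density of the segment from `x` to `x + v`, smeared by the mollifier. -/
def segmentDensity (ρ : Space n → ℝ) (x v z : Space n) : ℝ :=
  ∫ t in Icc (0 : ℝ) 1, ρ (z - (x + t • v))

/-- It is the convolution of the mollifier with the image of Lebesgue measure on the segment, which
is a finite measure. -/
theorem contDiff_segmentDensity (hρ : IsMollifier ρ δ) (x v : Space n) :
    ContDiff ℝ ∞ (segmentDensity ρ x v) := by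
  let ν : Measure (Space n) := (volume.restrict (Icc (0 : ℝ) 1)).map fun t => x + t • v
  have hm : Continuous fun t : ℝ => x + t • v := by fun_prop
  have hν : IsFiniteMeasure ν := by infer_instance
  have hf : LocallyIntegrable (fun _ : Space n => (1 : ℝ)) ν := (integrable_const 1).locallyIntegrable
  have h := hρ.hasCompactSupport.contDiff_convolution_right (n := (⊤ : ℕ∞))
    (ContinuousLinearMap.lsmul ℝ ℝ) hf hρ.contDiff
  convert h using 1
  funext z
  rw [convolution_def, integral_map hm.aemeasurable]
  · simp [segmentDensity]
  · have : Continuous fun t => ρ (z - t) := hρ.contDiff.continuous.comp (by fun_prop)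
    simpa using this.aestronglyMeasurable

/-- Moving z along v slides the window of integration from [0, 1] to [−s, 1 − s], so the derivative
is a difference of end values. Consequently the density times v is a field that transports the mass
from x to x + v. -/
theorem fderiv_segmentDensity (hρ : IsMollifier ρ δ) (x v z : Space n) :
    fderiv ℝ (segmentDensity ρ x v) z v = ρ (z - x) - ρ (z - (x + v)) := by
  have hd := (contDiff_segmentDensity hρ x v).differentiable (by simp) z
  have h2 : HasDerivAt (fun s : ℝ => segmentDensity ρ x v (z + s • v))
      (fderiv ℝ (segmentDensity ρ x v) z v) 0 := hasDerivAt_line hd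
  set f : ℝ → ℝ := fun t => ρ (z - (x + t • v)) with hf
  have hfc : Continuous f := hρ.contDiff.continuous.comp (by fun_prop)
  have hii : ∀ a b, IntervalIntegrable f volume a b := fun a b => hfc.intervalIntegrable a b
  have e : (fun s : ℝ => segmentDensity ρ x v (z + s • v))
      = fun s => (∫ t in (0 : ℝ)..(1 - s), f t) - ∫ t in (0 : ℝ)..(0 - s), f t := by
    funext s
    rw [intervalIntegral.integral_interval_sub_left (hii _ _) (hii _ _),
      ← intervalIntegral.integral_comp_sub_right (f := f), segmentDensity,
      integral_Icc_eq_integral_Ioc, ← intervalIntegral.integral_of_le zero_le_one]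
    congr 1; funext t
    simp only [hf]
    congr 1
    rw [sub_smul]; abel
  have hF : ∀ u, HasDerivAt (fun u => ∫ t in (0 : ℝ)..u, f t) (f u) u := fun u =>
    intervalIntegral.integral_hasDerivAt_right (hii _ _)
      (hfc.stronglyMeasurableAtFilter _ _) hfc.continuousAt
  have hsub : ∀ a : ℝ, HasDerivAt (fun s : ℝ => a - s) (-1) 0 := fun a => by
    simpa using (hasDerivAt_id (0 : ℝ)).const_sub a
  have h4 : HasDerivAt (fun s : ℝ => (∫ t in (0 : ℝ)..(1 - s), f t) - ∫ t in (0 : ℝ)..(0 - s), f t)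
      (f (1 - 0) * (-1) - f (0 - 0) * (-1)) 0 :=
    (HasDerivAt.comp (0 : ℝ) (hF (1 - 0)) (hsub 1)).sub
      (HasDerivAt.comp (0 : ℝ) (hF (0 - 0)) (hsub 0))
  rw [e] at h2
  rw [h2.unique h4]
  simp [hf]
  ring

theorem segmentDensity_eq_zero (hρ : IsMollifier ρ δ) {x v z : Space n} (hv : ‖v‖ ≤ δ)
    (hz : 2 * δ < ‖z - x‖) : segmentDensity ρ x v z = 0 := by
  refine setIntegral_eq_zero_of_forall_eq_zero fun t ht => hρ.eq_zero ?_
  have h1 : ‖z - x‖ ≤ ‖z - (x + t • v)‖ + ‖t • v‖ := by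
    calc ‖z - x‖ = ‖(z - (x + t • v)) + t • v‖ := by congr 1; abel
      _ ≤ _ := norm_add_le _ _
  have h2 : ‖t • v‖ ≤ δ := by
    rw [norm_smul, Real.norm_of_nonneg ht.1]
    nlinarith [ht.2, norm_nonneg v]
  linarith

theorem exists_lipschitz (hρ : IsMollifier ρ δ) : ∃ C : ℝ, 0 ≤ C ∧ ∀ x y, |ρ x - ρ y| ≤ C * ‖x - y‖ := by
  obtain ⟨C, hC⟩ := hρ.contDiff.lipschitzWith_of_hasCompactSupport hρ.hasCompactSupport (by simp)
  exact ⟨C, C.2, fun x y => by simpa [Real.dist_eq, dist_eq_norm] using hC.dist_le_mul x y⟩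

theorem abs_segmentDensity_sub_le {C : ℝ} (hρ : IsMollifier ρ δ)
    (hC0 : 0 ≤ C) (hC : ∀ x y, |ρ x - ρ y| ≤ C * ‖x - y‖) (x v z : Space n) :
    |segmentDensity ρ x v z - ρ (z - x)| ≤ C * ‖v‖ := by
  have hfc : Continuous fun t : ℝ => ρ (z - (x + t • v)) :=
    hρ.contDiff.continuous.comp (by fun_prop)
  have e : segmentDensity ρ x v z - ρ (z - x)
      = ∫ t in Icc (0 : ℝ) 1, (ρ (z - (x + t • v)) - ρ (z - x)) := by
    rw [integral_sub (hfc.integrableOn_Icc) (by simp), segmentDensity]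
    simp
  rw [e, ← Real.norm_eq_abs]
  refine (norm_setIntegral_le_of_norm_le_const (C := C * ‖v‖) (by simp) fun t ht => ?_).trans ?_
  · refine (hC _ _).trans (mul_le_mul_of_nonneg_left ?_ hC0)
    have : z - (x + t • v) - (z - x) = -(t • v) := by abel
    rw [this, norm_neg, norm_smul, Real.norm_of_nonneg ht.1]
    exact mul_le_of_le_one_left (norm_nonneg _) ht.2
  · simp

theorem divergence_smul_const {A : Space n → ℝ} (hA : ContDiff ℝ ∞ A) (v z : Space n) :
    divergence (fun z => A z • v) z = fderiv ℝ A z v := by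
  have h : HasFDerivAt (fun z => A z • v) _ z :=
    ((hA.differentiable (by simp) z).hasFDerivAt).smul_const v
  have hv : v = ∑ i, v i • basisVec n i := by
    ext j
    simp [basisVec_apply]
  rw [divergence, h.fderiv]
  conv_rhs => rw [hv]
  simp [map_sum, mul_comm]

/-- Nearby points are connected by a transport, whose product with `g` is given to first order by
the mollified field. -/
theorem exists_transport_near {U : Set (Space n)} {g : Space n → Space n}
    (hg : LocallyIntegrable g) (hρ : IsMollifier ρ δ) {x : Space n}
    (hx : Metric.closedBall x (2 * δ) ⊆ U) :
    ∃ C : ℝ, ∀ v : Space n, ‖v‖ ≤ δ → ∃ c, IsTransport U g ρ x (x + v) c ∧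
      |c - inner ℝ (mollify ρ g x) v| ≤ C * ‖v‖ ^ 2 := by
  obtain ⟨C, hC0, hC⟩ := exists_lipschitz hρ
  -- One factor ‖v‖ of the error comes from the Lipschitz bound for replacing the segment density by
  -- ρ(· − x), the other from the field v itself.
  refine ⟨C * ∫ z in Metric.closedBall x (2 * δ), ‖g z‖, fun v hv => ?_⟩
  have hA := contDiff_segmentDensity hρ x v
  set A := segmentDensity ρ x v
  have hA0 : ∀ z ∉ Metric.closedBall x (2 * δ), A z = 0 := by
    intro z hz
    refine segmentDensity_eq_zero hρ hv ?_
    rw [Metric.mem_closedBall, dist_eq_norm] at hz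
    exact not_le.1 hz
  have hsupp : tsupport (fun z => A z • v) ⊆ Metric.closedBall x (2 * δ) := by
    refine closure_minimal (fun z hz => ?_) Metric.isClosed_closedBall
    by_contra h
    exact hz (by simp [hA0 z h])
  have hcs : HasCompactSupport fun z => A z • v :=
    (isCompact_closedBall x (2 * δ)).of_isClosed_subset (isClosed_tsupport _) hsupp
  refine ⟨_, ⟨fun z => A z • v, hA.smul contDiff_const, hcs, hsupp.trans hx, fun z => ?_, rfl⟩, ?_⟩
  · rw [divergence_smul_const hA, fderiv_segmentDensity hρ]
  have hρx : Continuous fun z => ρ (z - x) := hρ.contDiff.continuous.comp (by fun_prop)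
  have hρcs : HasCompactSupport fun z => ρ (z - x) :=
    hρ.hasCompactSupport.comp_homeomorph (Homeomorph.subRight x)
  have hint : Integrable fun z => ρ (z - x) • g z :=
    hg.integrable_smul_left_of_hasCompactSupport hρx hρcs
  have hint1 : Integrable fun z => inner ℝ (g z) (A z • v) :=
    integrable_inner_of_hasCompactSupport hg (hA.smul contDiff_const).continuous hcs
  have hint2 : Integrable fun z => inner ℝ (ρ (z - x) • g z) v := hint.inner_const v
  have e1 : inner ℝ (mollify ρ g x) v = ∫ z, inner ℝ (ρ (z - x) • g z) v := by
    rw [mollify_eq, real_inner_comm, ← integral_inner hint]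
    simp only [real_inner_comm]
  change |(∫ z, inner ℝ (g z) (A z • v)) - _| ≤ _
  rw [e1, ← integral_sub hint1 hint2]
  have e2 : ∀ z, inner ℝ (g z) (A z • v) - inner ℝ (ρ (z - x) • g z) v
      = (A z - ρ (z - x)) * inner ℝ (g z) v := fun z => by
    rw [real_inner_smul_right, real_inner_smul_left]; ring
  simp only [e2]
  have hδ : 0 ≤ δ := (norm_nonneg v).trans hv
  have e3 : ∀ z ∉ Metric.closedBall x (2 * δ), (A z - ρ (z - x)) * inner ℝ (g z) v = 0 := by
    intro z hz
    rw [hA0 z hz, hρ.eq_zero, sub_zero, zero_mul]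
    rw [Metric.mem_closedBall, dist_eq_norm, not_le] at hz
    linarith
  rw [← setIntegral_eq_integral_of_forall_compl_eq_zero e3, ← Real.norm_eq_abs]
  have hgi : IntegrableOn g (Metric.closedBall x (2 * δ)) :=
    hg.integrableOn_isCompact (isCompact_closedBall _ _)
  calc _ ≤ ∫ z in Metric.closedBall x (2 * δ), C * ‖v‖ ^ 2 * ‖g z‖ := by
        refine norm_integral_le_of_norm_le (hgi.norm.const_mul _) (Eventually.of_forall fun z => ?_)
        rw [norm_mul, Real.norm_eq_abs]
        calc _ ≤ (C * ‖v‖) * (‖g z‖ * ‖v‖) :=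
              mul_le_mul (abs_segmentDensity_sub_le hρ hC0 hC x v z) (norm_inner_le_norm _ _)
                (norm_nonneg _) (by positivity)
          _ = _ := by ring
    _ = _ := by rw [integral_const_mul]; ring

end Segment

theorem inner_axis (y : Space n) : inner ℝ (axis n) y = y (Fin.last n) := by
  rw [axis, basisVec, EuclideanSpace.inner_single_left]; simp

theorem enorm_inner_le {E : Type*} [NormedAddCommGroup E] [InnerProductSpace ℝ E] (x y : E) :
    ‖(inner ℝ x y : ℝ)‖ₑ ≤ ‖x‖ₑ * ‖y‖ₑ := by
  rw [← ofReal_norm, ← ofReal_norm x, ← ofReal_norm y, ← ENNReal.ofReal_mul (norm_nonneg _)]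
  exact ENNReal.ofReal_le_ofReal (norm_inner_le_norm _ _)

theorem ENNReal_le_one_add_sq (a : ENNReal) : a ≤ 1 + a ^ 2 := by
  rcases le_total a 1 with h | h
  · exact h.trans le_self_add
  · calc a = a * 1 := (mul_one a).symm
      _ ≤ a * a := by gcongr
      _ = a ^ 2 := (sq a).symm
      _ ≤ _ := le_add_self

theorem ENNReal_mul_le_add_sq (a b : ENNReal) : a * b ≤ a ^ 2 + b ^ 2 := by
  rcases le_total a b with h | h
  · calc a * b ≤ b * b := by gcongr
      _ = b ^ 2 := (sq b).symm
      _ ≤ _ := le_add_self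
  · calc a * b ≤ a * a := by gcongr
      _ = a ^ 2 := (sq a).symm
      _ ≤ _ := le_self_add

namespace IsMollifier

variable {ρ : Space n → ℝ} {δ : ℝ}

theorem integrable (hρ : IsMollifier ρ δ) : Integrable ρ :=
  hρ.contDiff.continuous.integrable_of_hasCompactSupport hρ.hasCompactSupport

theorem lintegral_eq_one (hρ : IsMollifier ρ δ) : ∫⁻ h, ENNReal.ofReal (ρ h) = 1 := by
  rw [← ofReal_integral_eq_lintegral_ofReal hρ.integrable (Eventually.of_forall hρ.nonneg),
    hρ.integral_eq_one, ENNReal.ofReal_one]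

theorem integral_coord_mul (hρ : IsMollifier ρ δ) (a : Space n) :
    Integrable (fun z : Space n => z (Fin.last n) * ρ (z - a)) ∧
      ∫ z : Space n, z (Fin.last n) * ρ (z - a)
        = (∫ z : Space n, z (Fin.last n) * ρ z) + a (Fin.last n) := by
  have hz : Continuous fun z : Space n => z (Fin.last n) :=
    (EuclideanSpace.proj (𝕜 := ℝ) (Fin.last n)).continuous
  have hi : Integrable fun z : Space n => z (Fin.last n) * ρ z :=
    (hz.mul hρ.contDiff.continuous).integrable_of_hasCompactSupport hρ.hasCompactSupport.mul_left
  have hi2 : Integrable fun z : Space n => a (Fin.last n) * ρ z := hρ.integrable.const_mul _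
  have e : (fun z : Space n => (z + a) (Fin.last n) * ρ (z + a - a))
      = fun z => z (Fin.last n) * ρ z + a (Fin.last n) * ρ z := by
    funext z
    rw [add_sub_cancel_right, PiLp.add_apply]; ring
  constructor
  · have := (hi.add hi2).comp_sub_right a
    refine this.congr (Eventually.of_forall fun z => ?_)
    simp only [Pi.add_apply, PiLp.sub_apply]; ring
  · rw [← integral_add_right_eq_self (fun z : Space n => z (Fin.last n) * ρ (z - a)) a, e,
      integral_add hi hi2, integral_const_mul, hρ.integral_eq_one, mul_one]

/-- The translates of a mollifier by the multiples of the period. -/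
theorem summable_translate (hρ : IsMollifier ρ δ) {L : ℝ} (hL : 0 < L) (x : Space n) :
    Summable fun k : ℤ => ρ (x + k • (L • axis n)) := by
  obtain ⟨s, hs⟩ := exists_finset_translate hL hρ.hasCompactSupport.isCompact.isBounded
    |x (Fin.last n)|
  refine summable_of_ne_finset_zero (s := s) fun k hk => ?_
  exact image_eq_zero_of_notMem_tsupport (hs x le_rfl k hk)

end IsMollifier

/-! ### The mollified drive and its phase modulo the integers -/

namespace Pipe

variable {P : Pipe n} {g : Space n → Space n} {m : ℝ} {ρ : Space n → ℝ} {δ : ℝ}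

theorem IsDrive.locallyIntegrable (hg : P.IsDrive g m) : LocallyIntegrable g := by
  intro x
  have hL := P.L_pos
  set s : Set (Space n) := slab n (x (Fin.last n) - P.L / 2) P.L ∩ Metric.closedBall x 1 with hs
  have hz : Continuous fun z : Space n => z (Fin.last n) :=
    (EuclideanSpace.proj (𝕜 := ℝ) (Fin.last n)).continuous
  refine ⟨s, inter_mem ?_ (Metric.closedBall_mem_nhds x one_pos),
    hg.measurable.aestronglyMeasurable, ?_⟩
  · refine hz.continuousAt.preimage_mem_nhds (Ioc_mem_nhds ?_ ?_) <;> linarith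
  have hper : Function.Periodic (fun x => ‖g x‖ₑ ^ 2) (P.L • axis n) := fun x => by
    simp only [hg.periodic x]
  have h1 : ∫⁻ x in s, ‖g x‖ₑ ^ 2 ≤ 1 := by
    refine (lintegral_mono_set inter_subset_left).trans ?_
    rw [lintegral_slab hL _ hper]
    exact hg.norm_le
  have h2 : volume s < ⊤ := (measure_mono inter_subset_right).trans_lt
    measure_closedBall_lt_top
  calc ∫⁻ x in s, ‖g x‖ₑ ≤ ∫⁻ x in s, (1 + ‖g x‖ₑ ^ 2) :=
        lintegral_mono fun x => ENNReal_le_one_add_sq _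
    _ = volume s + ∫⁻ x in s, ‖g x‖ₑ ^ 2 := by
        rw [lintegral_add_left measurable_const, setLIntegral_one]
    _ < ⊤ := ENNReal.add_lt_top.2 ⟨h2, h1.trans_lt ENNReal.one_lt_top⟩

/-- The product of the drive with a transport around the period. -/
theorem IsDrive.transport_period (hg : P.IsDrive g m) (hρ : IsMollifier ρ δ) {x : Space n} {k : ℤ}
    {c : ℝ} (h : IsTransport P.carrier g ρ x (x + k • (P.L • axis n)) c) : c = k * m := by
  obtain ⟨ψ, h1, h2, h3, h4, h5⟩ := h
  have hL := P.L_pos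
  -- Source and sink differ by a multiple of the period, so they cancel in the periodization, which
  -- is then a test field.
  have hdiv : ∀ z, divergence (periodize P.L ψ) z = 0 := by
    intro z
    rw [divergence_periodize hL h2 h1]
    simp only [h4]
    have e1 : ∀ j : ℤ, z + j • (P.L • axis n) - x = (z - x) + j • (P.L • axis n) := fun j => by
      abel
    have e2 : ∀ j : ℤ, z + j • (P.L • axis n) - (x + k • (P.L • axis n))
        = (z - x) + (Equiv.subRight k j) • (P.L • axis n) := fun j => by
      rw [Equiv.subRight_apply, sub_smul]; abel
    simp only [e1, e2]
    have hs := hρ.summable_translate hL (z - x)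
    have hs' : Summable fun j : ℤ => ρ ((z - x) + (Equiv.subRight k j) • (P.L • axis n)) :=
      (Equiv.subRight k).summable_iff.2 hs
    rw [hs.tsum_sub hs', (Equiv.subRight k).tsum_eq fun j => ρ ((z - x) + j • (P.L • axis n)),
      sub_self]
  have htest : periodize P.L ψ ∈ P.testFields :=
    ⟨contDiff_periodize hL h2 h1, periodic_periodize _ _,
      tsupport_periodize_subset hL h2 periodic_carrier h3, hdiv⟩
  have hflux := hg.flux _ htest
  rw [integral_inner_periodize hL h2 hg.periodic
    (integrable_inner_of_hasCompactSupport hg.locallyIntegrable h1.continuous h2), h5] at hflux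
  have haxis : ∫ z, periodize P.L ψ z (Fin.last n) ∂period n P.L = ∫ z, ψ z (Fin.last n) := by
    have := integral_inner_periodize (g := fun _ => axis n) hL h2 (fun _ => rfl)
      (integrable_inner_of_hasCompactSupport (locallyIntegrable_const _) h1.continuous h2)
    simpa only [inner_axis] using this
  -- The flux of a transport is the displacement of the centre of mass, here kL, so m/L times it is
  -- km.
  have hmom := integral_coord_mul_divergence h2 h1 (Fin.last n)
  simp only [h4, mul_sub] at hmom
  rw [integral_sub (hρ.integral_coord_mul _).1 (hρ.integral_coord_mul _).1,
    (hρ.integral_coord_mul _).2, (hρ.integral_coord_mul _).2] at hmom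
  have hk : (x + k • (P.L • axis n)) (Fin.last n) = x (Fin.last n) + k * P.L := by simp [axis_last]
  rw [hk] at hmom
  have hI : ∫ z, ψ z (Fin.last n) = k * P.L := by linarith
  rw [hflux, haxis, hI]
  field_simp

/-- The potential of the mollified drive, well-defined modulo the integers. -/
theorem IsDrive.exists_phase (hg : P.IsDrive g m) (hm : m ≠ 0) (hρ : IsMollifier ρ δ) :
    ∃ θ : Space n → ℝ, ∀ x y (k : ℤ) c, IsTransport P.carrier g ρ x (y + k • (P.L • axis n)) c →
      ∃ j : ℤ, θ y = θ x + c / m + j := by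
  set v := P.L • axis n
  have hgl := hg.locallyIntegrable
  have htr : ∀ {x y : Space n} {c : ℝ} (j : ℤ), IsTransport P.carrier g ρ x y c →
      IsTransport P.carrier g ρ (x + j • v) (y + j • v) c := fun j h =>
    h.translate hg.periodic periodic_carrier j
  have htrans : ∀ {x y z : Space n} {c d : ℝ} {k j : ℤ}, IsTransport P.carrier g ρ x (y + k • v) c →
      IsTransport P.carrier g ρ y (z + j • v) d →
      IsTransport P.carrier g ρ x (z + (j + k) • v) (c + d) := by
    intro x y z c d k j h h'
    rw [add_smul, ← add_assoc]
    exact h.add hgl (htr k h')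
  have hsymm : ∀ {x y : Space n} {c : ℝ} {k : ℤ}, IsTransport P.carrier g ρ x (y + k • v) c →
      IsTransport P.carrier g ρ y (x + (-k) • v) (-c) := by
    intro x y c k h
    have := htr (-k) h.symm
    rwa [add_assoc, ← add_smul, add_neg_cancel, zero_smul, add_zero] at this
  -- Classes of points joined by transports up to axial periods. The phase is the product along a
  -- chosen transport from a representative of the class, divided by m. No connectedness of the pipe
  -- is needed, since phases of different classes are never compared.
  let r : Setoid (Space n) :=
    { r := fun x y => ∃ (k : ℤ) (c : ℝ), IsTransport P.carrier g ρ x (y + k • v) c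
      iseqv := ⟨fun x => ⟨0, 0, by rw [zero_smul, add_zero]; exact IsTransport.refl x⟩,
        fun ⟨k, c, h⟩ => ⟨-k, -c, hsymm h⟩,
        fun ⟨k, c, h⟩ ⟨j, d, h'⟩ => ⟨j + k, c + d, htrans h h'⟩⟩ }
  let rep : Space n → Space n := fun x => (Quotient.mk r x).out
  have hrep : ∀ x, ∃ (k : ℤ) (c : ℝ), IsTransport P.carrier g ρ (rep x) (x + k • v) c :=
    fun x => Quotient.exact (s := r) (Quotient.out_eq _)
  choose κ c₀ hκ using hrep
  refine ⟨fun x => c₀ x / m, fun x y k c h => ?_⟩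
  have hxy : rep x = rep y :=
    congrArg Quotient.out (Quotient.sound (s := r) ⟨k, c, h⟩ : Quotient.mk r x = Quotient.mk r y)
  have h1 := htrans (hκ x) h
  rw [hxy] at h1
  -- Representative to x, x to y, and back: a closed transport modulo the period, whose product is
  -- an integer multiple of m.
  have h2 := htrans (hsymm (hκ y)) h1
  have h3 := hg.transport_period hρ h2
  refine ⟨-(k + κ x + -κ y), ?_⟩
  have : c₀ y = c₀ x + c - (k + κ x + -κ y) * m := by push_cast at h3; linarith
  simp only [this]
  push_cast
  field_simp
  ring

/-- `θ` is a potential of `m⁻¹ E` modulo the integers. -/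
structure IsPhase (P : Pipe n) (E : Space n → Space n) (m δ : ℝ) (θ : Space n → ℝ) : Prop where
  translate : ∀ x, ∃ j : ℤ, θ (x + P.L • axis n) = θ x + j
  lift : ∀ x, Metric.closedBall x (2 * δ) ⊆ P.carrier → ∃ τ : Space n → ℝ, τ x = θ x ∧
    HasFDerivAt τ (m⁻¹ • innerSL ℝ (E x)) x ∧ ∀ᶠ y in 𝓝 x, ∃ j : ℤ, θ y = τ y + j

/-- Short segments are transports with product (E(x), v) + O(‖v‖²). Hence θ(x) + c(y − x)/m is a
branch of the phase near x, differentiable at x with gradient E(x)/m. -/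
theorem IsDrive.exists_isPhase (hg : P.IsDrive g m) (hm : m ≠ 0) (hδ : 0 < δ)
    (hρ : IsMollifier ρ δ) : ∃ θ, P.IsPhase (mollify ρ g) m δ θ := by
  obtain ⟨θ, hθ⟩ := hg.exists_phase hm hρ
  refine ⟨θ, fun x => ?_, fun x hx => ?_⟩
  -- The trivial transport from x to itself, read as one from x to (x + L e_z) − L e_z.
  · obtain ⟨j, hj⟩ := hθ x (x + P.L • axis n) (-1) 0 (by
      rw [neg_smul, one_smul, add_neg_cancel_right]; exact IsTransport.refl x)
    exact ⟨j, by simpa using hj⟩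
  · obtain ⟨C, hC⟩ := exists_transport_near hg.locallyIntegrable hρ hx
    have hC' : ∀ v : Space n, ∃ c, ‖v‖ ≤ δ → IsTransport P.carrier g ρ x (x + v) c ∧
        |c - inner ℝ (mollify ρ g x) v| ≤ C * ‖v‖ ^ 2 := by
      intro v
      by_cases hv : ‖v‖ ≤ δ
      · obtain ⟨c, hc⟩ := hC v hv
        exact ⟨c, fun _ => hc⟩
      · exact ⟨0, fun h => absurd h hv⟩
    choose c hc using hC'
    -- The choice of c is arbitrary, but its quadratic error vanishes at v = 0.
    have hc0 : c 0 = 0 := by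
      have := (hc 0 (by simpa using hδ.le)).2
      simpa using this
    have hnear : ∀ᶠ y in 𝓝 x, ‖y - x‖ ≤ δ := by
      filter_upwards [Metric.closedBall_mem_nhds x hδ] with y hy
      rwa [Metric.mem_closedBall, dist_eq_norm] at hy
    have hcd : HasFDerivAt (fun y => c (y - x)) (innerSL ℝ (mollify ρ g x)) x := by
      rw [hasFDerivAt_iff_isLittleO]
      simp only [sub_self, hc0, sub_zero, innerSL_apply_apply]
      have hO : (fun y => c (y - x) - inner ℝ (mollify ρ g x) (y - x))
          =O[𝓝 x] fun y => ‖y - x‖ ^ 2 := by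
        refine Asymptotics.IsBigO.of_bound C ?_
        filter_upwards [hnear] with y hy
        rw [Real.norm_eq_abs, Real.norm_of_nonneg (sq_nonneg _)]
        exact (hc _ hy).2
      refine hO.trans_isLittleO ?_
      exact Asymptotics.isLittleO_pow_sub_sub x one_lt_two
    refine ⟨fun y => θ x + c (y - x) / m, by simp [hc0], ?_, ?_⟩
    · have := (hcd.const_mul m⁻¹).const_add (θ x)
      simpa only [div_eq_inv_mul] using this
    · filter_upwards [hnear] with y hy
      refine hθ x y 0 (c (y - x)) ?_
      rw [zero_smul, add_zero]
      simpa using (hc _ hy).1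

section Phase

variable {E : Space n → Space n} {θ : Space n → ℝ} {X : ℝ → ℝ}

theorem IsPhase.periodic_comp (hθ : P.IsPhase E m δ θ) {Y : Type*} {X : ℝ → Y}
    (hX : Function.Periodic X 1) :
    Function.Periodic (fun x => X (θ x)) (P.L • axis n) := by
  intro x
  obtain ⟨j, hj⟩ := hθ.translate x
  have := hX.int_mul j (θ x)
  simp only [hj]
  simpa using this

theorem IsPhase.continuousAt_comp (hθ : P.IsPhase E m δ θ) (hX : Function.Periodic X 1)
    (hc : Continuous X) {x : Space n} (hx : Metric.closedBall x (2 * δ) ⊆ P.carrier) :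
    ContinuousAt (fun y => X (θ y)) x := by
  obtain ⟨τ, h0, h1, h2⟩ := hθ.lift x hx
  refine ContinuousAt.congr (f := fun y => X (τ y)) (hc.continuousAt.comp h1.continuousAt) ?_
  filter_upwards [h2] with y ⟨j, hj⟩
  have := hX.int_mul j (τ y)
  rw [hj]; simpa using this.symm

/-- The period 1 of X removes the integer ambiguity of θ, so X∘θ agrees with X∘τ for a branch τ near
x although θ itself may jump. -/
theorem IsPhase.hasFDerivAt_comp (hθ : P.IsPhase E m δ θ) (hX : Function.Periodic X 1)
    (hc : Differentiable ℝ X) {x : Space n} (hx : Metric.closedBall x (2 * δ) ⊆ P.carrier) :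
    HasFDerivAt (fun y => X (θ y)) ((deriv X (θ x) * m⁻¹) • innerSL ℝ (E x)) x := by
  obtain ⟨τ, h0, h1, h2⟩ := hθ.lift x hx
  have h3 : HasDerivAt X (deriv X (θ x)) (τ x) := h0 ▸ (hc (τ x)).hasDerivAt
  have h4 := h3.comp_hasFDerivAt x h1
  rw [smul_smul] at h4
  refine h4.congr_of_eventuallyEq ?_
  filter_upwards [h2] with y ⟨j, hj⟩
  have := hX.int_mul j (τ y)
  rw [hj]; simpa using this

end Phase

theorem IsDrive.continuous_mollify (hg : P.IsDrive g m) (hρ : IsMollifier ρ δ) :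
    Continuous (mollify ρ g) := by
  have hc : HasCompactSupport fun z => ρ (-z) :=
    hρ.hasCompactSupport.comp_homeomorph (Homeomorph.neg _)
  have h := hc.continuous_convolution_right (ContinuousLinearMap.lsmul ℝ ℝ).flip
    hg.locallyIntegrable (hρ.contDiff.continuous.comp continuous_neg)
  refine h.congr fun x => ?_
  rw [mollify_eq, convolution_def]
  simp

/-- Cauchy-Schwarz for the probability density ρ, then Fubini and translation invariance over a
period. -/
theorem IsDrive.lintegral_mollify_le (hg : P.IsDrive g m) (hρ : IsMollifier ρ δ) :
    ∫⁻ x, ‖mollify ρ g x‖ₑ ^ 2 ∂period n P.L ≤ 1 := by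
  have hgm : Measurable fun p : Space n × Space n => ‖g (p.1 + p.2)‖ₑ :=
    (hg.measurable.comp (measurable_fst.add measurable_snd)).enorm
  have hρm : Measurable fun h => ENNReal.ofReal (ρ h) := hρ.contDiff.continuous.measurable.ennreal_ofReal
  set μ : Measure (Space n) := volume.withDensity fun h => ENNReal.ofReal (ρ h)
  have hμ : μ univ = 1 := by
    rw [withDensity_apply _ MeasurableSet.univ, Measure.restrict_univ, hρ.lintegral_eq_one]
  have : IsProbabilityMeasure μ := ⟨hμ⟩
  have hpt : ∀ x, ‖mollify ρ g x‖ₑ ^ 2 ≤ ∫⁻ h, ‖g (x + h)‖ₑ ^ 2 ∂μ := by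
    intro x
    have hgx : Measurable fun h => ‖g (x + h)‖ₑ := (hg.measurable.comp (measurable_const_add x)).enorm
    have h1 : ‖mollify ρ g x‖ₑ ≤ ∫⁻ h, ‖g (x + h)‖ₑ ∂μ := by
      rw [lintegral_withDensity_eq_lintegral_mul _ hρm hgx]
      refine (enorm_integral_le_lintegral_enorm _).trans_eq (lintegral_congr fun h => ?_)
      rw [enorm_smul, Pi.mul_apply, Real.enorm_of_nonneg (hρ.nonneg h)]
    refine (pow_le_pow_left' h1 2).trans ?_
    have := sq_lintegral_mul_le μ hgx.aemeasurable (aemeasurable_const (b := (1 : ENNReal)))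
    simpa [hμ] using this
  calc _ ≤ ∫⁻ x, (∫⁻ h, ‖g (x + h)‖ₑ ^ 2 ∂μ) ∂period n P.L := lintegral_mono hpt
    _ = ∫⁻ h, (∫⁻ x, ‖g (x + h)‖ₑ ^ 2 ∂period n P.L) ∂μ :=
        lintegral_lintegral_swap (hgm.pow_const 2).aemeasurable
    _ = ∫⁻ _h, (∫⁻ x, ‖g x‖ₑ ^ 2 ∂period n P.L) ∂μ := by
        congr 1; funext h
        exact lintegral_period_add P.L_pos (F := fun x => ‖g x‖ₑ ^ 2)
          (fun x => by simp only [hg.periodic x]) h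
    _ ≤ ∫⁻ _h, 1 ∂μ := lintegral_mono fun _ => hg.norm_le
    _ = 1 := by simp

/-- Small translates of a test field are test fields. -/
theorem testFields_translate {φ : Space n → Space n} (hφ : φ ∈ P.testFields)
    (hδ : ∀ x ∈ tsupport φ, Metric.closedBall x (2 * δ) ⊆ P.carrier) {h : Space n}
    (hh : ‖h‖ ≤ 2 * δ) : (fun x => φ (x + h)) ∈ P.testFields := by
  refine ⟨hφ.1.comp (contDiff_id.add contDiff_const), fun x => ?_, ?_, fun x => ?_⟩
  · simp only [add_right_comm x, hφ.2.1 (x + h)]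
  · have : tsupport (fun z => φ (z + h)) = (Homeomorph.addRight h) ⁻¹' tsupport φ :=
      (tsupport_comp_eq_preimage φ (Homeomorph.addRight h))
    rw [this]
    intro x hx
    refine hδ _ hx ?_
    simpa [Metric.mem_closedBall, dist_eq_norm] using hh
  · rw [divergence_comp_add_right, hφ.2.2.2]

/-- Shifting g by h amounts to shifting φ by −h. For |h| ≤ δ the shifted field is a test field of
the same flux, so the drive has the same product with it, and averaging over h changes nothing. -/
theorem IsDrive.integral_inner_mollify (hg : P.IsDrive g m) (hρ : IsMollifier ρ δ)
    {φ : Space n → Space n} (hφ : φ ∈ P.testFields)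
    (hδ : ∀ x ∈ tsupport φ, Metric.closedBall x (2 * δ) ⊆ P.carrier)
    (hf : ∫⁻ x, ‖φ x‖ₑ ^ 2 ∂period n P.L ≠ ⊤) :
    ∫ x, inner ℝ (mollify ρ g x) (φ x) ∂period n P.L
      = ∫ x, inner ℝ (g x) (φ x) ∂period n P.L := by
  have hL := P.L_pos
  have hρc := hρ.contDiff.continuous
  have hφm : Measurable φ := hφ.1.continuous.measurable
  have hρm : Measurable fun h => ENNReal.ofReal (ρ h) := hρc.measurable.ennreal_ofReal
  have hgm : Measurable fun p : Space n × Space n => g (p.1 + p.2) :=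
    hg.measurable.comp (measurable_fst.add measurable_snd)
  have h1 : ∀ x, inner ℝ (mollify ρ g x) (φ x) = ∫ h, ρ h * inner ℝ (g (x + h)) (φ x) := by
    intro x
    have hint : Integrable fun z => ρ (z - x) • g z :=
      hg.locallyIntegrable.integrable_smul_left_of_hasCompactSupport (hρc.comp (by fun_prop))
        (hρ.hasCompactSupport.comp_homeomorph (Homeomorph.subRight x))
    have hint' : Integrable fun h => ρ h • g (x + h) := by
      have := hint.comp_add_left x
      simpa using this
    rw [mollify, real_inner_comm, ← integral_inner hint']
    simp only [real_inner_smul_right, real_inner_comm]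
  have hF : Measurable (Function.uncurry fun x h : Space n => ρ h * inner ℝ (g (x + h)) (φ x)) :=
    (hρc.measurable.comp measurable_snd).mul (hgm.inner (hφm.comp measurable_fst))
  have hprod : Integrable (Function.uncurry fun x h : Space n => ρ h * inner ℝ (g (x + h)) (φ x))
      ((period n P.L).prod volume) := by
    refine ⟨hF.aestronglyMeasurable, ?_⟩
    rw [HasFiniteIntegral, lintegral_prod_symm' _ hF.enorm]
    have hb : ∀ h, ∫⁻ x, ‖ρ h * inner ℝ (g (x + h)) (φ x)‖ₑ ∂period n P.L
        ≤ ENNReal.ofReal (ρ h) * (1 + ∫⁻ x, ‖φ x‖ₑ ^ 2 ∂period n P.L) := by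
      intro h
      have e : ∀ x, ‖ρ h * inner ℝ (g (x + h)) (φ x)‖ₑ
          = ENNReal.ofReal (ρ h) * ‖(inner ℝ (g (x + h)) (φ x) : ℝ)‖ₑ := fun x => by
        rw [enorm_mul, Real.enorm_of_nonneg (hρ.nonneg h)]
      simp only [e]
      rw [lintegral_const_mul' _ _ ENNReal.ofReal_ne_top]
      refine mul_le_mul_right ?_ _
      calc _ ≤ ∫⁻ x, (‖g (x + h)‖ₑ ^ 2 + ‖φ x‖ₑ ^ 2) ∂period n P.L :=
            lintegral_mono fun x => (enorm_inner_le _ _).trans (ENNReal_mul_le_add_sq _ _)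
        _ = (∫⁻ x, ‖g (x + h)‖ₑ ^ 2 ∂period n P.L) + _ := lintegral_add_right _
            (hφm.enorm.pow_const 2)
        _ ≤ _ := by
            gcongr
            rw [lintegral_period_add hL (F := fun x => ‖g x‖ₑ ^ 2)
              (fun x => by simp only [hg.periodic x]) h]
            exact hg.norm_le
    simp only [Function.uncurry_apply_pair]
    refine (lintegral_mono hb).trans_lt ?_
    rw [lintegral_mul_const _ hρm, hρ.lintegral_eq_one, one_mul]
    exact ENNReal.add_lt_top.2 ⟨ENNReal.one_lt_top, hf.lt_top⟩
  have h2 : ∀ h, ∫ x, ρ h * inner ℝ (g (x + h)) (φ x) ∂period n P.L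
      = ρ h * ∫ x, inner ℝ (g x) (φ x) ∂period n P.L := by
    intro h
    rw [integral_const_mul]
    by_cases hh : ‖h‖ ≤ δ
    · congr 1
      have hδ0 : 0 ≤ δ := (norm_nonneg h).trans hh
      have ht := testFields_translate hφ hδ (h := -h) (by rw [norm_neg]; linarith)
      have e1 := integral_period_add hL (F := fun x => (inner ℝ (g x) (φ (x + -h)) : ℝ))
        (fun x => by
          have := ht.2.1 x
          simp only [hg.periodic x] at this ⊢
          rw [this]) h
      simp only [add_neg_cancel_right] at e1
      have e2 := integral_period_add hL (F := fun x => φ x (Fin.last n))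
        (fun x => by simp only [hφ.2.1 x]) (-h)
      rw [e1, hg.flux _ ht, hg.flux _ hφ, e2]
    · rw [hρ.eq_zero (not_le.1 hh), zero_mul, zero_mul]
  simp only [h1]
  rw [integral_integral_swap hprod]
  simp only [h2]
  rw [integral_mul_const, hρ.integral_eq_one, one_mul]

end Pipe

/-! ### Periodic bumps -/

section Bumps

theorem periodic_integral_of_mean_zero {f : ℝ → ℝ} (hf : Continuous f) (hp : Function.Periodic f 1)
    (h0 : ∫ t in (0 : ℝ)..1, f t = 0) : Function.Periodic (fun t => ∫ s in (0 : ℝ)..t, f s) 1 := by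
  intro t
  have h1 := hp.intervalIntegral_add_eq t 0
  rw [zero_add, h0] at h1
  have h2 := intervalIntegral.integral_add_adjacent_intervals (μ := volume)
    (hf.intervalIntegrable 0 t) (hf.intervalIntegrable t (t + 1))
  simp only
  rw [← h2, h1, add_zero]

theorem integral_contDiff_one {f : ℝ → ℝ} (hf : Continuous f) :
    ContDiff ℝ 1 (fun t => ∫ s in (0 : ℝ)..t, f s) ∧
      deriv (fun t => ∫ s in (0 : ℝ)..t, f s) = f := by
  have hd : deriv (fun t => ∫ s in (0 : ℝ)..t, f s) = f := funext fun t => hf.deriv_integral f 0 t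
  refine ⟨contDiff_one_iff_deriv.2 ⟨fun t => ?_, by rw [hd]; exact hf⟩, hd⟩
  exact (intervalIntegral.integral_hasDerivAt_right (hf.intervalIntegrable _ _)
    (hf.stronglyMeasurableAtFilter _ _) hf.continuousAt).differentiableAt

/-- Periodic bumps of width `1 / N` with disjoint supports. -/
theorem exists_periodic_bumps : ∃ κ c : ℝ, 0 < κ ∧ 0 < c ∧ ∀ N : ℕ, 0 < N →
    ∃ χ X : ℕ → ℝ → ℝ, (∀ j, Function.Periodic (χ j) 1 ∧ ContDiff ℝ 1 (χ j) ∧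
      (∀ t, χ j t ∈ Icc (0 : ℝ) 1) ∧ (∀ t, |deriv (χ j) t| ≤ c * N) ∧
      Function.Periodic (X j) 1 ∧ ContDiff ℝ 1 (X j) ∧ ∀ t, deriv (X j) t = χ j t - κ / N) ∧
      ∀ i < N, ∀ j < N, ∀ t, χ i t ≠ 0 → χ j t ≠ 0 → i = j := by
  let b : ContDiffBump (1 / 2 : ℝ) := ⟨1 / 8, 1 / 4, by norm_num, by norm_num⟩
  have hb : ContDiff ℝ 1 b := b.contDiff
  have hb0 : ∀ t : ℝ, t ∉ Ioo (0 : ℝ) 1 → b t = 0 := by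
    intro t ht
    refine b.zero_of_le_dist ?_
    change (1 / 4 : ℝ) ≤ _
    rw [Real.dist_eq]
    by_contra h
    rw [not_le, abs_lt] at h
    exact ht ⟨by linarith, by linarith⟩
  obtain ⟨c, hc⟩ := (hb.continuous_deriv (by simp)).bounded_above_of_compact_support
    b.hasCompactSupport.deriv
  have hc0 : 0 ≤ c := (norm_nonneg _).trans (hc 0)
  have hκ : 0 < ∫ t in (0 : ℝ)..1, b t := by
    refine intervalIntegral.integral_pos one_pos hb.continuous.continuousOn
      (fun _ _ => b.nonneg) ⟨1 / 2, by norm_num, ?_⟩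
    rw [b.one_of_mem_closedBall]
    · exact one_pos
    · simp [b.rIn_pos.le]
  -- κ is the integral of the profile b. The factor 2 counts the two terms of the local formula for
  -- the bump, and the added 1 makes the constant positive.
  refine ⟨∫ t in (0 : ℝ)..1, b t, 2 * (c + 1), hκ, by positivity, fun N hN => ?_⟩
  have hN' : (1 : ℝ) ≤ N := by exact_mod_cast hN
  have hN0 : (0 : ℝ) < N := by positivity
  let η : ℝ → ℝ := fun t => b (N * Int.fract t)
  have hηp : Function.Periodic η 1 := fun t => by simp [η]
  have hηk : ∀ (k : ℤ) (s : ℝ), s ∈ Ioo (k - 1 : ℝ) (k + 1) →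
      η s = b (N * (s - k)) + b (N * (s - (k - 1))) := by
    intro k s hs
    rcases le_or_gt (k : ℝ) s with h | h
    · have hf : Int.fract s = s - k := by
        rw [Int.fract, (Int.floor_eq_iff).2 ⟨h, hs.2⟩]
      have hz : b (N * (s - (k - 1))) = 0 := hb0 _ fun h' => by nlinarith [h'.2]
      simp only [η]
      rw [hf, hz, add_zero]
    · have hf : Int.fract s = s - (k - 1) := by
        have : ⌊s⌋ = k - 1 := (Int.floor_eq_iff).2 (by push_cast; exact ⟨hs.1.le, by linarith⟩)
        rw [Int.fract, this]; push_cast; ring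
      have hz : b (N * (s - k)) = 0 := hb0 _ fun h' => by nlinarith [h'.1]
      simp only [η]
      rw [hf, hz, zero_add]
  -- The fractional part jumps at the integers. Since b vanishes outside (0, 1), the sum of two
  -- neighbouring bumps is a smooth formula on both sides of the jump.
  have hloc : ∀ t : ℝ, η =ᶠ[𝓝 t] fun s => b (N * (s - ⌊t⌋)) + b (N * (s - (⌊t⌋ - 1))) := by
    intro t
    filter_upwards [Ioo_mem_nhds (show ((⌊t⌋ : ℝ) - 1) < t by linarith [Int.floor_le t])
      (Int.lt_floor_add_one t)] with s hs
    exact hηk _ s hs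
  have hηc : ContDiff ℝ 1 η := by
    refine contDiff_iff_contDiffAt.2 fun t => ContDiffAt.congr_of_eventuallyEq ?_ (hloc t)
    refine ContDiff.contDiffAt ((hb.comp ?_).add (hb.comp ?_)) <;> fun_prop
  have hηd : ∀ t, |deriv η t| ≤ 2 * (c + 1) * N := by
    intro t
    have hd : ∀ a : ℝ, HasDerivAt (fun s => b (N * (s - a))) (deriv b (N * (t - a)) * N) t := by
      intro a
      have h1 : HasDerivAt (fun s : ℝ => N * (s - a)) N t := by
        simpa using ((hasDerivAt_id t).sub_const a).const_mul (N : ℝ)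
      exact (hb.differentiable (by simp) _).hasDerivAt.comp t h1
    rw [(hloc t).deriv_eq, ((hd _).fun_add (hd _)).deriv, ← add_mul, abs_mul, abs_of_pos hN0]
    refine mul_le_mul_of_nonneg_right ?_ hN0.le
    refine (abs_add_le _ _).trans ?_
    have h1 := hc (N * (t - ⌊t⌋))
    have h2 := hc (N * (t - (⌊t⌋ - 1)))
    rw [Real.norm_eq_abs] at h1 h2
    linarith
  -- On the support of the j-th bump the integer part of Nt is j modulo N, so different j < N have
  -- disjoint supports.
  have hηs : ∀ (j : ℕ) (t : ℝ), η (t - j / N) ≠ 0 → ∃ k : ℤ, ⌊N * t⌋ = N * k + j := by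
    intro j t h
    have h1 : N * Int.fract (t - j / N) ∈ Ioo (0 : ℝ) 1 := by
      by_contra h'; exact h (hb0 _ h')
    refine ⟨⌊t - j / N⌋, Int.floor_eq_iff.2 ?_⟩
    have h2 : N * Int.fract (t - j / N) = N * t - j - N * ⌊t - j / N⌋ := by
      rw [Int.fract]; field_simp
    rw [h2] at h1
    push_cast
    exact ⟨by linarith [h1.1], by linarith [h1.2]⟩
  have hmean : ∫ t in (0 : ℝ)..1, η t = (∫ t in (0 : ℝ)..1, b t) / N := by
    have e1 : ∫ t in (0 : ℝ)..1, η t = ∫ t in (0 : ℝ)..1, b (N * t) := by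
      refine intervalIntegral.integral_congr_ae ?_
      have h1 : ∀ᵐ t : ℝ, t ≠ 1 := by simp [ae_iff]
      filter_upwards [h1] with t ht ht'
      rw [uIoc_of_le zero_le_one] at ht'
      simp only [η]
      rw [Int.fract_eq_self.2 ⟨ht'.1.le, lt_of_le_of_ne ht'.2 ht⟩]
    rw [e1, intervalIntegral.integral_comp_mul_left (fun t => b t) hN0.ne', mul_zero, mul_one,
      ← intervalIntegral.integral_add_adjacent_intervals (hb.continuous.intervalIntegrable 0 1)
        (hb.continuous.intervalIntegrable 1 N)]
    have e2 : ∫ t in (1 : ℝ)..N, b t = ∫ t in (1 : ℝ)..N, (0 : ℝ) := by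
      refine intervalIntegral.integral_congr fun t ht => hb0 t fun h => ?_
      rw [uIcc_of_le hN'] at ht
      exact absurd h.2 (not_lt.2 ht.1)
    rw [e2, intervalIntegral.integral_zero, add_zero, smul_eq_mul]
    exact (div_eq_inv_mul _ _).symm
  set κ := ∫ t in (0 : ℝ)..1, b t
  have hχc : ∀ j : ℕ, ContDiff ℝ 1 fun t => η (t - j / N) := fun j =>
    hηc.comp (contDiff_id.sub contDiff_const)
  have hχp : ∀ j : ℕ, Function.Periodic (fun t => η (t - j / N)) 1 := fun j t => by
    simp only
    rw [add_sub_right_comm, hηp]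
  have hYc : ∀ j : ℕ, Continuous fun t => η (t - j / N) - κ / N := fun j =>
    (hχc j).continuous.sub continuous_const
  have hYp : ∀ j : ℕ, Function.Periodic (fun t => η (t - j / N) - κ / N) 1 := fun j t => by
    simp only
    rw [add_sub_right_comm, hηp]
  have hY0 : ∀ j : ℕ, ∫ t in (0 : ℝ)..1, (η (t - j / N) - κ / N) = 0 := by
    intro j
    rw [intervalIntegral.integral_sub ((hχc j).continuous.intervalIntegrable _ _)
      (continuous_const.intervalIntegrable _ _), intervalIntegral.integral_comp_sub_right]
    have := hηp.intervalIntegral_add_eq (0 - j / N) 0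
    have e : (0 : ℝ) - j / N + 1 = 1 - j / N := by ring
    rw [e, zero_add] at this
    rw [this, hmean]
    simp
  refine ⟨fun j t => η (t - j / N), fun j t => ∫ s in (0 : ℝ)..t, (η (s - j / N) - κ / N),
    fun j => ⟨hχp j, hχc j, fun t => ⟨b.nonneg, b.le_one⟩, fun t => ?_,
      periodic_integral_of_mean_zero (hYc j) (hYp j) (hY0 j), (integral_contDiff_one (hYc j)).1,
      fun t => congrFun (integral_contDiff_one (hYc j)).2 t⟩, fun i hi j hj t h h' => ?_⟩
  · rw [deriv_comp_sub_const]; exact hηd _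
  · obtain ⟨k, hk⟩ := hηs i t h
    obtain ⟨l, hl⟩ := hηs j t h'
    rw [hk] at hl
    have h1 : ((N * k + i : ℤ)) % N = (N * l + j) % N := by rw [hl]
    rw [Int.mul_add_emod_self_left, Int.mul_add_emod_self_left,
      Int.emod_eq_of_lt (by positivity) (by exact_mod_cast hi),
      Int.emod_eq_of_lt (by positivity) (by exact_mod_cast hj)] at h1
    exact_mod_cast h1

end Bumps

theorem ENNReal_weighted_mul_le {R : ℝ} (hR : 0 < R) {E F : Type*} [NormedAddCommGroup E]
    [NormedAddCommGroup F] (x : E) (y : F) :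
    ‖x‖ₑ * ‖y‖ₑ ≤ ENNReal.ofReal R * ‖x‖ₑ ^ 2 + ENNReal.ofReal R⁻¹ * ‖y‖ₑ ^ 2 := by
  rw [← ofReal_norm, ← ofReal_norm, ← ENNReal.ofReal_mul (norm_nonneg _),
    ← ENNReal.ofReal_pow (norm_nonneg _), ← ENNReal.ofReal_pow (norm_nonneg _),
    ← ENNReal.ofReal_mul hR.le, ← ENNReal.ofReal_mul (by positivity),
    ← ENNReal.ofReal_add (by positivity) (by positivity)]
  refine ENNReal.ofReal_le_ofReal ?_
  have h : R * ‖x‖ ^ 2 + R⁻¹ * ‖y‖ ^ 2 - ‖x‖ * ‖y‖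
      = R⁻¹ * ((R * ‖x‖ - ‖y‖ / 2) ^ 2 + 3 / 4 * ‖y‖ ^ 2) := by field_simp; ring
  have : 0 ≤ R⁻¹ * ((R * ‖x‖ - ‖y‖ / 2) ^ 2 + 3 / 4 * ‖y‖ ^ 2) := by positivity
  linarith

/-! ### Small supports and the energy density -/

section Averages

theorem measurable_translate_sub {G : Type*} [NormedAddCommGroup G] {f : Space n → G} (hc : Continuous f) :
    Measurable fun p : Space n × Space n => ‖f (p.1 + p.2) - f p.1‖ₑ :=
  ((hc.comp (continuous_fst.add continuous_snd)).sub (hc.comp continuous_fst)).enorm.measurable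

variable {G : Type*} [NormedAddCommGroup G] [NormedSpace ℝ G] {L r : ℝ}

theorem lintegral_box_enorm_translate_sub_le (hL : 0 < L) (hr : 0 ≤ r) {f : Space n → G}
    (hf : ContDiff ℝ 1 f) (hp : Function.Periodic f (L • axis n)) :
    ∫⁻ x, (∫⁻ h in box n r r, ‖f (x + h) - f x‖ₑ) ∂period n L
      ≤ volume (box n r r) *
        (ENNReal.ofReal ((n + 1) * r) * ∫⁻ x, ‖fderiv ℝ f x‖ₑ ∂period n L) := by
  rw [lintegral_lintegral_swap (measurable_translate_sub hf.continuous).aemeasurable]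
  calc _ ≤ ∫⁻ _h in box n r r, (ENNReal.ofReal ((n + 1) * r)
        * ∫⁻ x, ‖fderiv ℝ f x‖ₑ ∂period n L) := by
        refine setLIntegral_mono' (measurableSet_box r r) fun h hh => ?_
        refine (lintegral_translate_sub_le hL hf hp h).trans ?_
        refine mul_le_mul_left ?_ _
        rw [← ofReal_norm]
        exact ENNReal.ofReal_le_ofReal (norm_le_of_mem_box hr le_rfl le_rfl hh)
    _ = _ := by rw [setLIntegral_const, mul_comm]

theorem volume_box_ne_zero (hr : 0 < r) : volume (box n r r) ≠ 0 := by
  rw [volume_box hr.le]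
  exact (ENNReal.ofReal_pos.2 (by positivity)).ne'

theorem volume_box_ne_top (hr : 0 ≤ r) : volume (box n r r) ≠ ⊤ := by
  rw [volume_box hr]; exact ENNReal.ofReal_ne_top

/-- The Poincaré inequality for functions of small support. -/
theorem lintegral_le_of_small_support (hL : 0 < L) (hr : 0 < r) (hrL : r ≤ L) {f : Space n → G}
    (hf : ContDiff ℝ 1 f) (hp : Function.Periodic f (L • axis n))
    (hs : 2 * period n L (Function.support f) ≤ volume (box n r r)) :
    ∫⁻ x, ‖f x‖ₑ ∂period n L
      ≤ 2 * (ENNReal.ofReal ((n + 1) * r) * ∫⁻ x, ‖fderiv ℝ f x‖ₑ ∂period n L) := by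
  set v := volume (box n r r) with hv
  have hv0 : v ≠ 0 := volume_box_ne_zero hr
  have hvt : v ≠ ⊤ := volume_box_ne_top hr.le
  have hm : Measurable fun p : Space n × Space n => ‖f (p.1 + p.2) - f p.1‖ₑ :=
    measurable_translate_sub hf.continuous
  have hmx : ∀ x, Measurable fun h => ‖f (x + h) - f x‖ₑ := fun x =>
    hm.comp measurable_prodMk_left
  have hS : MeasurableSet (Function.support f) := hf.continuous.isOpen_support.measurableSet
  -- The support fills at most half of a box, so f(x + h) = 0 for at least half of the h, and the
  -- other half is absorbed on the left.
  have hpt : ∀ x, ‖f x‖ₑ * v ≤ 2 * ∫⁻ h in box n r r, ‖f (x + h) - f x‖ₑ := by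
    intro x
    have h1 : ‖f x‖ₑ * v ≤ (∫⁻ h in box n r r, ‖f (x + h) - f x‖ₑ)
        + ‖f x‖ₑ * ∫⁻ h in box n r r, (Function.support f).indicator 1 (x + h) := by
      rw [hv, ← setLIntegral_const, ← lintegral_const_mul' _ _ enorm_ne_top,
        ← lintegral_add_left (hmx x)]
      refine lintegral_mono fun h => ?_
      by_cases hx : f (x + h) = 0
      · simp [hx]
      · have : x + h ∈ Function.support f := hx
        simp [this]
    have h2 : ∫⁻ h in box n r r, (Function.support f).indicator 1 (x + h)
        ≤ period n L (Function.support f) := by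
      refine (lintegral_box_le hL hrL (F := (Function.support f).indicator 1) (fun y => ?_) x).trans ?_
      · by_cases hy : f y = 0
        · have h3 : y ∉ Function.support f := by simpa using hy
          have h4 : y + L • axis n ∉ Function.support f := by simpa [hp y] using hy
          rw [indicator_of_notMem h3, indicator_of_notMem h4]
        · have h3 : y ∈ Function.support f := hy
          have h4 : y + L • axis n ∈ Function.support f := by simpa [hp y] using hy
          rw [indicator_of_mem h3, indicator_of_mem h4]; rfl
      · rw [lintegral_indicator_one hS]
    have h3 : ‖f x‖ₑ * v + ‖f x‖ₑ * v
        ≤ 2 * (∫⁻ h in box n r r, ‖f (x + h) - f x‖ₑ) + ‖f x‖ₑ * v := by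
      calc _ = 2 * (‖f x‖ₑ * v) := (two_mul _).symm
        _ ≤ 2 * ((∫⁻ h in box n r r, ‖f (x + h) - f x‖ₑ)
            + ‖f x‖ₑ * period n L (Function.support f)) := by gcongr; exact h1.trans (by gcongr)
        _ = 2 * (∫⁻ h in box n r r, ‖f (x + h) - f x‖ₑ)
            + ‖f x‖ₑ * (2 * period n L (Function.support f)) := by ring
        _ ≤ _ := by gcongr
    exact (ENNReal.add_le_add_iff_right (ENNReal.mul_ne_top enorm_ne_top hvt)).1 h3
  have h4 : (∫⁻ x, ‖f x‖ₑ ∂period n L) * v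
      ≤ 2 * (ENNReal.ofReal ((n + 1) * r) * ∫⁻ x, ‖fderiv ℝ f x‖ₑ ∂period n L) * v := by
    rw [← lintegral_mul_const _ hf.continuous.enorm.measurable]
    refine (lintegral_mono hpt).trans ?_
    rw [lintegral_const_mul' _ _ (by simp)]
    calc _ ≤ 2 * (v * (ENNReal.ofReal ((n + 1) * r) * ∫⁻ x, ‖fderiv ℝ f x‖ₑ ∂period n L)) := by
          gcongr
          exact lintegral_box_enorm_translate_sub_le hL hr.le hf hp
      _ = _ := by ring
  exact (ENNReal.mul_le_mul_iff_left hv0 hvt).1 h4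

end Averages

/-- The energy density of a field `φ` and a drive `E`, including the mean oscillation of `φ` at the
scale `r`. -/
def density (E φ : Space n → Space n) (r : ℝ) (x : Space n) : ENNReal :=
  1 + ‖E x‖ₑ ^ 2 + ‖φ x‖ₑ ^ 2 + ‖fderiv ℝ φ x‖ₑ ^ 2
    + ENNReal.ofReal (r ^ n * r * ((n + 1) * r) ^ 2)⁻¹
      * ∫⁻ h in box n r r, ‖φ (x + h) - φ x‖ₑ ^ 2

section Density

variable {E φ : Space n → Space n} {r : ℝ}

theorem one_le_density (x : Space n) : 1 ≤ density E φ r x := by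
  simp only [density, add_assoc]; exact le_self_add

theorem sq_drive_le_density (x : Space n) : ‖E x‖ₑ ^ 2 ≤ density E φ r x := by
  simp only [density, add_assoc]
  exact le_add_left le_self_add

theorem fderiv_le_density (x : Space n) : ‖fderiv ℝ φ x‖ₑ ≤ density E φ r x := by
  refine (ENNReal_le_one_add_sq _).trans ?_
  calc _ ≤ (1 + ‖fderiv ℝ φ x‖ₑ ^ 2) + (‖E x‖ₑ ^ 2 + ‖φ x‖ₑ ^ 2
      + ENNReal.ofReal (r ^ n * r * ((n + 1) * r) ^ 2)⁻¹
      * ∫⁻ h in box n r r, ‖φ (x + h) - φ x‖ₑ ^ 2) := le_self_add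
    _ = _ := by rw [density]; ring

theorem mul_le_density (x : Space n) : ‖E x‖ₑ * ‖φ x‖ₑ ≤ density E φ r x := by
  refine (ENNReal_mul_le_add_sq _ _).trans ?_
  calc _ ≤ (‖E x‖ₑ ^ 2 + ‖φ x‖ₑ ^ 2) + (1 + ‖fderiv ℝ φ x‖ₑ ^ 2
      + ENNReal.ofReal (r ^ n * r * ((n + 1) * r) ^ 2)⁻¹
      * ∫⁻ h in box n r r, ‖φ (x + h) - φ x‖ₑ ^ 2) := le_self_add
    _ = _ := by rw [density]; ring

theorem oscillation_le_density (x : Space n) : ‖φ x‖ₑ ^ 2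
    + ENNReal.ofReal (r ^ n * r * ((n + 1) * r) ^ 2)⁻¹
      * ∫⁻ h in box n r r, ‖φ (x + h) - φ x‖ₑ ^ 2 ≤ density E φ r x := by
  calc _ ≤ (‖φ x‖ₑ ^ 2 + ENNReal.ofReal (r ^ n * r * ((n + 1) * r) ^ 2)⁻¹
      * ∫⁻ h in box n r r, ‖φ (x + h) - φ x‖ₑ ^ 2)
      + (1 + ‖E x‖ₑ ^ 2 + ‖fderiv ℝ φ x‖ₑ ^ 2) := le_self_add
    _ = _ := by rw [density]; ring

/-- The local mass of a field against a smaller field of small support. -/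
theorem lintegral_mul_le_density {L : ℝ} (hL : 0 < L) (hr : 0 < r) (hrL : r ≤ L) {a : ℝ}
    (ha : 0 ≤ a) (hφ : ContDiff ℝ 1 φ) (hp : Function.Periodic φ (L • axis n))
    (hφa : ∫⁻ x, ‖φ x‖ₑ ^ 2 ∂period n L ≤ ENNReal.ofReal (a ^ 2))
    {f : Space n → Space n} (hf : Continuous f) (hle : ∀ x, ‖f x‖ₑ ≤ ‖φ x‖ₑ) {J : Set (Space n)}
    (hJ : MeasurableSet J) (hfJ : ∀ x ∉ J, f x = 0) :
    (∫⁻ x, ‖f x‖ₑ * ‖φ x‖ₑ ∂period n L) * ENNReal.ofReal (r ^ n * r)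
      ≤ ENNReal.ofReal (√(r ^ n * r) * a) * (∫⁻ x, ‖f x‖ₑ ∂period n L)
        + ENNReal.ofReal (r ^ n * r * ((n + 1) * r)) * ∫⁻ x in J, density E φ r x ∂period n L := by
  set V := r ^ n * r with hV
  have hV0 : 0 < V := by positivity
  set R := (n + 1 : ℝ) * r with hR
  have hR0 : 0 < R := by positivity
  have hvol : volume (box n r r) = ENNReal.ofReal V := volume_box hr.le
  have hc := hφ.continuous
  have hm1 : ∀ x, Measurable fun h => ‖φ (x + h)‖ₑ := fun x =>
    (hc.comp (continuous_const.add continuous_id)).enorm.measurable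
  have hm2 : ∀ x, Measurable fun h => ‖φ (x + h) - φ x‖ₑ := fun x =>
    ((hc.comp (continuous_const.add continuous_id)).sub continuous_const).enorm.measurable
  have hmean : ∀ x, ∫⁻ h in box n r r, ‖φ (x + h)‖ₑ ≤ ENNReal.ofReal (√V * a) := by
    intro x
    have h1 := sq_lintegral_mul_le (volume.restrict (box n r r)) (f := fun _ => 1)
      aemeasurable_const (hm1 x).aemeasurable
    have h2 : ∫⁻ h in box n r r, ‖φ (x + h)‖ₑ ^ 2 ≤ ENNReal.ofReal (a ^ 2) :=
      (lintegral_box_le hL hrL (F := fun x => ‖φ x‖ₑ ^ 2)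
        (fun x => by simp only [hp x]) x).trans hφa
    simp only [one_mul, one_pow, setLIntegral_one, hvol] at h1
    have h3 := h1.trans (mul_le_mul_right h2 _)
    rw [← ENNReal.ofReal_mul hV0.le] at h3
    refine (ENNReal.pow_le_pow_left_iff two_ne_zero).1 (h3.trans_eq ?_)
    rw [← ENNReal.ofReal_pow (by positivity), mul_pow, Real.sq_sqrt hV0.le]
  -- The factor |φ(x)| is replaced by its box mean, bounded uniformly by the norm of φ, plus its
  -- oscillation. The weight R = (n + 1)r in the product inequality turns the oscillation term into
  -- VR times the density.
  have hpt : ∀ x, ‖f x‖ₑ * ‖φ x‖ₑ * ENNReal.ofReal V ≤ ENNReal.ofReal (√V * a) * ‖f x‖ₑ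
      + J.indicator (fun x => ENNReal.ofReal (V * R) * density E φ r x) x := by
    intro x
    by_cases hx : x ∈ J
    · rw [indicator_of_mem hx]
      have h1 : ‖φ x‖ₑ * ENNReal.ofReal V ≤ (∫⁻ h in box n r r, ‖φ (x + h)‖ₑ)
          + ∫⁻ h in box n r r, ‖φ (x + h) - φ x‖ₑ := by
        rw [← hvol, ← setLIntegral_const, ← lintegral_add_left (hm1 x)]
        refine lintegral_mono fun h => ?_
        calc ‖φ x‖ₑ = ‖φ (x + h) - (φ (x + h) - φ x)‖ₑ := by rw [sub_sub_cancel]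
          _ ≤ _ := enorm_sub_le
      have h2 : ‖f x‖ₑ * ∫⁻ h in box n r r, ‖φ (x + h) - φ x‖ₑ
          ≤ ENNReal.ofReal (V * R) * density E φ r x := by
        calc _ ≤ ‖φ x‖ₑ * ∫⁻ h in box n r r, ‖φ (x + h) - φ x‖ₑ := by gcongr; exact hle x
          _ = ∫⁻ h in box n r r, ‖φ x‖ₑ * ‖φ (x + h) - φ x‖ₑ :=
              (lintegral_const_mul' _ _ enorm_ne_top).symm
          _ ≤ ∫⁻ h in box n r r, (ENNReal.ofReal R * ‖φ x‖ₑ ^ 2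
              + ENNReal.ofReal R⁻¹ * ‖φ (x + h) - φ x‖ₑ ^ 2) :=
              lintegral_mono fun h => ENNReal_weighted_mul_le hR0 _ _
          _ = ENNReal.ofReal R * ‖φ x‖ₑ ^ 2 * ENNReal.ofReal V
              + ENNReal.ofReal R⁻¹ * ∫⁻ h in box n r r, ‖φ (x + h) - φ x‖ₑ ^ 2 := by
              rw [lintegral_add_left measurable_const, setLIntegral_const, hvol,
                lintegral_const_mul' _ _ ENNReal.ofReal_ne_top]
          _ = ENNReal.ofReal (V * R) * (‖φ x‖ₑ ^ 2 + ENNReal.ofReal (V * R ^ 2)⁻¹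
              * ∫⁻ h in box n r r, ‖φ (x + h) - φ x‖ₑ ^ 2) := by
              have e : ENNReal.ofReal R⁻¹
                  = ENNReal.ofReal (V * R) * ENNReal.ofReal (V * R ^ 2)⁻¹ := by
                rw [← ENNReal.ofReal_mul (by positivity)]
                congr 1; field_simp
              rw [e, ENNReal.ofReal_mul hV0.le]
              ring
          _ ≤ _ := by gcongr; exact oscillation_le_density x
      calc _ = ‖f x‖ₑ * (‖φ x‖ₑ * ENNReal.ofReal V) := mul_assoc _ _ _
        _ ≤ ‖f x‖ₑ * ((∫⁻ h in box n r r, ‖φ (x + h)‖ₑ)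
          + ∫⁻ h in box n r r, ‖φ (x + h) - φ x‖ₑ) := by gcongr
        _ = (∫⁻ h in box n r r, ‖φ (x + h)‖ₑ) * ‖f x‖ₑ
          + ‖f x‖ₑ * ∫⁻ h in box n r r, ‖φ (x + h) - φ x‖ₑ := by ring
        _ ≤ _ := by gcongr; exact hmean x
    · simp [hfJ x hx]
  have hfφ : Measurable fun x => ‖f x‖ₑ * ‖φ x‖ₑ := hf.enorm.measurable.mul hc.enorm.measurable
  rw [← lintegral_mul_const _ hfφ]
  refine (lintegral_mono hpt).trans_eq ?_
  rw [lintegral_add_left (hf.enorm.measurable.const_mul _), lintegral_indicator hJ,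
    lintegral_const_mul' _ _ ENNReal.ofReal_ne_top, lintegral_const_mul' _ _ ENNReal.ofReal_ne_top]

end Density

/-- Pigeonhole: N disjoint pieces share a total mass of at most A. -/
theorem exists_lintegral_le_of_disjoint {α : Type*} [MeasurableSpace α] {μ : Measure α} {N : ℕ}
    (hN : 0 < N) {J : ℕ → Set α} (hJ : ∀ j, MeasurableSet (J j))
    (hd : ∀ i < N, ∀ j < N, i ≠ j → Disjoint (J i) (J j)) {K : Set α} (hK : ∀ j, J j ⊆ K)
    (a : α → ENNReal) {A : ℝ} (hA : ∫⁻ x in K, a x ∂μ ≤ ENNReal.ofReal A) :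
    ∃ j, ∫⁻ x in J j, a x ∂μ ≤ ENNReal.ofReal (A / N) := by
  by_contra! h
  have h1 : ∑ j ∈ Finset.range N, ∫⁻ x in J j, a x ∂μ ≤ ENNReal.ofReal A := by
    rw [← lintegral_biUnion_finset (fun i hi j hj hij => hd i (by simpa using hi) j
      (by simpa using hj) hij) fun j _ => hJ j]
    exact (lintegral_mono_set (iUnion₂_subset fun j _ => hK j)).trans hA
  have h2 : ∑ _j ∈ Finset.range N, ENNReal.ofReal (A / N)
      < ∑ j ∈ Finset.range N, ∫⁻ x in J j, a x ∂μ :=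
    ENNReal.sum_lt_sum_of_nonempty (by simpa using hN.ne') fun j _ => h j
  have h3 : ∑ _j ∈ Finset.range N, ENNReal.ofReal (A / N) = ENNReal.ofReal A := by
    have hN0 : (0 : ℝ) < N := by exact_mod_cast hN
    rw [Finset.sum_const, Finset.card_range, nsmul_eq_mul, ← ENNReal.ofReal_natCast,
      ← ENNReal.ofReal_mul hN0.le]
    congr 1; field_simp
  exact (h2.trans_le h1).ne h3

/-! ### Modulation of a test field by the phase, and the case of a short period -/

namespace Pipe

variable {P : Pipe n} {E φ : Space n → Space n} {m : ℝ}

theorem integral_divergence_period {f : Space n → Space n} (hf : ContDiff ℝ 1 f)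
    (hp : Function.Periodic f (P.L • axis n)) (hs : tsupport f ⊆ P.carrier) :
    ∫ x, divergence f x ∂period n P.L = 0 := by
  have hd : ∀ i x, fderiv ℝ (fun x => f x i) x (basisVec n i) = fderiv ℝ f x (basisVec n i) i := by
    intro i x
    have h2 := (EuclideanSpace.proj (𝕜 := ℝ) i).hasFDerivAt.comp x
      (hf.differentiable (by simp) x).hasFDerivAt
    have h3 : fderiv ℝ (fun x => f x i) x = _ := h2.fderiv
    rw [h3]; rfl
  have hfi : ∀ i, ContDiff ℝ 1 fun x => f x i := fun i =>
    (EuclideanSpace.proj (𝕜 := ℝ) i).contDiff.comp hf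
  have hc : ∀ i, Continuous fun x => fderiv ℝ (fun x => f x i) x (basisVec n i) := fun i =>
    ((hfi i).continuous_fderiv (by simp)).clm_apply continuous_const
  have hi : ∀ i, Integrable (fun x => fderiv ℝ (fun x => f x i) x (basisVec n i))
      (period n P.L) := fun i =>
    P.integrable_period (fun x hx => by rw [hd, fderiv_eq_zero_of_notMem hs hx]; rfl)
      (P.integrable_of_continuous (hc i))
  simp only [divergence, ← hd]
  rw [integral_finsetSum _ fun i _ => hi i]
  refine Finset.sum_eq_zero fun i _ => integral_fderiv_period P.L_pos (hfi i)
    (fun x => by simp only [hp x]) _ ?_ (hi i)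
  exact P.integrable_period (fun x hx => by rw [test_eq_zero hs hx]; rfl)
    (P.integrable_of_continuous (hfi i).continuous)

section Modulate

variable {E φ : Space n → Space n} {m δ : ℝ} {θ : Space n → ℝ} {X : ℝ → ℝ}

theorem continuous_of_zero_off_tsupport {F : Type*} [NormedAddCommGroup F] {f : Space n → F}
    (h0 : ∀ x ∉ tsupport φ, f x = 0) (hc : ∀ x ∈ tsupport φ, ContinuousAt f x) : Continuous f := by
  refine continuous_iff_continuousAt.2 fun x => ?_
  by_cases hx : x ∈ tsupport φ
  · exact hc x hx
  · have : f =ᶠ[𝓝 x] fun _ => 0 := by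
      filter_upwards [(isClosed_tsupport φ).isOpen_compl.mem_nhds hx] with y hy
      exact h0 y hy
    exact continuousAt_const.congr (EventuallyEq.symm this)

/-- The phase has differentiable local branches only at points with a margin inside the pipe. All
points of the support of φ have one, and elsewhere the product vanishes locally. -/
theorem IsPhase.modulate (hθ : P.IsPhase E m δ θ) (hE : Continuous E) (hφ : φ ∈ P.testFields)
    (hδ : ∀ x ∈ tsupport φ, Metric.closedBall x (2 * δ) ⊆ P.carrier)
    (hX : Function.Periodic X 1) (hXc : ContDiff ℝ 1 X) :
    ContDiff ℝ 1 (fun x => X (θ x) • φ x) ∧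
      Function.Periodic (fun x => X (θ x) • φ x) (P.L • axis n) ∧
      tsupport (fun x => X (θ x) • φ x) ⊆ tsupport φ ∧
      ∀ x, fderiv ℝ (fun x => X (θ x) • φ x) x = X (θ x) • fderiv ℝ φ x
        + ((deriv X (θ x) * m⁻¹) • innerSL ℝ (E x)).smulRight (φ x) := by
  have hφd := hφ.1.differentiable (by simp)
  have hφc : Continuous (fderiv ℝ φ) := hφ.1.continuous_fderiv (by simp)
  have hX' : Function.Periodic (deriv X) 1 := fun t => by
    rw [← deriv_comp_add_const]; congr 1; exact funext hX
  have hX'c : Continuous (deriv X) := hXc.continuous_deriv (by simp)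
  have hd : ∀ x, HasFDerivAt (fun x => X (θ x) • φ x) (X (θ x) • fderiv ℝ φ x
      + ((deriv X (θ x) * m⁻¹) • innerSL ℝ (E x)).smulRight (φ x)) x := by
    intro x
    by_cases hx : x ∈ tsupport φ
    · exact (hθ.hasFDerivAt_comp hX (hXc.differentiable (by simp)) (hδ x hx)).smul
        (hφd x).hasFDerivAt
    · have h0 : φ x = 0 := image_eq_zero_of_notMem_tsupport hx
      have h1 : fderiv ℝ φ x = 0 :=
        image_eq_zero_of_notMem_tsupport fun h => hx (tsupport_fderiv_subset ℝ h)
      have h2 : (fun x => X (θ x) • φ x) =ᶠ[𝓝 x] fun _ => 0 := by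
        filter_upwards [(isClosed_tsupport φ).isOpen_compl.mem_nhds hx] with y hy
        rw [image_eq_zero_of_notMem_tsupport hy, smul_zero]
      rw [h0, h1]
      have h3 : HasFDerivAt (fun _ : Space n => (0 : Space n)) (0 : Space n →L[ℝ] Space n) x :=
        hasFDerivAt_const _ _
      have := h3.congr_of_eventuallyEq h2
      convert this using 1
      ext v; simp
  refine ⟨contDiff_one_iff_hasFDerivAt.2 ⟨_, ?_, hd⟩, fun x => ?_, ?_, fun x => (hd x).fderiv⟩
  · refine continuous_of_zero_off_tsupport (φ := φ) (fun x hx => ?_) fun x hx => ?_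
    · rw [image_eq_zero_of_notMem_tsupport hx, image_eq_zero_of_notMem_tsupport
        fun h => hx (tsupport_fderiv_subset ℝ h)]
      ext v; simp
    · have h1 := hθ.continuousAt_comp hX hXc.continuous (hδ x hx)
      have h2 := hθ.continuousAt_comp hX' hX'c (hδ x hx)
      refine (h1.smul hφc.continuousAt).add ?_
      have h3 : ContinuousAt (fun y => (deriv X (θ y) * m⁻¹) • innerSL ℝ (E y)) x :=
        (h2.mul continuousAt_const).smul ((innerSL ℝ).continuous.comp hE).continuousAt
      exact ((ContinuousLinearMap.smulRightL ℝ (Space n) (Space n)).continuous.continuousAt.comp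
        h3).clm_apply hφ.1.continuous.continuousAt
  · have := hθ.periodic_comp hX x
    simp only at this ⊢
    rw [this, hφ.2.1]
  · exact closure_mono (Function.support_smul_subset_right (fun x => X (θ x)) φ)

/-- Since div φ = 0, the divergence of X(θ)φ is m⁻¹X'(θ) E·φ, and a divergence has mean zero over a
period. -/
theorem IsPhase.integral_deriv_mul (hθ : P.IsPhase E m δ θ) (hm : m ≠ 0) (hE : Continuous E)
    (hφ : φ ∈ P.testFields) (hδ : ∀ x ∈ tsupport φ, Metric.closedBall x (2 * δ) ⊆ P.carrier)
    (hX : Function.Periodic X 1) (hXc : ContDiff ℝ 1 X) :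
    ∫ x, deriv X (θ x) * inner ℝ (E x) (φ x) ∂period n P.L = 0 := by
  obtain ⟨h1, h2, h3, h4⟩ := hθ.modulate hE hφ hδ hX hXc
  have h5 := integral_divergence_period h1 h2 (h3.trans hφ.2.2.1)
  have h6 : ∀ x, divergence (fun x => X (θ x) • φ x) x
      = m⁻¹ * (deriv X (θ x) * inner ℝ (E x) (φ x)) := by
    intro x
    have h7 := hφ.2.2.2 x
    rw [divergence] at h7 ⊢
    rw [h4]
    have h8 : inner ℝ (E x) (φ x) = ∑ i, E x i * φ x i := by
      rw [PiLp.inner_apply]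
      exact Finset.sum_congr rfl fun i _ => by simp [mul_comm]
    have h9 : ∀ i, inner ℝ (E x) (basisVec n i) = E x i := fun i => by
      rw [basisVec, EuclideanSpace.inner_single_right]; simp
    simp only [add_apply, smul_apply, PiLp.add_apply,
      PiLp.smul_apply, smul_eq_mul, ContinuousLinearMap.smulRight_apply, innerSL_apply_apply, h9,
      Finset.sum_add_distrib, ← Finset.mul_sum, h7, mul_zero, zero_add, h8]
    rw [Finset.mul_sum, Finset.mul_sum]
    exact Finset.sum_congr rfl fun i _ => by ring
  simp only [h6] at h5
  rw [integral_const_mul] at h5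
  exact (mul_eq_zero.1 h5).resolve_left (inv_ne_zero hm)

/-- Modulation by a function of the phase multiplies the product with the drive by the mean. -/
theorem IsPhase.integral_modulate (hθ : P.IsPhase E m δ θ) (hm : m ≠ 0) (hE : Continuous E)
    (hφ : φ ∈ P.testFields) (hδ : ∀ x ∈ tsupport φ, Metric.closedBall x (2 * δ) ⊆ P.carrier)
    {χ : ℝ → ℝ} (hχ : Function.Periodic χ 1) (hχc : ContDiff ℝ 1 χ)
    (hX : Function.Periodic X 1) (hXc : ContDiff ℝ 1 X) {κ : ℝ}
    (hd : ∀ t, deriv X t = χ t - κ) :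
    ∫ x, inner ℝ (E x) (χ (θ x) • φ x) ∂period n P.L
      = κ * ∫ x, inner ℝ (E x) (φ x) ∂period n P.L := by
  have h1 := hθ.integral_deriv_mul hm hE hφ hδ hX hXc
  obtain ⟨k1, k2, k3, k4⟩ := hθ.modulate hE hφ hδ hχ hχc
  have hi1 : Integrable (fun x => inner ℝ (E x) (χ (θ x) • φ x)) (period n P.L) :=
    P.integrable_period (fun x hx => by
      rw [test_eq_zero hφ.2.2.1 hx, smul_zero, inner_zero_right])
      (P.integrable_of_continuous (hE.inner k1.continuous))
  have hi2 : Integrable (fun x => inner ℝ (E x) (φ x)) (period n P.L) :=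
    P.integrable_period (fun x hx => by rw [test_eq_zero hφ.2.2.1 hx, inner_zero_right])
      (P.integrable_of_continuous (hE.inner hφ.1.continuous))
  have h2 : ∀ x, deriv X (θ x) * inner ℝ (E x) (φ x)
      = inner ℝ (E x) (χ (θ x) • φ x) - κ * inner ℝ (E x) (φ x) := fun x => by
    rw [hd, real_inner_smul_right]; ring
  simp only [h2] at h1
  rw [integral_sub hi1 (hi2.const_mul κ), integral_const_mul] at h1
  linarith

end Modulate

theorem period_carrier : period n P.L P.carrier = 1 := by
  have := measure_univ (μ := P.measure)
  rwa [measure_eq, Measure.restrict_apply_univ] at this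

/-- The cell and the drive contribute at most 1 each, φ contributes a₀², and a₁² comes once from the
gradient and once from the oscillation, whose normalization cancels the volume and the squared size
of the box. -/
theorem lintegral_density_le {r a₀ a₁ : ℝ} (hr : 0 < r) (hE : Continuous E)
    (hE1 : ∫⁻ x, ‖E x‖ₑ ^ 2 ∂period n P.L ≤ 1) (hφ : φ ∈ P.testFields)
    (h0 : ∫⁻ x, ‖φ x‖ₑ ^ 2 ∂period n P.L ≤ ENNReal.ofReal (a₀ ^ 2))
    (h1 : ∫⁻ x, ‖fderiv ℝ φ x‖ₑ ^ 2 ∂period n P.L ≤ ENNReal.ofReal (a₁ ^ 2)) :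
    ∫⁻ x in P.carrier, density E φ r x ∂period n P.L
      ≤ ENNReal.ofReal (2 + a₀ ^ 2 + 2 * a₁ ^ 2) := by
  have hφ1 : ContDiff ℝ 1 φ := hφ.1.of_le (by simp)
  set V := r ^ n * r with hV
  have hV0 : 0 < V := by positivity
  set R := (n + 1 : ℝ) * r with hR
  have hR0 : 0 < R := by positivity
  have hm1 : Measurable fun x => ‖E x‖ₑ ^ 2 := hE.enorm.measurable.pow_const 2
  have hm2 : Measurable fun x => ‖φ x‖ₑ ^ 2 := hφ1.continuous.enorm.measurable.pow_const 2
  have hm3 : Measurable fun x => ‖fderiv ℝ φ x‖ₑ ^ 2 :=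
    ((hφ1.continuous_fderiv (by simp)).enorm.measurable).pow_const 2
  have hosc : ENNReal.ofReal (V * R ^ 2)⁻¹
      * ∫⁻ x in P.carrier, (∫⁻ h in box n r r, ‖φ (x + h) - φ x‖ₑ ^ 2) ∂period n P.L
      ≤ ENNReal.ofReal (a₁ ^ 2) := by
    have h2 := lintegral_box_translate_sub_le P.L_pos hr.le (le_refl r) (le_refl r) hφ1 hφ.2.1
    rw [volume_box hr.le, ← hR, ← hV] at h2
    calc _ ≤ ENNReal.ofReal (V * R ^ 2)⁻¹ * (ENNReal.ofReal V * (ENNReal.ofReal R ^ 2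
          * ENNReal.ofReal (a₁ ^ 2))) := by
          refine mul_le_mul_right ((setLIntegral_le_lintegral _ _).trans (h2.trans ?_)) _
          gcongr
      _ = _ := by
          rw [← ENNReal.ofReal_pow hR0.le, ← ENNReal.ofReal_mul (by positivity),
            ← ENNReal.ofReal_mul (by positivity), ← ENNReal.ofReal_mul (by positivity)]
          congr 1; field_simp
  have hs1 : Measurable fun x => 1 + ‖E x‖ₑ ^ 2 := measurable_const.add hm1
  have hs2 : Measurable fun x => 1 + ‖E x‖ₑ ^ 2 + ‖φ x‖ₑ ^ 2 := hs1.add hm2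
  have hs3 : Measurable fun x => 1 + ‖E x‖ₑ ^ 2 + ‖φ x‖ₑ ^ 2 + ‖fderiv ℝ φ x‖ₑ ^ 2 := hs2.add hm3
  simp only [density]
  rw [lintegral_add_left hs3, lintegral_add_left hs2, lintegral_add_left hs1,
    lintegral_add_left measurable_const,
    lintegral_const_mul' _ _ ENNReal.ofReal_ne_top, setLIntegral_const, period_carrier, one_mul]
  calc _ ≤ 1 + 1 + ENNReal.ofReal (a₀ ^ 2) + ENNReal.ofReal (a₁ ^ 2) + ENNReal.ofReal (a₁ ^ 2) :=
        add_le_add (add_le_add (add_le_add (add_le_add le_rfl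
          ((setLIntegral_le_lintegral _ _).trans hE1)) ((setLIntegral_le_lintegral _ _).trans h0))
          ((setLIntegral_le_lintegral _ _).trans h1)) hosc
    _ = _ := by
        rw [← ENNReal.ofReal_one, ← ENNReal.ofReal_add (by positivity) (by positivity),
          ← ENNReal.ofReal_add (by positivity) (by positivity),
          ← ENNReal.ofReal_add (by positivity) (by positivity),
          ← ENNReal.ofReal_add (by positivity) (by positivity)]
        congr 1; ring

variable {g : Space n → Space n}

/-- By Cauchy-Schwarz, d² is at most the squared norm of φ. Off the columns this mass is at most
L²a₁². On the columns, averages over boxes of width r and height L bound it by the measure (L/m)² of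
the columns times 2a₀²/(rⁿL), up to a gradient term. The gradient terms are absorbed into d²/2. -/
theorem IsDrive.flux_le_of_short (hg : P.IsDrive g m) (hm : 0 < m) (hφ : φ ∈ P.testFields)
    {a₀ a₁ d r : ℝ} (hr : 0 < r) (hLr : P.L ≤ r) (hd : 0 < d)
    (h0 : ∫⁻ x, ‖φ x‖ₑ ^ 2 ∂period n P.L ≤ ENNReal.ofReal (a₀ ^ 2))
    (h1 : ∫⁻ x, ‖fderiv ℝ φ x‖ₑ ^ 2 ∂period n P.L ≤ ENNReal.ofReal (a₁ ^ 2))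
    (hgd : d ≤ ∫ x, inner ℝ (g x) (φ x) ∂period n P.L)
    (hr2 : a₁ ^ 2 * r ^ 2 * (1 + 2 * (n + 1) ^ 2) ≤ d ^ 2 / 2) :
    m ^ 2 ≤ 4 * r * a₀ ^ 2 / (r ^ n * d ^ 2) := by
  have hL := P.L_pos
  have hφ1 : ContDiff ℝ 1 φ := hφ.1.of_le (by simp)
  set V := r ^ n * P.L with hV
  have hV0 : 0 < V := by positivity
  have hA := (isClosed_columnSet φ).measurableSet
  have h2 : ENNReal.ofReal (d ^ 2) ≤ (∫⁻ x in columnSet φ, ‖φ x‖ₑ ^ 2 ∂period n P.L)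
      + ∫⁻ x in (columnSet φ)ᶜ, ‖φ x‖ₑ ^ 2 ∂period n P.L := by
    rw [lintegral_add_compl _ hA]
    refine le_trans ?_ (hg.enorm_inner_sq_le hφ1.continuous.measurable)
    rw [← ofReal_norm, ← ENNReal.ofReal_pow (norm_nonneg _)]
    exact ENNReal.ofReal_le_ofReal (pow_le_pow_left₀ hd.le (hgd.trans (le_abs_self _)) 2)
  have h3 := lintegral_mul_volume_box_le hL (le_refl P.L) hr.le (le_refl r) hLr hφ1 hφ.2.1
    (columnSet φ)
  rw [volume_box hr.le, ← hV] at h3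
  have h4 := lintegral_compl_columnSet_le hL hφ1 hφ.2.1
  have h5 := hg.volume_columnSet_le hm hφ
  have h6 : ENNReal.ofReal (d ^ 2 * V) ≤ ENNReal.ofReal (2 * ((P.L / m) ^ 2 * a₀ ^ 2
      + V * (((n + 1) * r) ^ 2 * a₁ ^ 2)) + P.L ^ 2 * a₁ ^ 2 * V) := by
    rw [ENNReal.ofReal_mul (by positivity)]
    calc _ ≤ ((∫⁻ x in columnSet φ, ‖φ x‖ₑ ^ 2 ∂period n P.L)
        + ∫⁻ x in (columnSet φ)ᶜ, ‖φ x‖ₑ ^ 2 ∂period n P.L) * ENNReal.ofReal V := by gcongr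
      _ = (∫⁻ x in columnSet φ, ‖φ x‖ₑ ^ 2 ∂period n P.L) * ENNReal.ofReal V
        + (∫⁻ x in (columnSet φ)ᶜ, ‖φ x‖ₑ ^ 2 ∂period n P.L) * ENNReal.ofReal V := add_mul _ _ _
      _ ≤ 2 * (ENNReal.ofReal ((P.L / m) ^ 2) * ENNReal.ofReal (a₀ ^ 2) + ENNReal.ofReal V *
          (ENNReal.ofReal ((n + 1) * r) ^ 2 * ENNReal.ofReal (a₁ ^ 2)))
          + ENNReal.ofReal P.L ^ 2 * ENNReal.ofReal (a₁ ^ 2) * ENNReal.ofReal V := by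
          refine add_le_add (h3.trans ?_) ?_
          · gcongr
          · gcongr
            refine h4.trans ?_
            gcongr
      _ = _ := by
          rw [show (2 : ENNReal) = ENNReal.ofReal 2 by simp, ← ENNReal.ofReal_pow hL.le,
            ← ENNReal.ofReal_pow (by positivity), ← ENNReal.ofReal_mul (by positivity),
            ← ENNReal.ofReal_mul (by positivity), ← ENNReal.ofReal_mul (by positivity),
            ← ENNReal.ofReal_mul (by positivity), ← ENNReal.ofReal_mul (by positivity),
            ← ENNReal.ofReal_add (by positivity) (by positivity),
            ← ENNReal.ofReal_mul (by positivity),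
            ← ENNReal.ofReal_add (by positivity) (by positivity)]
  rw [ENNReal.ofReal_le_ofReal_iff (by positivity)] at h6
  have h7 : P.L ^ 2 * a₁ ^ 2 ≤ r ^ 2 * a₁ ^ 2 := by gcongr
  have h8 : V * (d ^ 2 / 2) ≤ 2 * ((P.L / m) ^ 2 * a₀ ^ 2) := by
    have h9 : P.L ^ 2 * a₁ ^ 2 * V ≤ r ^ 2 * a₁ ^ 2 * V := by gcongr
    have h10 := mul_le_mul_of_nonneg_left hr2 hV0.le
    nlinarith
  have h9 : m ^ 2 * (r ^ n * d ^ 2) ≤ 4 * P.L * a₀ ^ 2 := by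
    rw [div_pow, div_mul_eq_mul_div, mul_div_assoc' 2, le_div_iff₀ (by positivity), hV] at h8
    have : P.L * (m ^ 2 * (r ^ n * d ^ 2)) ≤ P.L * (4 * P.L * a₀ ^ 2) := by nlinarith
    exact le_of_mul_le_mul_left this hL
  rw [le_div_iff₀ (by positivity)]
  refine h9.trans ?_
  gcongr

end Pipe

/-! ### The estimate of one modulated piece and the bound for the flux constant -/

namespace Pipe

variable {P : Pipe n} {E φ g : Space n → Space n} {m δ : ℝ} {θ : Space n → ℝ} {χ : ℝ → ℝ}

theorem IsPhase.measurableSet_bump (hθ : P.IsPhase E m δ θ)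
    (hδ : ∀ x ∈ tsupport φ, Metric.closedBall x (2 * δ) ⊆ P.carrier)
    (hχ : Function.Periodic χ 1) (hχc : Continuous χ) :
    MeasurableSet {x ∈ tsupport φ | χ (θ x) ≠ 0} := by
  have h1 : ContinuousOn (fun x => χ (θ x)) (tsupport φ) := fun x hx =>
    (hθ.continuousAt_comp hχ hχc (hδ x hx)).continuousWithinAt
  have h2 := h1.preimage_isClosed_of_isClosed (isClosed_tsupport φ) (isClosed_singleton (x := 0))
  have h3 : {x ∈ tsupport φ | χ (θ x) ≠ 0}
      = tsupport φ \ (tsupport φ ∩ (fun x => χ (θ x)) ⁻¹' {0}) := by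
    ext x
    simp
  rw [h3]
  exact (isClosed_tsupport φ).measurableSet.diff h2.measurableSet

theorem modulate_fderiv_le (hm : 0 < m) {b r : ℝ} (hb : 0 ≤ b)
    (hχ1 : ∀ t, χ t ∈ Icc (0 : ℝ) 1) (hχd : ∀ t, |deriv χ t| ≤ b)
    {F : Space n →L[ℝ] Space n} {x : Space n}
    (hF : F = χ (θ x) • fderiv ℝ φ x
      + ((deriv χ (θ x) * m⁻¹) • innerSL ℝ (E x)).smulRight (φ x)) :
    ‖F‖ₑ ≤ ({x ∈ tsupport φ | χ (θ x) ≠ 0}).indicator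
      (fun x => ENNReal.ofReal (1 + b / m) * density E φ r x) x := by
  by_cases hx : x ∈ {x ∈ tsupport φ | χ (θ x) ≠ 0}
  · rw [indicator_of_mem hx]
    have h1 : ‖F‖ ≤ ‖fderiv ℝ φ x‖ + b / m * (‖E x‖ * ‖φ x‖) := by
      rw [hF]
      refine (norm_add_le _ _).trans (add_le_add ?_ ?_)
      · rw [norm_smul, Real.norm_of_nonneg (hχ1 _).1]
        exact mul_le_of_le_one_left (norm_nonneg _) (hχ1 _).2
      · rw [ContinuousLinearMap.norm_smulRight_apply, norm_smul, innerSL_apply_norm, mul_assoc]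
        refine mul_le_mul_of_nonneg_right ?_ (by positivity)
        rw [norm_mul, norm_inv, Real.norm_of_nonneg hm.le, Real.norm_eq_abs, div_eq_mul_inv]
        exact mul_le_mul_of_nonneg_right (hχd _) (inv_nonneg.2 hm.le)
    have h2 : ‖F‖ₑ ≤ ‖fderiv ℝ φ x‖ₑ + ENNReal.ofReal (b / m) * (‖E x‖ₑ * ‖φ x‖ₑ) := by
      simp only [← ofReal_norm]
      rw [← ENNReal.ofReal_mul (norm_nonneg _), ← ENNReal.ofReal_mul (by positivity),
        ← ENNReal.ofReal_add (norm_nonneg _) (by positivity)]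
      exact ENNReal.ofReal_le_ofReal h1
    calc _ ≤ _ := h2
      _ ≤ density E φ r x + ENNReal.ofReal (b / m) * density E φ r x := by
          gcongr
          · exact fderiv_le_density x
          · exact mul_le_density x
      _ = _ := by
          rw [ENNReal.ofReal_add zero_le_one (by positivity), ENNReal.ofReal_one, add_mul, one_mul]
  · rw [indicator_of_notMem hx]
    have h0 : F = 0 := by
      rw [hF]
      by_cases hxs : x ∈ tsupport φ
      · have h1 : χ (θ x) = 0 := by by_contra h; exact hx ⟨hxs, h⟩
        -- A zero of the nonnegative χ is a minimum, so the gradient is also confined to the set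
        -- where χ(θ) ≠ 0.
        have h2 : deriv χ (θ x) = 0 :=
          IsLocalMin.deriv_eq_zero (Eventually.of_forall fun t => by rw [h1]; exact (hχ1 t).1)
        rw [h1, h2]
        ext v; simp
      · rw [image_eq_zero_of_notMem_tsupport hxs, image_eq_zero_of_notMem_tsupport
          fun h => hxs (tsupport_fderiv_subset ℝ h)]
        ext v; simp
    rw [h0, ← ofReal_norm, norm_zero, ENNReal.ofReal_zero]

/-- The estimate for one modulated field. -/
theorem IsPhase.modulation_estimate (hθ : P.IsPhase E m δ θ) (hm : 0 < m) (hE : Continuous E)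
    (hφ : φ ∈ P.testFields) (hδ : ∀ x ∈ tsupport φ, Metric.closedBall x (2 * δ) ⊆ P.carrier)
    {a₀ r s b α i : ℝ} (ha₀ : 0 ≤ a₀) (hr : 0 < r) (hrL : r ≤ P.L) (hs : 0 < s) (hsL : s ≤ P.L)
    (h0 : ∫⁻ x, ‖φ x‖ₑ ^ 2 ∂period n P.L ≤ ENNReal.ofReal (a₀ ^ 2))
    (hχ : Function.Periodic χ 1) (hχc : ContDiff ℝ 1 χ) (hχ1 : ∀ t, χ t ∈ Icc (0 : ℝ) 1)
    (hb : 0 ≤ b) (hχd : ∀ t, |deriv χ t| ≤ b) (hα : 0 ≤ α) (hαs : 2 * α ≤ s ^ n * s)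
    (hJα : ∫⁻ x in {x ∈ tsupport φ | χ (θ x) ≠ 0}, density E φ r x ∂period n P.L
      ≤ ENNReal.ofReal α)
    (hi0 : 0 ≤ i) (hi : i ≤ ∫ x, inner ℝ (E x) (χ (θ x) • φ x) ∂period n P.L) :
    i ^ 2 * (r ^ n * r) ≤ α ^ 2 * (√(r ^ n * r) * a₀ * (2 * ((n + 1) * s) * (1 + b / m))
      + r ^ n * r * ((n + 1) * r)) := by
  obtain ⟨k1, k2, k3, k4⟩ := hθ.modulate hE hφ hδ hχ hχc
  have hJ := hθ.measurableSet_bump hδ hχ hχc.continuous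
  set J := {x ∈ tsupport φ | χ (θ x) ≠ 0} with hJdef
  set f : Space n → Space n := fun x => χ (θ x) • φ x with hf
  have hφ1 : ContDiff ℝ 1 φ := hφ.1.of_le (by simp)
  have hfm : Measurable fun x => ‖f x‖ₑ := k1.continuous.enorm.measurable
  have hEm : Measurable fun x => ‖E x‖ₑ := hE.enorm.measurable
  have hfJ : ∀ x ∉ J, f x = 0 := by
    intro x hx
    by_cases hxs : x ∈ tsupport φ
    · have h1 : χ (θ x) = 0 := by by_contra h; exact hx ⟨hxs, h⟩
      simp [hf, h1]
    · simp [hf, image_eq_zero_of_notMem_tsupport hxs]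
  have hle : ∀ x, ‖f x‖ₑ ≤ ‖φ x‖ₑ := by
    intro x
    rw [enorm_le_iff_norm_le, norm_smul, Real.norm_of_nonneg (hχ1 _).1]
    exact mul_le_of_le_one_left (norm_nonneg _) (hχ1 _).2
  set W := ∫⁻ x, ‖f x‖ₑ * ‖φ x‖ₑ ∂period n P.L
  set M := ∫⁻ x, ‖f x‖ₑ ∂period n P.L
  have hW : W * ENNReal.ofReal (r ^ n * r) ≤ ENNReal.ofReal (√(r ^ n * r) * a₀) * M
      + ENNReal.ofReal (r ^ n * r * ((n + 1) * r)) * ENNReal.ofReal α :=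
    (lintegral_mul_le_density P.L_pos hr hrL ha₀ hφ1 hφ.2.1 h0 k1.continuous hle hJ hfJ).trans
      (by gcongr)
  -- The summand 1 of the density makes α a bound for the measure of the support as well.
  have hsupp : 2 * period n P.L (Function.support f) ≤ volume (box n s s) := by
    have h1 : period n P.L (Function.support f) ≤ ENNReal.ofReal α := by
      refine (measure_mono (t := J) fun x hx => ?_).trans (le_trans ?_ hJα)
      · by_contra h; exact hx (hfJ x h)
      · rw [← setLIntegral_one]
        exact lintegral_mono fun x => one_le_density x
    rw [volume_box hs.le]
    calc _ ≤ 2 * ENNReal.ofReal α := by gcongr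
      _ = ENNReal.ofReal (2 * α) := by rw [ENNReal.ofReal_mul two_pos.le]; simp
      _ ≤ _ := ENNReal.ofReal_le_ofReal hαs
  have hM : M ≤ ENNReal.ofReal (2 * ((n + 1) * s) * (1 + b / m)) * ENNReal.ofReal α := by
    have h1 : ∫⁻ x, ‖fderiv ℝ f x‖ₑ ∂period n P.L
        ≤ ENNReal.ofReal (1 + b / m) * ENNReal.ofReal α := by
      calc _ ≤ ∫⁻ x, J.indicator (fun x => ENNReal.ofReal (1 + b / m) * density E φ r x) x
            ∂period n P.L := lintegral_mono fun x => modulate_fderiv_le hm hb hχ1 hχd (k4 x)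
        _ = ENNReal.ofReal (1 + b / m) * ∫⁻ x in J, density E φ r x ∂period n P.L := by
            rw [lintegral_indicator hJ, lintegral_const_mul' _ _ ENNReal.ofReal_ne_top]
        _ ≤ _ := by gcongr
    calc M ≤ 2 * (ENNReal.ofReal ((n + 1) * s) * ∫⁻ x, ‖fderiv ℝ f x‖ₑ ∂period n P.L) :=
          lintegral_le_of_small_support P.L_pos hs hsL k1 k2 hsupp
      _ ≤ 2 * (ENNReal.ofReal ((n + 1) * s)
          * (ENNReal.ofReal (1 + b / m) * ENNReal.ofReal α)) := by gcongr
      _ = _ := by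
          rw [ENNReal.ofReal_mul (p := 2 * ((n + 1) * s)) (by positivity),
            ENNReal.ofReal_mul two_pos.le]
          simp only [ENNReal.ofReal_ofNat]
          ring
  -- Cauchy-Schwarz on the support of the piece: the drive contributes α. Writing |f|² ≤ |f||φ|
  -- leaves W, which is itself bounded by a small multiple of α.
  have hI : ENNReal.ofReal (i ^ 2) ≤ ENNReal.ofReal α * W := by
    calc ENNReal.ofReal (i ^ 2) ≤ ‖∫ x, inner ℝ (E x) (f x) ∂period n P.L‖ₑ ^ 2 := by
          rw [← ofReal_norm, ← ENNReal.ofReal_pow (norm_nonneg _)]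
          exact ENNReal.ofReal_le_ofReal (pow_le_pow_left₀ hi0 (hi.trans (le_abs_self _)) 2)
      _ ≤ (∫⁻ x in J, ‖E x‖ₑ * ‖f x‖ₑ ∂period n P.L) ^ 2 := by
          refine pow_le_pow_left' ((enorm_integral_le_lintegral_enorm _).trans ?_) 2
          rw [← lintegral_indicator hJ]
          refine lintegral_mono fun x => ?_
          by_cases hx : x ∈ J
          · rw [indicator_of_mem hx]; exact enorm_inner_le _ _
          · simp [hfJ x hx]
      _ ≤ (∫⁻ x in J, ‖E x‖ₑ ^ 2 ∂period n P.L) * ∫⁻ x in J, ‖f x‖ₑ ^ 2 ∂period n P.L :=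
          sq_lintegral_mul_le _ hEm.aemeasurable hfm.aemeasurable
      _ ≤ _ := by
          gcongr
          · exact (lintegral_mono fun x => sq_drive_le_density x).trans hJα
          · refine (setLIntegral_le_lintegral _ _).trans (lintegral_mono fun x => ?_)
            rw [sq]; gcongr; exact hle x
  have hfin : ENNReal.ofReal (i ^ 2 * (r ^ n * r)) ≤ ENNReal.ofReal (α ^ 2 * (√(r ^ n * r) * a₀
      * (2 * ((n + 1) * s) * (1 + b / m)) + r ^ n * r * ((n + 1) * r))) := by
    rw [ENNReal.ofReal_mul (by positivity)]
    calc _ ≤ ENNReal.ofReal α * W * ENNReal.ofReal (r ^ n * r) := by gcongr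
      _ = ENNReal.ofReal α * (W * ENNReal.ofReal (r ^ n * r)) := mul_assoc _ _ _
      _ ≤ ENNReal.ofReal α * (ENNReal.ofReal (√(r ^ n * r) * a₀)
          * (ENNReal.ofReal (2 * ((n + 1) * s) * (1 + b / m)) * ENNReal.ofReal α)
          + ENNReal.ofReal (r ^ n * r * ((n + 1) * r)) * ENNReal.ofReal α) := by
          gcongr
          exact hW.trans (by gcongr)
      _ = _ := by
          rw [ENNReal.ofReal_mul (p := α ^ 2) (by positivity),
            ENNReal.ofReal_add (by positivity) (by positivity),
            ENNReal.ofReal_mul (p := √(r ^ n * r) * a₀) (by positivity), ENNReal.ofReal_pow hα]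
          ring
  exact (ENNReal.ofReal_le_ofReal_iff (by positivity)).1 hfin

/-- The flux constant of a drive is bounded in terms of a test field on which the drive is large. -/
theorem exists_flux_bound (n : ℕ) {a₀ a₁ d : ℝ} (ha₀ : 0 ≤ a₀) (hd : 0 < d) :
    ∃ F : ℝ, ∀ (P : Pipe n) (φ g : Space n → Space n) (m : ℝ), 0 < m → P.IsDrive g m →
      φ ∈ P.testFields → ∫⁻ x, ‖φ x‖ₑ ^ 2 ∂period n P.L ≤ ENNReal.ofReal (a₀ ^ 2) →
      ∫⁻ x, ‖fderiv ℝ φ x‖ₑ ^ 2 ∂period n P.L ≤ ENNReal.ofReal (a₁ ^ 2) →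
      d ≤ ∫ x, inner ℝ (g x) (φ x) ∂period n P.L → m ≤ F := by
  obtain ⟨κ, c, hκ, hc, hbump⟩ := exists_periodic_bumps
  have hsmall : ∀ C ε : ℝ, 0 ≤ C → 0 < ε → ∃ r : ℝ, 0 < r ∧ r ≤ 1 ∧ C * r ≤ ε := by
    intro C ε hC hε
    refine ⟨min 1 (ε / (C + 1)), by positivity, min_le_left _ _, ?_⟩
    calc _ ≤ C * (ε / (C + 1)) := mul_le_mul_of_nonneg_left (min_le_right _ _) hC
      _ ≤ (C + 1) * (ε / (C + 1)) := by gcongr; linarith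
      _ = ε := by field_simp
  set A := 2 + a₀ ^ 2 + 2 * a₁ ^ 2 with hA
  have hA0 : 0 < A := by positivity
  -- Order of the choices: r₀ separates short from long periods, r makes the oscillation term small,
  -- s then makes the term of the box mean small, and N brings the support below half a box of side
  -- s. None of them depends on the pipe.
  obtain ⟨r₀, hr₀, hr₀1, hr₀C⟩ := hsmall (a₁ ^ 2 * (1 + 2 * (n + 1) ^ 2)) (d ^ 2 / 2)
    (by positivity) (by positivity)
  obtain ⟨r₁, hr₁, -, hr₁C⟩ := hsmall (A ^ 2 * (n + 1)) (κ ^ 2 * d ^ 2 / 4) (by positivity)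
    (by positivity)
  set r := min r₀ r₁
  have hr : 0 < r := lt_min hr₀ hr₁
  set V := r ^ n * r
  have hV : 0 < V := by positivity
  obtain ⟨s₁, hs₁, -, hs₁C⟩ := hsmall (A ^ 2 * (√V * a₀ * (2 * (n + 1) * 2)))
    (κ ^ 2 * d ^ 2 * V / 4) (by positivity) (by positivity)
  set s := min r₀ s₁
  have hs : 0 < s := lt_min hr₀ hs₁
  obtain ⟨N, hN⟩ := exists_nat_gt (2 * A / (s ^ n * s))
  have hN0 : (0 : ℝ) < N := lt_of_le_of_lt (by positivity) hN
  have hNs : 2 * (A / N) ≤ s ^ n * s := by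
    rw [div_lt_iff₀ (by positivity)] at hN
    rw [← mul_div_assoc, div_le_iff₀ hN0]
    linarith
  obtain ⟨χ, X, hχ, hdisj⟩ := hbump N (by exact_mod_cast hN0)
  -- The square root serves the periods L ≤ r₀. For longer ones m > cN is to be refuted, since then
  -- the bump derivatives, at most cN, contribute at most 1 after division by m.
  refine ⟨max (c * N) √(4 * r₀ * a₀ ^ 2 / (r₀ ^ n * d ^ 2)), fun P φ g m hm hg hφ h0 h1 hgd => ?_⟩
  rcases le_or_gt P.L r₀ with hL | hL
  · refine le_trans ?_ (le_max_right _ _)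
    refine Real.le_sqrt_of_sq_le (hg.flux_le_of_short hm hφ hr₀ hL hd h0 h1 hgd ?_)
    have h2 : a₁ ^ 2 * (1 + 2 * (n + 1) ^ 2) * (r₀ * r₀) ≤ a₁ ^ 2 * (1 + 2 * (n + 1) ^ 2) * r₀ := by
      refine mul_le_mul_of_nonneg_left ?_ (by positivity)
      exact mul_le_of_le_one_left hr₀.le hr₀1
    calc _ = a₁ ^ 2 * (1 + 2 * (n + 1) ^ 2) * (r₀ * r₀) := by ring
      _ ≤ _ := h2.trans hr₀C
  refine le_trans ?_ (le_max_left _ _)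
  by_contra! hcm
  obtain ⟨δ, hδ, hmargin⟩ := exists_margin hφ
  obtain ⟨ρ, hρ⟩ := exists_isMollifier (n := n) hδ
  obtain ⟨θ, hθ⟩ := hg.exists_isPhase hm.ne' hδ hρ
  have hE := hg.continuous_mollify hρ
  have hE1 := hg.lintegral_mollify_le hρ
  set E := mollify ρ g
  have hdens := lintegral_density_le hr hE hE1 hφ h0 h1
  obtain ⟨j, hj⟩ := exists_lintegral_le_of_disjoint (μ := period n P.L) (N := N)
    (J := fun j => {x ∈ tsupport φ | χ j (θ x) ≠ 0}) (by exact_mod_cast hN0)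
    (fun j => hθ.measurableSet_bump hmargin (hχ j).1 (hχ j).2.1.continuous)
    (fun i hi j hj hij => Set.disjoint_left.2 fun x hx hx' =>
      hij (hdisj i hi j hj _ hx.2 hx'.2))
    (K := P.carrier) (fun j x hx => hφ.2.2.1 hx.1) _ hdens
  obtain ⟨q1, q2, q3, q4, q5, q6, q7⟩ := hχ j
  have hI : κ / N * d ≤ ∫ x, inner ℝ (E x) (χ j (θ x) • φ x) ∂period n P.L := by
    rw [hθ.integral_modulate hm.ne' hE hφ hmargin q1 q2 q5 q6 q7,
      hg.integral_inner_mollify hρ hφ hmargin (h0.trans_lt ENNReal.ofReal_lt_top).ne]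
    exact mul_le_mul_of_nonneg_left hgd (by positivity)
  have key := hθ.modulation_estimate hm hE hφ hmargin ha₀ hr ((min_le_left _ _).trans hL.le) hs
    ((min_le_left _ _).trans hL.le) h0 q1 q2 q3 (by positivity) q4 (by positivity) hNs hj
    (by positivity) hI
  have hb : 1 + c * N / m ≤ 2 := by
    have : c * N / m ≤ 1 := (div_le_one hm).2 hcm.le
    linarith
  -- Both sides carry N⁻²: the product with the drive is κd/N and the energy of the piece is A/N.
  -- What remains is free of N, and the choices of r and s make each of the two terms on the right
  -- at most a quarter of the left.
  have key2 : κ ^ 2 * d ^ 2 * V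
      ≤ A ^ 2 * (√V * a₀ * (2 * ((n + 1) * s) * 2) + V * ((n + 1) * r)) := by
    have h2 : κ ^ 2 * d ^ 2 * V ≤ A ^ 2 * (√V * a₀ * (2 * ((n + 1) * s) * (1 + c * N / m))
        + V * ((n + 1) * r)) := by
      have h3 := mul_le_mul_of_nonneg_left key (sq_nonneg (N : ℝ))
      calc _ = (N : ℝ) ^ 2 * ((κ / N * d) ^ 2 * V) := by field_simp
        _ ≤ _ := h3
        _ = _ := by rw [← mul_assoc, div_pow, mul_div_cancel₀ _ (by positivity)]
    refine h2.trans ?_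
    gcongr
  have h4 : A ^ 2 * (√V * a₀ * (2 * (n + 1) * 2)) * s ≤ κ ^ 2 * d ^ 2 * V / 4 :=
    (mul_le_mul_of_nonneg_left (min_le_right _ _) (by positivity)).trans hs₁C
  have h5 : A ^ 2 * (n + 1) * r * V ≤ κ ^ 2 * d ^ 2 / 4 * V := by
    gcongr
    exact (mul_le_mul_of_nonneg_left (min_le_right _ _) (by positivity)).trans hr₁C
  have h6 : 0 < κ ^ 2 * d ^ 2 * V := by positivity
  nlinarith

end Pipe

/-! ### The field e as a drive, and the projected Stokes system -/

namespace Pipe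

variable {P : Pipe n}

/-- The representative of a point modulo the period in the slab `0 < z ≤ L`. -/
def fold (L : ℝ) (x : Space n) : Space n :=
  x - ((⌈x (Fin.last n) / L⌉ - 1 : ℤ) : ℝ) • (L • axis n)

theorem measurable_fold (L : ℝ) : Measurable (fold L : Space n → Space n) := by
  have h1 : Measurable fun x : Space n => ⌈x (Fin.last n) / L⌉ :=
    ((measurable_coord (Fin.last n)).div_const L).ceil
  have h2 : Measurable fun x : Space n => ((⌈x (Fin.last n) / L⌉ - 1 : ℤ) : ℝ) := by
    push_cast
    exact (measurable_from_top.comp h1).sub_const 1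
  exact measurable_id.sub (h2.smul_const _)

theorem periodic_fold {L : ℝ} (hL : 0 < L) :
    Function.Periodic (fold L : Space n → Space n) (L • axis n) := by
  intro x
  have h1 : (x + L • axis n) (Fin.last n) / L = x (Fin.last n) / L + 1 := by
    simp only [PiLp.add_apply, PiLp.smul_apply, axis_last, smul_eq_mul, mul_one]
    field_simp
  simp only [fold]
  rw [h1, Int.ceil_add_one, add_sub_cancel_right]
  push_cast
  rw [sub_smul, one_smul]
  abel

theorem fold_eq_self {L : ℝ} (hL : 0 < L) {x : Space n} (hx : x ∈ slab n 0 L) : fold L x = x := by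
  have h1 : ⌈x (Fin.last n) / L⌉ = 1 := by
    rw [Int.ceil_eq_iff]
    have := hx.2
    rw [zero_add] at this
    refine ⟨by simpa using div_pos hx.1 hL, by simpa using (div_le_one hL).2 this⟩
  simp [fold, h1]

theorem norm_e (h : P.projAxis ≠ 0) : ‖P.e‖ = 1 := by
  rw [Pipe.e, norm_smul, norm_inv, norm_norm, inv_mul_cancel₀ (norm_ne_zero_iff.2 h)]

theorem test_mem_H {φ : Space n → Space n} (hφ : φ ∈ P.testFields) {f : P.L2}
    (hf : f =ᵐ[P.measure] φ) : f ∈ P.H :=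
  Submodule.le_topologicalClosure _ (Submodule.subset_span ⟨φ, hφ, hf⟩)

theorem inner_e_test {φ : Space n → Space n} (hφ : φ ∈ P.testFields) {f : P.L2}
    (hf : f =ᵐ[P.measure] φ) :
    inner ℝ (P.e : P.L2) f = ‖P.projAxis‖⁻¹ * ∫ x, φ x (Fin.last n) ∂period n P.L := by
  have h1 : inner ℝ (P.projAxis : P.L2) f
      = inner ℝ ((memLp_const (axis n)).toLp (fun _ => axis n) : P.L2) f :=
    P.H.inner_orthogonalProjectionOnto_eq_of_mem_right ⟨f, test_mem_H hφ hf⟩ _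
  rw [Pipe.e, Submodule.coe_smul, real_inner_smul_left, h1, L2.inner_def,
    ← P.integral_measure fun x hx => by rw [test_eq_zero hφ.2.2.1 hx]; rfl]
  congr 1
  refine integral_congr_ae ?_
  filter_upwards [hf, (memLp_const (axis n)).coeFn_toLp (μ := P.measure) (p := 2)] with x h2 h3
  rw [h2, h3, inner_axis]

/-- The field `e`, extended periodically, is a drive. -/
theorem exists_isDrive (h : P.projAxis ≠ 0) : ∃ g, P.IsDrive g (P.L / ‖P.projAxis‖) ∧
    ∀ φ ∈ P.testFields, ∀ f : P.L2, f =ᵐ[P.measure] φ →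
      inner ℝ (P.e : P.L2) f = ∫ x, inner ℝ (g x) (φ x) ∂period n P.L := by
  have hL := P.L_pos
  -- `P.e` is only a class on the cell; a representative is read off after folding into one period
  -- and set to zero off the pipe.
  set g : Space n → Space n := P.carrier.indicator fun x => (P.e : P.L2) (fold P.L x) with hg
  have hg0 : ∀ x ∉ P.carrier, g x = 0 := fun x hx => indicator_of_notMem hx _
  have hge : (P.e : P.L2) =ᵐ[P.measure] g := by
    refine P.ae_measure_iff.2 ?_
    filter_upwards [ae_restrict_mem (measurableSet_slab 0 P.L)] with x hx hxc
    rw [hg, indicator_of_mem hxc, fold_eq_self hL hx]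
  have hmeas : Measurable g :=
    ((Lp.stronglyMeasurable (P.e : P.L2)).measurable.comp (measurable_fold P.L)).indicator
      P.isOpen.measurableSet
  have hin : ∀ φ ∈ P.testFields, ∀ f : P.L2, f =ᵐ[P.measure] φ →
      inner ℝ (P.e : P.L2) f = ∫ x, inner ℝ (g x) (φ x) ∂period n P.L := by
    intro φ hφ f hf
    rw [← P.integral_measure fun x hx => by rw [hg0 x hx, inner_zero_left], L2.inner_def]
    refine integral_congr_ae ?_
    filter_upwards [hf, hge] with x h1 h2
    rw [h1, h2]
  refine ⟨g, ⟨hmeas, fun x => ?_, ?_, fun ψ hψ => ?_⟩, hin⟩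
  · have hc : (x + P.L • axis n ∈ P.carrier) = (x ∈ P.carrier) := periodic_carrier x
    by_cases hx : x ∈ P.carrier
    · rw [hg, indicator_of_mem hx, indicator_of_mem (hc ▸ hx), periodic_fold hL]
    · rw [hg0 x hx, hg0 _ (hc ▸ hx)]
  · rw [← P.lintegral_measure fun x hx => by rw [hg0 x hx]; simp, ← enorm_sq_Lp hge]
    have : ‖(P.e : P.L2)‖ₑ = 1 := by
      rw [← ofReal_norm]
      have h1 : ‖(P.e : P.L2)‖ = 1 := norm_e h
      rw [h1, ENNReal.ofReal_one]
    rw [this, one_pow]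
  · have hf := (P.memLp_of_continuous hψ.1.continuous).coeFn_toLp
    rw [← hin ψ hψ _ hf, inner_e_test hψ hf]
    congr 1
    field_simp

theorem inner_pos_of_stokes_eq (hn : 1 ≤ n) (h : P.projAxis ≠ 0) {w : P.stokes.domain}
    (hw : P.stokes w = P.e) : 0 < inner ℝ (P.stokes w) (w : P.H) := by
  refine (stokes_inner_nonneg w).lt_of_ne fun h0 => ?_
  have h1 := stokes_injective hn h0.symm
  rw [h1, P.stokes.map_zero] at hw
  have h2 := norm_e h
  rw [← hw, norm_zero] at h2
  exact zero_ne_one h2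

/-- The flux constant is bounded in terms of the norms of `w`. -/
theorem exists_period_bound (n : ℕ) {c₀ c₁ : ℝ} (h0 : 0 ≤ c₀) (h1 : 0 < c₁) :
    ∃ F : ℝ, ∀ P : Pipe n, P.projAxis ≠ 0 → ∀ w : P.stokes.domain, P.stokes w = P.e →
      ‖(w : P.H)‖ = c₀ → inner ℝ (P.stokes w) (w : P.H) = c₁ ^ 2 →
      P.L / ‖P.projAxis‖ ≤ F := by
  -- A test field within min(1, c₁²/2) of (w, ∇w) enlarges the norms by at most 1 and keeps at least
  -- half of (e, w) = c₁².
  obtain ⟨F, hF⟩ := exists_flux_bound n (a₀ := c₀ + 1) (a₁ := c₁ + 1) (d := c₁ ^ 2 / 2)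
    (by positivity) (by positivity)
  refine ⟨F, fun P hP w hw hw0 hw1 => ?_⟩
  obtain ⟨G, hG, hGv⟩ := stokes_mem_graph w
  have hGn : ‖G‖ = c₁ := by
    have h2 : inner ℝ G G = inner ℝ (P.stokes w) (w : P.H) := hGv _ hG
    rw [hw1, real_inner_self_eq_norm_sq] at h2
    exact (sq_eq_sq₀ (norm_nonneg _) h1.le).1 h2
  obtain ⟨φ, hφ, f, hf1, hf2, hf⟩ := P.exists_test_near hG (ε := min 1 (c₁ ^ 2 / 2)) (by positivity)
  obtain ⟨g, hg, hgin⟩ := exists_isDrive hP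
  have hfd : ‖((w : P.H) : P.L2) - f.1‖ ≤ min 1 (c₁ ^ 2 / 2) :=
    (norm_fst_le ((((w : P.H) : P.L2), G) - f)).trans hf.le
  have hfd2 : ‖G - f.2‖ ≤ min 1 (c₁ ^ 2 / 2) :=
    (norm_snd_le ((((w : P.H) : P.L2), G) - f)).trans hf.le
  have hn1 : ‖f.1‖ ≤ c₀ + 1 := by
    have h2 : ‖f.1‖ ≤ ‖((w : P.H) : P.L2)‖ + ‖((w : P.H) : P.L2) - f.1‖ := by
      calc ‖f.1‖ = ‖((w : P.H) : P.L2) - (((w : P.H) : P.L2) - f.1)‖ := by rw [sub_sub_cancel]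
        _ ≤ _ := norm_sub_le _ _
    have h3 : ‖((w : P.H) : P.L2)‖ = c₀ := hw0
    linarith [min_le_left 1 (c₁ ^ 2 / 2)]
  have hn2 : ‖f.2‖ ≤ c₁ + 1 := by
    have h2 : ‖f.2‖ ≤ ‖G‖ + ‖G - f.2‖ := by
      calc ‖f.2‖ = ‖G - (G - f.2)‖ := by rw [sub_sub_cancel]
        _ ≤ _ := norm_sub_le _ _
    linarith [min_le_left 1 (c₁ ^ 2 / 2)]
  have hL := P.L_pos
  have hp : 0 < ‖P.projAxis‖ := norm_pos_iff.2 hP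
  refine hF P φ g _ (by positivity) hg hφ ?_ ?_ ?_
  · rw [← P.lintegral_measure fun x hx => by rw [test_eq_zero hφ.2.2.1 hx]; simp,
      ← enorm_sq_Lp hf1, ← ofReal_norm, ← ENNReal.ofReal_pow (norm_nonneg _)]
    exact ENNReal.ofReal_le_ofReal (pow_le_pow_left₀ (norm_nonneg _) hn1 2)
  · refine (lintegral_fderiv_le hφ).trans ?_
    rw [← enorm_sq_Lp hf2, ← ofReal_norm, ← ENNReal.ofReal_pow (norm_nonneg _)]
    exact ENNReal.ofReal_le_ofReal (pow_le_pow_left₀ (norm_nonneg _) hn2 2)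
  · rw [← hgin φ hφ _ hf1]
    have h2 : inner ℝ (P.e : P.L2) ((w : P.H) : P.L2) = c₁ ^ 2 := by
      rw [hw] at hw1; exact hw1
    have h3 : inner ℝ (P.e : P.L2) (((w : P.H) : P.L2) - f.1) ≤ c₁ ^ 2 / 2 := by
      refine (real_inner_le_norm _ _).trans ?_
      have h4 : ‖(P.e : P.L2)‖ = 1 := norm_e hP
      rw [h4, one_mul]
      exact hfd.trans (min_le_right _ _)
    rw [inner_sub_right, h2] at h3
    linarith

theorem stokes_eq_iff (hn : 1 ≤ n) {u v : P.stokes.domain} : P.stokes u = P.stokes v ↔ u = v := by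
  refine ⟨fun h => sub_eq_zero.1 (stokes_injective hn ?_), fun h => by rw [h]⟩
  rw [P.stokes.map_sub, h, sub_self, inner_zero_left]

theorem existsUnique_stokes_eq (hn : 1 ≤ n) (f : P.H) : ∃! w : P.stokes.domain, P.stokes w = f := by
  obtain ⟨S, -, hA⟩ := P.exists_stokes_inverse hn
  obtain ⟨u, -, hu⟩ := hA f
  exact ⟨u, hu, fun v hv => (stokes_eq_iff hn).1 (hv.trans hu.symm)⟩

/-- The resolvent system is uniquely solvable. -/
theorem resolvent_injective (hn : 1 ≤ n) {a : ℝ} {u v u' v' : P.stokes.domain}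
    (h1 : P.stokes u + a • (v : P.H) = P.stokes u' + a • (v' : P.H))
    (h2 : P.stokes v - a • (u : P.H) = P.stokes v' - a • (u' : P.H)) : u = u' ∧ v = v' := by
  have k1 : P.stokes (u - u') + a • ((v - v' : P.stokes.domain) : P.H) = 0 := by
    rw [P.stokes.map_sub, Submodule.coe_sub, smul_sub, ← sub_eq_zero.2 h1]; abel
  have k2 : P.stokes (v - v') - a • ((u - u' : P.stokes.domain) : P.H) = 0 := by
    rw [P.stokes.map_sub, Submodule.coe_sub, smul_sub, ← sub_eq_zero.2 h2]; abel
  have h3 := resolvent_graph_norm stokes_symm k1 k2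
  rw [norm_zero] at h3
  have e1 : ‖P.stokes (u - u')‖ = 0 := by
    nlinarith [sq_nonneg ‖P.stokes (u - u')‖, sq_nonneg ‖P.stokes (v - v')‖]
  have e2 : ‖P.stokes (v - v')‖ = 0 := by
    nlinarith [sq_nonneg ‖P.stokes (u - u')‖, sq_nonneg ‖P.stokes (v - v')‖]
  rw [norm_eq_zero, P.stokes.map_sub, sub_eq_zero] at e1 e2
  exact ⟨(stokes_eq_iff hn).1 e1, (stokes_eq_iff hn).1 e2⟩

theorem solvesSystem_iff {T ν : ℝ} (hν : 0 < ν) {k : ℕ} {p q : ℝ}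
    {uv : P.stokes.domain × P.stokes.domain} :
    P.SolvesSystem T ν k p q uv ↔
      ((2 * Real.pi * k / (T * ν)) • (uv.2 : P.H) + P.stokes uv.1
          - (inner ℝ (P.stokes uv.1) P.e : ℝ) • P.e
        = (2 * Real.pi * k / (T * ν) * (P.L / ‖P.projAxis‖ * q)) • P.e ∧
      -((2 * Real.pi * k / (T * ν)) • (uv.1 : P.H)) + P.stokes uv.2
          - (inner ℝ (P.stokes uv.2) P.e : ℝ) • P.e
        = -((2 * Real.pi * k / (T * ν) * (P.L / ‖P.projAxis‖ * p)) • P.e)) := by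
  have ha : 2 * Real.pi * k / T = ν * (2 * Real.pi * k / (T * ν)) := by field_simp
  rw [SolvesSystem, ha]
  set a := 2 * Real.pi * k / (T * ν)
  rw [← smul_right_inj (M := P.H) hν.ne' (m₁ := a • (uv.2 : P.H) + P.stokes uv.1
      - (inner ℝ (P.stokes uv.1) P.e : ℝ) • P.e),
    ← smul_right_inj (M := P.H) hν.ne' (m₁ := -(a • (uv.1 : P.H)) + P.stokes uv.2
      - (inner ℝ (P.stokes uv.2) P.e : ℝ) • P.e)]
  simp only [smul_sub, smul_add, smul_neg, smul_smul, mul_assoc]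

/-- Here division by zero gives e = 0, so sources and projections vanish and the plain resolvent
system is left. -/
theorem solvesSystem_iff_of_projAxis_eq_zero (hn : 1 ≤ n) (hP : P.projAxis = 0) {T ν : ℝ}
    (hν : 0 < ν) {k : ℕ} {p q : ℝ} {uv : P.stokes.domain × P.stokes.domain} :
    P.SolvesSystem T ν k p q uv ↔ uv = 0 := by
  have he : P.e = 0 := by rw [Pipe.e, hP, smul_zero]
  rw [solvesSystem_iff hν, he]
  simp only [smul_zero, sub_zero, neg_zero]
  refine ⟨fun ⟨h1, h2⟩ => ?_, fun h => by simp [h, P.stokes.map_zero]⟩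
  have h3 := resolvent_injective hn (P := P) (u := uv.1) (v := uv.2) (u' := 0) (v' := 0)
    (a := 2 * Real.pi * k / (T * ν)) ?_ ?_
  · exact Prod.ext h3.1 h3.2
  · rw [P.stokes.map_zero, Submodule.coe_zero, smul_zero, add_zero, ← h1]; abel
  · rw [P.stokes.map_zero, Submodule.coe_zero, smul_zero, sub_zero, ← h2]; abel

/-- For uniqueness, the difference of two solutions has zero fluxes, so the multiplier estimate
makes its multipliers zero, and the resolvent system is injective. -/
theorem existsUnique_solvesSystem (hn : 1 ≤ n) {T ν : ℝ} (hT : 0 < T) (hν : 0 < ν) {k : ℕ}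
    (hk : 1 ≤ k) (p q : ℝ) :
    ∃! uv : P.stokes.domain × P.stokes.domain, P.SolvesSystem T ν k p q uv := by
  rcases eq_or_ne P.projAxis 0 with hP | hP
  · exact ⟨0, (solvesSystem_iff_of_projAxis_eq_zero hn hP hν).2 rfl,
      fun uv h => (solvesSystem_iff_of_projAxis_eq_zero hn hP hν).1 h⟩
  have hsym := stokes_symm (P := P)
  have he := norm_e hP
  have hk0 : (0 : ℝ) < k := by exact_mod_cast hk
  have ha : 0 < 2 * Real.pi * k / (T * ν) := by positivity
  obtain ⟨w, hw, -⟩ := existsUnique_stokes_eq hn P.e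
  obtain ⟨S, hS, hA⟩ := P.exists_stokes_inverse hn
  obtain ⟨u, v, hb, s, t, h1, h2⟩ := exists_projected_solution hsym S hS hA he ha.ne'
    (P.L / ‖P.projAxis‖ * p) (P.L / ‖P.projAxis‖ * q)
  refine ⟨(u, v), (solvesSystem_iff hν).2 ((exists_multiplier he ha.ne').2 ⟨hb, s, t, h1, h2⟩),
    fun uv huv => ?_⟩
  obtain ⟨hb', s', t', k1, k2⟩ := (exists_multiplier he ha.ne').1 ((solvesSystem_iff hν).1 huv)
  have hc := inner_pos_of_stokes_eq hn hP hw
  have hz := multiplier_bound hsym hw le_rfl (by rw [← hw]) hc ha.le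
    (u := uv.1 - u) (v := uv.2 - v) (b := 0) (b' := 0) (s := s' - s) (t := t' - t)
    (by rw [Submodule.coe_sub, inner_sub_left, hb'.1, hb.1, sub_self])
    (by rw [Submodule.coe_sub, inner_sub_left, hb'.2, hb.2, sub_self])
    (by rw [P.stokes.map_sub, Submodule.coe_sub, smul_sub, sub_smul, ← k1, ← h1]; abel)
    (by rw [P.stokes.map_sub, Submodule.coe_sub, smul_sub, sub_smul, ← k2, ← h2]; abel)
  have hz' : (s' - s) ^ 2 + (t' - t) ^ 2 ≤ 0 := by
    have h3 : 0 < (inner ℝ (P.stokes w) (w : P.H) : ℝ) ^ 2 := by positivity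
    norm_num at hz
    by_contra! h4
    exact absurd hz (not_le.2 (mul_pos h3 h4))
  have hs : s' = s := sub_eq_zero.1 ((pow_eq_zero_iff two_ne_zero).1
    (le_antisymm (by linarith [sq_nonneg (t' - t)]) (sq_nonneg _)))
  have ht : t' = t := sub_eq_zero.1 ((pow_eq_zero_iff two_ne_zero).1
    (le_antisymm (by linarith [sq_nonneg (s' - s)]) (sq_nonneg _)))
  have := resolvent_injective hn (k1.trans (by rw [hs, h1])) (k2.trans (by rw [ht, h2]))
  exact Prod.ext this.1 this.2

theorem SolvesSystem.norm_sq_le {T ν : ℝ} (hT : 0 < T) (hν : 0 < ν) {k : ℕ} (hk : 1 ≤ k) {p q : ℝ}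
    {uv : P.stokes.domain × P.stokes.domain} (huv : P.SolvesSystem T ν k p q uv)
    (hP : P.projAxis ≠ 0) {w : P.stokes.domain} (hw : P.stokes w = P.e) {c F : ℝ} (hc : 0 < c)
    (hwc : inner ℝ (P.stokes w) (w : P.H) = c) (hF : P.L / ‖P.projAxis‖ ≤ F) :
    ‖P.stokes uv.1‖ ^ 2 + ‖P.stokes uv.2‖ ^ 2 ≤ 8 * (F ^ 2 + (‖(w : P.H)‖ ^ 2 / c) ^ 2) / c ^ 2
      * (1 + (2 * Real.pi * P.L / (T * ν * ‖P.projAxis‖)) ^ 2 * (k : ℝ) ^ 2)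
      * (p ^ 2 + q ^ 2) := by
  have hL := P.L_pos
  have hp : 0 < ‖P.projAxis‖ := norm_pos_iff.2 hP
  have he := norm_e hP
  have hsym := stokes_symm (P := P)
  have hk0 : (0 : ℝ) < k := by exact_mod_cast hk
  have ha : 0 < 2 * Real.pi * k / (T * ν) := by positivity
  obtain ⟨hb, s, t, h1, h2⟩ := (exists_multiplier he ha.ne').1 ((solvesSystem_iff hν).1 huv)
  have hst := multiplier_bound hsym hw le_rfl (by rw [← hw]; exact hwc) hc ha.le hb.1 hb.2 h1 h2
  have hg := resolvent_graph_norm hsym h1 h2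
  rw [norm_smul, norm_smul, he, mul_one, mul_one, Real.norm_eq_abs, Real.norm_eq_abs, sq_abs,
    sq_abs] at hg
  refine hg.trans ?_
  clear h1 h2 hb huv hg
  set a := 2 * Real.pi * k / (T * ν) with ha_def
  set m := P.L / ‖P.projAxis‖ with hm_def
  have hm0 : 0 < m := by positivity
  have hM : (2 * Real.pi * P.L / (T * ν * ‖P.projAxis‖)) ^ 2 * (k : ℝ) ^ 2 = (a * m) ^ 2 := by
    rw [ha_def, hm_def]; field_simp
  rw [hM]
  set K := ‖(w : P.H)‖ ^ 2 / c
  -- m(1 + Ka) = m + K(am): the bound m ≤ F is needed only for the first summand.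
  have h3 : (m * (1 + K * a)) ^ 2 ≤ 2 * (F ^ 2 + K ^ 2) * (1 + (a * m) ^ 2) := by
    have h4 : m ^ 2 ≤ F ^ 2 := pow_le_pow_left₀ hm0.le hF 2
    have h5 : 0 ≤ F ^ 2 * (a * m) ^ 2 := by positivity
    nlinarith [sq_nonneg (m - K * (a * m)), sq_nonneg K]
  have h4 : c ^ 2 * (s ^ 2 + t ^ 2) ≤
      8 * (F ^ 2 + K ^ 2) * (1 + (a * m) ^ 2) * (p ^ 2 + q ^ 2) := by
    calc _ ≤ _ := hst
      _ = 4 * (p ^ 2 + q ^ 2) * (m * (1 + K * a)) ^ 2 := by ring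
      _ ≤ 4 * (p ^ 2 + q ^ 2) * (2 * (F ^ 2 + K ^ 2) * (1 + (a * m) ^ 2)) := by gcongr
      _ = _ := by ring
  rw [div_mul_eq_mul_div, div_mul_eq_mul_div, le_div_iff₀ (by positivity)]
  linarith

end Pipe

end StokesPipe

end

theorem theorem3 (n : ℕ) (hn : 1 ≤ n) :
    ∃ C : ℝ → ℝ → ℝ, ∀ P : StokesPipe.Pipe n,
      (∀ T ν : ℝ, 0 < T → 0 < ν → ∀ k : ℕ, 1 ≤ k → ∀ p q : ℝ,
        ∃! uv : P.stokes.domain × P.stokes.domain, P.SolvesSystem T ν k p q uv) ∧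
      (∃! w : P.stokes.domain, P.stokes w = P.e) ∧
      ∀ w : P.stokes.domain, P.stokes w = P.e →
        ∀ C₀ C₁ : ℝ, C₀ = ‖(w : P.H)‖ → C₁ = √(inner ℝ (P.stokes w) (w : P.H)) →
          ∀ T ν : ℝ, 0 < T → 0 < ν → ∀ k : ℕ, 1 ≤ k → ∀ p q : ℝ,
            ∀ uv : P.stokes.domain × P.stokes.domain, P.SolvesSystem T ν k p q uv →
              ‖P.stokes uv.1‖ ^ 2 + ‖P.stokes uv.2‖ ^ 2 ≤
                C C₀ C₁ * (1 + (2 * Real.pi * P.L / (T * ν * ‖P.projAxis‖)) ^ 2 * (k : ℝ) ^ 2)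
                  * (p ^ 2 + q ^ 2) := by
  -- F is chosen as a function of c₀ and c₁ before any pipe is given, so the final constant depends
  -- on nothing else in fixed dimension. For other signs of c₀, c₁ the value 0 is a dummy.
  have hbound : ∀ c₀ c₁ : ℝ, ∃ F : ℝ, 0 ≤ c₀ → 0 < c₁ → ∀ P : StokesPipe.Pipe n,
      P.projAxis ≠ 0 → ∀ w : P.stokes.domain, P.stokes w = P.e → ‖(w : P.H)‖ = c₀ →
      inner ℝ (P.stokes w) (w : P.H) = c₁ ^ 2 → P.L / ‖P.projAxis‖ ≤ F := by
    intro c₀ c₁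
    by_cases h : 0 ≤ c₀ ∧ 0 < c₁
    · obtain ⟨F, hF⟩ := StokesPipe.Pipe.exists_period_bound n h.1 h.2
      exact ⟨F, fun _ _ => hF⟩
    · exact ⟨0, fun h0 h1 => absurd ⟨h0, h1⟩ h⟩
  choose F hF using hbound
  refine ⟨fun c₀ c₁ => 8 * (F c₀ c₁ ^ 2 + (c₀ ^ 2 / c₁ ^ 2) ^ 2) / (c₁ ^ 2) ^ 2, fun P =>
    ⟨fun T ν hT hν k hk p q => StokesPipe.Pipe.existsUnique_solvesSystem hn hT hν hk p q,
      StokesPipe.Pipe.existsUnique_stokes_eq hn _, ?_⟩⟩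
  intro w hw C₀ C₁ hC₀ hC₁ T ν hT hν k hk p q uv huv
  -- If ℙe_z = 0 the solution is zero and only the nonnegativity of the right-hand side is left.
  rcases eq_or_ne P.projAxis 0 with hP | hP
  · rw [(StokesPipe.Pipe.solvesSystem_iff_of_projAxis_eq_zero hn hP hν).1 huv, Prod.fst_zero,
      Prod.snd_zero, P.stokes.map_zero, norm_zero]
    norm_num
    positivity
  · have hc := StokesPipe.Pipe.inner_pos_of_stokes_eq hn hP hw
    have hC₁0 : 0 < C₁ := hC₁ ▸ Real.sqrt_pos.2 hc
    have hC₁2 : inner ℝ (P.stokes w) (w : P.H) = C₁ ^ 2 := by rw [hC₁, Real.sq_sqrt hc.le]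
    have hm := hF C₀ C₁ (hC₀ ▸ norm_nonneg _) hC₁0 P hP w hw hC₀.symm hC₁2
    have := huv.norm_sq_le hT hν hk hP hw (by positivity) hC₁2 hm
    rw [← hC₀] at this
    exact this
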